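/- Let $\mu,\sigma>0$ and $f\in H^3(\mathbb{R})$ (real valued, identified with its continuous, in fact $C^2$, representative). Set $$\Omega^\pm:=\{(x_1,x_2)\in\mathbb{R}^2: x_2\gtrless f(x_1)\},\qquad \Gamma:=\partial\Omega^\pm=\{\Xi(\xi):\xi\in\mathbb{R}\},\quad \Xi(\xi):=(\xi,f(\xi)),$$ $$\omega:=(1+f'^2)^{1/2},\quad \nu:=\omega^{-1}(-f',1)^\top,\quad \kappa:=\omega^{-3}f'',\quad g=(g_1,g_2)^\top:=(\omega^{-1}-1,\ \omega^{-1}f')^\top.$$ For functions $z^\pm$ on $\Omega^\pm$ having limits at $y\in\Gamma$ let $[z](y):=\lim_{\Omega^+\ni x\to y}z^+(x)-\lim_{\Omega^-\ni x\to y}z^-(x)$, and let $T_{ij}(v,q):=-q\delta_{ij}+\mu(\partial_iv_j+\partial_jv_i)$. Consider the problem of finding $$(v^\pm,q^\pm)\in\big(C^2(\Omega^\pm,\mathbb{R}^2)\cap C^1(\overline{\Omega^\pm},\mathbb{R}^2)\big)\times\big(C^1(\Omega^\pm)\cap C(\overline{\Omega^\pm})\big)$$ (where $C^1(\overline{\Omega^\pm})$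 means that the function and its first derivatives extend continuously from $\Omega^\pm$ to $\overline{\Omega^\pm}$) such that $$\begin{array}{rcll}\mu\Delta v^\pm-\nabla q^\pm&=&0&\text{in }\Omega^\pm,\\ \operatorname{div}v^\pm&=&0&\text{in }\Omega^\pm,\\ v^+&=&v^-&\text{on }\Gamma,\\ {}[T(v,q)](\Xi(\xi))\,\nu(\xi)&=&-\sigma\kappa(\xi)\nu(\xi)&\text{for all }\xi\in\mathbb{R},\\ (v^\pm,q^\pm)(x)&\to&0&\text{for }|x|\to\infty,\ x\in\Omega^\pm.\end{array}\tag{1}$$ For $k=1,2$ and $y\in\mathbb{R}^2\setminus\{0\}$ let $$\mathcal{U}^k_j(y):=-\frac{1}{4\pi\mu}\Big(\delta_{jk}\ln\frac1{|y|}+\frac{y_jy_k}{|y|^2}\Big)\ (j=1,2),\qquad \mathcal{P}^k(y):=-\frac1{2\pi}\frac{y_k}{|y|^2},\qquad M(y):=-\sigma\begin{pmatrix}\mathcal{U}^1&\mathcal{U}^2\\ \mathcal{P}^1&\mathcal{P}^2\end{pmatrix}(y).$$ Then for every $x\in\mathbb{R}^2\setminus\Gamma$ the integrals $$v(x):=\sigma\int_{\mathbb{R}}\sum_{k=1}^2\partial_s\big(\mathcal{U}^k(x-(s,f(s)))\big)g_k(s)\,ds,\qquad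 q(x):=-\sigma\int_{\mathbb{R}}\sum_{k=1}^2\mathcal{P}^k(x-(s,f(s)))\,g_k'(s)\,ds$$ exist (the integrands are absolutely integrable) and, with $r:=x-(s,f(s))$, $$(v,q)^\top(x)=-\int_{\mathbb{R}}\partial_s[M(r)]g(s)\,ds=\int_{\mathbb{R}}\big(\partial_1M(r)+f'(s)\partial_2M(r)\big)g(s)\,ds,$$ where these integrands are absolutely integrable, too. Moreover, $(v^\pm,q^\pm):=(v,q)|_{\Omega^\pm}$ is a solution of (1), and it is the only one: any solution $(w^\pm,p^\pm)$ of (1) in the above class satisfies $w^\pm=v$ and $p^\pm=q$ in $\Omega^\pm$. -/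

import Mathlib

open MeasureTheory Filter Topology

namespace StokesGraph

/-- The plane with its Euclidean norm; the coordinates `x₁, x₂` are `x 0, x 1`. -/
abbrev Plane : Type := EuclideanSpace ℝ (Fin 2)

/-- The partial derivative `∂ᵢ u`. -/
noncomputable def pd {F : Type*} [NormedAddCommGroup F] [NormedSpace ℝ F]
    (i : Fin 2) (u : Plane → F) (x : Plane) : F :=
  fderiv ℝ u x (EuclideanSpace.single i 1)

/-- A real function belongs to `Hˢ(ℝ)`, `s ≥ 0`: it is square integrable and the tempered distribution it
defines lies in the Bessel potential space of order `s` over `L²`. -/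
def MemH (s : ℝ) (f : ℝ → ℝ) : Prop :=
  ∃ h : MemLp (fun t => (f t : ℂ)) 2 (volume : Measure ℝ),
    TemperedDistribution.MemSobolev s 2 (Lp.toTemperedDistribution h.toLp)

section Geometry

/-- The parametrization `Ξ(s) = (s, f s)` of the interface. -/
noncomputable def Xi (f : ℝ → ℝ) (s : ℝ) : Plane := !₂[s, f s]

/-- The interface `Γ`, the graph of `f`. -/
def Gam (f : ℝ → ℝ) : Set Plane := Set.range (Xi f)

/-- The domain `Ω⁺` above the graph. -/
def OmegaPlus (f : ℝ → ℝ) : Set Plane := {x | f (x 0) < x 1}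

/-- The domain `Ω⁻` below the graph. -/
def OmegaMinus (f : ℝ → ℝ) : Set Plane := {x | x 1 < f (x 0)}

/-- `ω = (1 + f'²)^{1/2}`. -/
noncomputable def omega (f : ℝ → ℝ) (s : ℝ) : ℝ := √(1 + deriv f s ^ 2)

/-- The unit normal `ν = ω⁻¹ (-f', 1)` exterior to `Ω⁻`, pulled back to `ℝ`. -/
noncomputable def nu (f : ℝ → ℝ) (s : ℝ) : Plane := (omega f s)⁻¹ • !₂[-deriv f s, 1]

/-- The curvature `κ = ω⁻³ f''` of the interface, pulled back to `ℝ`. -/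
noncomputable def kappa (f : ℝ → ℝ) (s : ℝ) : ℝ := deriv (deriv f) s / omega f s ^ 3

/-- The density `g = (ω⁻¹ - 1, ω⁻¹ f')`; `g f 0` and `g f 1` are its two components. -/
noncomputable def g (f : ℝ → ℝ) (k : Fin 2) (s : ℝ) : ℝ :=
  ![(omega f s)⁻¹ - 1, (omega f s)⁻¹ * deriv f s] k

end Geometry

section Problem

/-- `u`, of which only the values on `Ω` matter, extends continuously to `closure Ω`. -/
def ExtendsCont {F : Type*} [TopologicalSpace F] (Ω : Set Plane) (u : Plane → F) : Prop :=
  ∃ U : Plane → F, ContinuousOn U (closure Ω) ∧ Set.EqOn U u Ω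

/-- `zp` (on `Ωp`) and `zm` (on `Ωm`) have limits at `y`, and their jump `[z](y)`, the limit from
`Ωp` minus the limit from `Ωm`, equals `J`. -/
def HasJump {F : Type*} [TopologicalSpace F] [Sub F] (Ωp Ωm : Set Plane) (zp zm : Plane → F)
    (y : Plane) (J : F) : Prop :=
  ∃ a b : F, Tendsto zp (𝓝[Ωp] y) (𝓝 a) ∧ Tendsto zm (𝓝[Ωm] y) (𝓝 b) ∧ J = a - b

/-- The divergence of a vector field. -/
noncomputable def divergence (v : Plane → Plane) (x : Plane) : ℝ := ∑ i, pd i v x i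

/-- The stress tensor `T(v, q)ᵢⱼ = -q δᵢⱼ + μ (∂ᵢ vⱼ + ∂ⱼ vᵢ)`. -/
noncomputable def stress (μ : ℝ) (v : Plane → Plane) (q : Plane → ℝ) (x : Plane) :
    Matrix (Fin 2) (Fin 2) ℝ :=
  Matrix.of fun i j => -q x * (if i = j then 1 else 0) + μ * (pd i v x j + pd j v x i)

/-- `(v, q)` has the regularity
`(C²(Ω) ∩ C¹(closure Ω)) × (C¹(Ω) ∩ C(closure Ω))` and solves the homogeneous Stokes system in the
open set `Ω`, and `(v, q)(x) → 0` as `|x| → ∞` within `Ω`. -/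
structure IsStokesPhase (μ : ℝ) (Ω : Set Plane) (v : Plane → Plane) (q : Plane → ℝ) : Prop where
  contDiffOn_v : ContDiffOn ℝ 2 v Ω
  extends_v : ExtendsCont Ω v
  extends_Dv : ExtendsCont Ω (fderiv ℝ v)
  contDiffOn_q : ContDiffOn ℝ 1 q Ω
  extends_q : ExtendsCont Ω q
  momentum : ∀ x ∈ Ω, μ • Laplacian.laplacian v x - gradient q x = 0
  incompressible : ∀ x ∈ Ω, divergence v x = 0
  decay_v : Tendsto v (Bornology.cobounded Plane ⊓ 𝓟 Ω) (𝓝 0)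
  decay_q : Tendsto q (Bornology.cobounded Plane ⊓ 𝓟 Ω) (𝓝 0)

/-- `(v⁺, v⁻, q⁺, q⁻)` is a classical solution of the two-phase Stokes problem with fixed interface
`Γ = graph f`, viscosity `μ` and surface tension `σ`. Only the values of `v⁺, q⁺` on `Ω⁺` and of
`v⁻, q⁻` on `Ω⁻` matter. -/
structure IsSolution (f : ℝ → ℝ) (μ σ : ℝ) (vp vm : Plane → Plane) (qp qm : Plane → ℝ) :
    Prop where
  upper : IsStokesPhase μ (OmegaPlus f) vp qp
  lower : IsStokesPhase μ (OmegaMinus f) vm qm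
  /-- `v⁺ = v⁻` on `Γ`. -/
  velocity_jump : ∀ ξ : ℝ, HasJump (OmegaPlus f) (OmegaMinus f) vp vm (Xi f ξ) 0
  /-- `[T(v, q)] ν = -σ κ ν` on `Γ`. -/
  stress_jump : ∀ ξ : ℝ, ∃ J : Matrix (Fin 2) (Fin 2) ℝ,
    HasJump (OmegaPlus f) (OmegaMinus f) (stress μ vp qp) (stress μ vm qm) (Xi f ξ) J ∧
    ∀ i, ∑ j, J i j * nu f ξ j = -σ * (kappa f ξ * nu f ξ i)

end Problem

section Potential

/-- The velocity part `𝒰ᵏ` of the fundamental solution of the Stokes equations,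
`𝒰ᵏⱼ(y) = -(4πμ)⁻¹ (δⱼₖ ln(1/|y|) + yⱼ yₖ / |y|²)`. -/
noncomputable def U (μ : ℝ) (k : Fin 2) (y : Plane) : Plane :=
  WithLp.toLp 2 fun j =>
    -(1 / (4 * Real.pi * μ)) *
      ((if j = k then 1 else 0) * Real.log (1 / ‖y‖) + y j * y k / ‖y‖ ^ 2)

/-- The pressure part `𝒫ᵏ(y) = -(2π)⁻¹ yₖ / |y|²` of the fundamental solution. -/
noncomputable def P (k : Fin 2) (y : Plane) : ℝ :=
  -(1 / (2 * Real.pi)) * (y k / ‖y‖ ^ 2)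

/-- The integrand `∑ₖ ∂ₛ(𝒰ᵏ(x - (s, f s))) gₖ(s)` of the velocity potential. -/
noncomputable def velocityIntegrand (f : ℝ → ℝ) (μ : ℝ) (x : Plane) (s : ℝ) : Plane :=
  ∑ k, g f k s • deriv (fun t => U μ k (x - Xi f t)) s

/-- The integrand `∑ₖ 𝒫ᵏ(x - (s, f s)) gₖ'(s)` of the pressure potential. -/
noncomputable def pressureIntegrand (f : ℝ → ℝ) (x : Plane) (s : ℝ) : ℝ :=
  ∑ k, P k (x - Xi f s) * deriv (g f k) s

/-- The velocity of the hydrodynamic single-layer potential,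
`v(x) = σ ∫ ∑ₖ ∂ₛ(𝒰ᵏ(x - (s, f s))) gₖ(s) ds`. -/
noncomputable def velocity (f : ℝ → ℝ) (μ σ : ℝ) (x : Plane) : Plane :=
  σ • ∫ s, velocityIntegrand f μ x s

/-- The pressure of the hydrodynamic single-layer potential,
`q(x) = -σ ∫ ∑ₖ 𝒫ᵏ(x - (s, f s)) gₖ'(s) ds`. -/
noncomputable def pressure (f : ℝ → ℝ) (σ : ℝ) (x : Plane) : ℝ :=
  -σ * ∫ s, pressureIntegrand f x s

/-- The `k`-th column `-σ (𝒰ᵏ, 𝒫ᵏ)` of the matrix `M`. -/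
noncomputable def M (μ σ : ℝ) (k : Fin 2) (y : Plane) : Plane × ℝ := -σ • (U μ k y, P k y)

/-- The integrand `∂ₛ[M(r)] g(s)` with `r = x - (s, f s)`. -/
noncomputable def repIntegrand (f : ℝ → ℝ) (μ σ : ℝ) (x : Plane) (s : ℝ) : Plane × ℝ :=
  ∑ k, g f k s • deriv (fun t => M μ σ k (x - Xi f t)) s

/-- The integrand `(∂₁M(r) + f'(s) ∂₂M(r)) g(s)` with `r = x - (s, f s)`. -/
noncomputable def repIntegrand' (f : ℝ → ℝ) (μ σ : ℝ) (x : Plane) (s : ℝ) : Plane × ℝ :=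
  ∑ k, g f k s •
    (pd 0 (M μ σ k) (x - Xi f s) + deriv f s • pd 1 (M μ σ k) (x - Xi f s))

end Potential

end StokesGraph

/-!
The potential. By the formula `g' = κ ω ν` and integration by parts along the graph, the components of
`v`, of all `∂ₗ v` and of `q` are finite sums of integrals `∫ φ(s) K(x - (s, f s)) ds` with kernels `K`
that are homogeneous of degree `-1`, namely `∂ₗ 𝒰ᵏⱼ` and `𝒫ᵏ`, and densities `φ ∈ {gₖ, gₖ f', gₖ'}`.
These kernels are smooth off the origin and square integrable along the graph, so that the integrals
converge and may be differentiated (`IsHomKernel.hasFDerivAt_potK`), and the Stokes system off the graph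
follows from that of the fundamental solution.

The boundary behaviour uses only that the densities belong to `H¹(ℝ)`, which follows from
`f', f'' ∈ H¹(ℝ)` (`MemH.regularity`). Identify the plane with `ℂ`. Then every kernel `K` is
`Re (a / z + b conj z / z²)` for constants `a, b` (`pd_U_eq`, `P_eq`), and two complex integrals over the
graph remain.
* The Cauchy integral: subtracting its value at the point translated vertically by one and integrating
  by parts leaves an integral with a logarithmic kernel (`IsInterface.cauchyC_eq`). The kernels are
  bounded in `L²` up to the graph, and the limits at the graph and at infinity follow from the
  convergence theorem `tendsto_integral_mul_of_L2_bounded`. The jump is the one of Plemelj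
  (`IsInterface.cauchyBdry_jump`).
* The integral with kernel `conj z / z²`: since `conj z / z` is bounded, it differs from the Cauchy
  integral of a modified density by a term that is continuous across the graph
  (`IsInterface.exists_tendsto_regC`).

The resulting jump of `∂ₗ 𝒰ᵏⱼ` is `μ⁻¹ νₗ (δⱼₖ - νⱼ νₖ) φ / ω` and that of `𝒫ᵏ` is `-νₖ φ / ω`
(`jump_pd_U`, `jump_P`). The first one annihilates the tangential derivative of `𝒰ᵏ`, so that `[v] = 0`,
and it annihilates the normal density `g' = κ ω ν`, so that `[∂ₗ v] = 0`. The second one gives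
`[q] = σ κ`.

Uniqueness. The difference of two solutions is a flow without surface forces. By the divergence theorem
on both sides of the graph, it satisfies the Stokes system on the whole plane in the weak sense
(`BrokenFlow.weak_divergence`, `BrokenFlow.weak_momentum`), and its mollifications satisfy it in the
classical sense. The mollified pressure is therefore an entire harmonic function which vanishes at
infinity, hence zero by the maximum principle (`eq_zero_of_harmonic`); then the same holds for the
components of the velocity.
-/

open scoped ContDiff ComplexConjugate

namespace StokesGraph

/-! ### Weak derivatives on the line -/

/-- Primitives of complex valued integrable functions are absolutely continuous. -/
lemma absolutelyContinuous_primitive {ψ : ℝ → ℂ} {a b : ℝ}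
    (h : IntervalIntegrable ψ volume a b) :
    AbsolutelyContinuousOnInterval (fun x => ∫ v in a..x, ψ v) a b := by
  have hre : IntervalIntegrable (fun t => (ψ t).re) volume a b := ⟨h.1.re, h.2.re⟩
  have him : IntervalIntegrable (fun t => (ψ t).im) volume a b := ⟨h.1.im, h.2.im⟩
  have h1 := hre.absolutelyContinuousOnInterval_intervalIntegral (c := a) (by simp)
  have h2 := him.absolutelyContinuousOnInterval_intervalIntegral (c := a) (by simp)
  have c1 : AbsolutelyContinuousOnInterval (fun _ : ℝ => (1 : ℂ)) a b :=
    (contDiffOn_const).absolutelyContinuousOnInterval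
  have c2 : AbsolutelyContinuousOnInterval (fun _ : ℝ => Complex.I) a b :=
    (contDiffOn_const).absolutelyContinuousOnInterval
  have h3 := (h1.smul c1).add (h2.smul c2)
  rw [absolutelyContinuousOnInterval_iff] at h3 ⊢
  intro ε hε
  obtain ⟨δ, hδ, H⟩ := h3 ε hε
  refine ⟨δ, hδ, fun E hE hs => ?_⟩
  have key : ∀ x ∈ Set.uIcc a b, ((fun x : ℝ => ∫ t in a..x, (ψ t).re) • (fun _ : ℝ => (1 : ℂ)) +
      (fun x : ℝ => ∫ t in a..x, (ψ t).im) • (fun _ : ℝ => Complex.I)) x =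
        ∫ v in a..x, ψ v := by
    intro x hx
    have hi : IntervalIntegrable ψ volume a x := h.mono_set (Set.uIcc_subset_uIcc_left hx)
    have e1 : ∫ t in a..x, (ψ t).re = (∫ t in a..x, ψ t).re := by
      rcases le_total a x with hax | hax
      · simp only [intervalIntegral.integral_of_le hax]; exact integral_re hi.1
      · simp only [intervalIntegral.integral_of_ge hax, Complex.neg_re]
        exact congrArg Neg.neg (integral_re hi.2)
    have e2 : ∫ t in a..x, (ψ t).im = (∫ t in a..x, ψ t).im := by
      rcases le_total a x with hax | hax
      · simp only [intervalIntegral.integral_of_le hax]; exact integral_im hi.1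
      · simp only [intervalIntegral.integral_of_ge hax, Complex.neg_im]
        exact congrArg Neg.neg (integral_im hi.2)
    simp only [Pi.add_apply, Pi.smul_apply', e1, e2]
    simp [Complex.re_add_im]
  have := H E hE hs
  refine lt_of_le_of_lt (le_of_eq (Finset.sum_congr rfl fun i hi => ?_)) this
  obtain ⟨hh, -⟩ := hE
  rw [key _ (hh i hi).1, key _ (hh i hi).2]

/-- The product rule for a primitive `θ` of an integrable function and a `C¹` function `B`. -/
lemma primitive_mul_sub {θ ψ B B' : ℝ → ℂ} {a b : ℝ} (hψ : LocallyIntegrable ψ)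
    (hθ : ∀ a b, θ b - θ a = ∫ t in a..b, ψ t)
    (hB : ∀ s ∈ Set.uIcc a b, HasDerivAt B (B' s) s) (hB' : ContinuousOn B' (Set.uIcc a b)) :
    θ b * B b - θ a * B a = ∫ t in a..b, (ψ t * B t + θ t * B' t) := by
  have hint : ∀ x y, IntervalIntegrable ψ volume x y := fun x y => by
    rw [intervalIntegrable_iff']
    exact hψ.integrableOn_isCompact isCompact_uIcc
  have hθe : θ = fun x => θ a + ∫ t in a..x, ψ t := by
    funext x; rw [← hθ a x]; ring
  have hθc : Continuous θ := by
    rw [hθe]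
    exact continuous_const.add (intervalIntegral.continuous_primitive hint a)
  have hBc : ContinuousOn B (Set.uIcc a b) := fun s hs => (hB s hs).continuousAt.continuousWithinAt
  have i1 : IntervalIntegrable (fun t => ψ t * B t + θ t * B' t) volume a b :=
    ((hint a b).mul_continuousOn hBc).add (hθc.continuousOn.mul hB').intervalIntegrable
  have acθ : AbsolutelyContinuousOnInterval θ a b := by
    rw [hθe]
    exact ((contDiffOn_const).absolutelyContinuousOnInterval (f := fun _ => θ a)).add
      (absolutelyContinuous_primitive (hint a b))
  have acB : AbsolutelyContinuousOnInterval B a b := by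
    rcases eq_or_ne a b with rfl | hab
    · rw [absolutelyContinuousOnInterval_iff]
      intro ε hε
      refine ⟨1, one_pos, fun E hE _ => ?_⟩
      obtain ⟨hh, -⟩ := hE
      rw [Finset.sum_eq_zero]
      · exact hε
      · intro i hi
        have h1 := (hh i hi).1
        have h2 := (hh i hi).2
        simp only [Set.uIcc_self, Set.mem_singleton_iff] at h1 h2
        simp [h1, h2]
    · refine ContDiffOn.absolutelyContinuousOnInterval ?_
      have hu : UniqueDiffOn ℝ (Set.uIcc a b) := uniqueDiffOn_uIcc hab
      rw [show (1 : WithTop ℕ∞) = 0 + 1 by simp, contDiffOn_succ_iff_derivWithin hu]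
      refine ⟨fun s hs => (hB s hs).differentiableAt.differentiableWithinAt, by simp, ?_⟩
      rw [contDiffOn_zero]
      exact hB'.congr fun s hs => (hB s hs).hasDerivWithinAt.derivWithin (hu s hs)
  have acF : AbsolutelyContinuousOnInterval (fun x => θ x * B x -
      ∫ t in a..x, (ψ t * B t + θ t * B' t)) a b :=
    (acθ.smul acB).sub (absolutelyContinuous_primitive i1)
  have hd : ∀ᵐ x, x ∈ Set.uIcc a b → HasDerivAt (fun x => θ x * B x -
      ∫ t in a..x, (ψ t * B t + θ t * B' t)) 0 x := by
    filter_upwards [LocallyIntegrable.ae_hasDerivAt_integral hψ, i1.ae_hasDerivAt_integral] with x h1 h2 hx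
    have h3 : HasDerivAt θ (ψ x) x := by
      rw [hθe]; simpa using (h1 a).const_add (θ a)
    have h4 := (h3.fun_mul (hB x hx)).fun_sub (h2 hx a (by simp))
    rwa [sub_self] at h4
  obtain ⟨C, hC⟩ := acF.const_of_ae_hasDerivAt_zero hd
  have e1 := hC a (by simp)
  have e2 := hC b (by simp)
  simp only [intervalIntegral.integral_same] at e1
  rw [← e1] at e2
  linear_combination e2

/-- An integrable function on a left half-line with integrable weak derivative tends to zero
at infinity, so that its value at the end point is the integral of the derivative. -/
lemma integral_Iic_of_sub {F G : ℝ → ℂ} {c : ℝ} (h : ∀ a ≤ c, F c - F a = ∫ t in a..c, G t)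
    (hF : IntegrableOn F (Set.Iic c)) (hG : IntegrableOn G (Set.Iic c)) :
    ∫ t in Set.Iic c, G t = F c := by
  have t1 := intervalIntegral_tendsto_integral_Iic c hG tendsto_id
  have t2 : Tendsto F atBot (𝓝 (F c - ∫ t in Set.Iic c, G t)) := by
    refine (tendsto_const_nhds.sub t1).congr' ?_
    filter_upwards [eventually_le_atBot c] with a ha
    simp only [id, ← h a ha]; ring
  by_contra hne
  have hpos : 0 < ‖F c - ∫ t in Set.Iic c, G t‖ := by
    rw [norm_pos_iff, sub_ne_zero]; exact fun h => hne h.symm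
  obtain ⟨N, hN⟩ := eventually_atBot.1 (t2.norm.eventually (lt_mem_nhds (half_lt_self hpos)))
  have hi : IntegrableOn (fun _ : ℝ => ‖F c - ∫ t in Set.Iic c, G t‖ / 2) (Set.Iic (min N c)) := by
    refine Integrable.mono (hF.mono_set (Set.Iic_subset_Iic.2 (min_le_right _ _)))
      aestronglyMeasurable_const ?_
    filter_upwards [ae_restrict_mem measurableSet_Iic] with t ht
    have := hN t (le_trans ht (min_le_left _ _))
    rw [Real.norm_of_nonneg (by positivity)]
    exact this.le
  rw [integrableOn_const_iff] at hi
  simp only [Real.volume_Iic, lt_self_iff_false, or_false] at hi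
  rw [enorm_eq_zero] at hi
  linarith

/-- The counterpart of `integral_Iic_of_sub` on a right half-line. -/
lemma integral_Ioi_of_sub {F G : ℝ → ℂ} {c : ℝ} (h : ∀ b ≥ c, F b - F c = ∫ t in c..b, G t)
    (hF : IntegrableOn F (Set.Ioi c)) (hG : IntegrableOn G (Set.Ioi c)) :
    ∫ t in Set.Ioi c, G t = -F c := by
  have key := integral_Iic_of_sub (F := fun t => F (-t)) (G := fun t => -G (-t)) (c := -c)
    (fun a ha => by
      have := h (-a) (by linarith)
      simp only [neg_neg, intervalIntegral.integral_neg, intervalIntegral.integral_comp_neg]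
      rw [← this]; ring) ?_ ?_
  · have e := integral_comp_neg_Iic (-c) G
    rw [neg_neg] at e
    simp only [neg_neg, integral_neg, e] at key
    rw [← key, neg_neg]
  · have h2 := ((Measure.measurePreserving_neg (volume : Measure ℝ)).integrableOn_comp_preimage
      (Homeomorph.neg ℝ).measurableEmbedding (s := Set.Ici c) (f := F)).2
      ((integrableOn_Ici_iff_integrableOn_Ioi (by finiteness)).2 hF)
    simpa [Function.comp_def] using h2
  · have h2 := ((Measure.measurePreserving_neg (volume : Measure ℝ)).integrableOn_comp_preimage
      (Homeomorph.neg ℝ).measurableEmbedding (s := Set.Ici c) (f := G)).2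
      ((integrableOn_Ici_iff_integrableOn_Ioi (by finiteness)).2 hG)
    simpa [Function.comp_def] using h2.neg

/-! ### Densities of Sobolev class `H¹` -/

/-- `θ` is a square integrable function on the line with square integrable weak derivative `ψ`,
given by its continuous representative. -/
structure SobH1 (θ ψ : ℝ → ℂ) : Prop where
  memLp : MemLp θ 2
  memLp_deriv : MemLp ψ 2
  sub_eq : ∀ a b, θ b - θ a = ∫ t in a..b, ψ t

lemma locallyIntegrable_of_memLp_two {ψ : ℝ → ℂ} (h : MemLp ψ 2) : LocallyIntegrable ψ :=
  h.locallyIntegrable (by norm_num)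

lemma integrable_mul_of_memLp_two {u v : ℝ → ℂ} (hu : MemLp u 2) (hv : MemLp v 2) :
    Integrable fun t => u t * v t :=
  hu.integrable_mul hv

lemma SobH1.continuous {θ ψ : ℝ → ℂ} (h : SobH1 θ ψ) : Continuous θ := by
  have hi := locallyIntegrable_of_memLp_two h.memLp_deriv
  have : θ = fun x => θ 0 + ∫ t in (0:ℝ)..x, ψ t := by
    funext x; rw [← h.sub_eq 0 x]; ring
  rw [this]
  refine continuous_const.add (intervalIntegral.continuous_primitive (fun x y => ?_) 0)
  rw [intervalIntegrable_iff']
  exact hi.integrableOn_isCompact isCompact_uIcc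

/-- A function of class `H¹` is bounded: compare `θ x` with the values of `θ` on `[x, x + 1]`. -/
lemma SobH1.bounded {θ ψ : ℝ → ℂ} (h : SobH1 θ ψ) : ∃ C, ∀ x, ‖θ x‖ ≤ C := by
  have hθ2 : Integrable fun t => ‖θ t‖ ^ 2 := h.memLp.integrable_norm_pow (by norm_num)
  have hψ2 : Integrable fun t => ‖ψ t‖ ^ 2 := h.memLp_deriv.integrable_norm_pow (by norm_num)
  have hψl := locallyIntegrable_of_memLp_two h.memLp_deriv
  refine ⟨(∫ t, ‖θ t‖ ^ 2) + (∫ t, ‖ψ t‖ ^ 2) + 2, fun x => ?_⟩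
  have hψx : IntegrableOn (fun t => ‖ψ t‖) (Set.Ioc x (x + 1)) :=
    ((LocallyIntegrable.integrableOn_isCompact hψl
      (isCompact_Icc (a := x) (b := x + 1))).mono_set Set.Ioc_subset_Icc_self).norm
  have b1 : ∫ t in Set.Ioc x (x + 1), ‖ψ t‖ ≤ (∫ t, ‖ψ t‖ ^ 2) + 1 := by
    calc ∫ t in Set.Ioc x (x + 1), ‖ψ t‖ ≤ ∫ t in Set.Ioc x (x + 1), (‖ψ t‖ ^ 2 + 1) := by
          refine integral_mono hψx (hψ2.integrableOn.add (by simp [integrableOn_const_iff])) ?_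
          intro t; simp only; nlinarith [sq_nonneg (‖ψ t‖ - 1)]
      _ = (∫ t in Set.Ioc x (x + 1), ‖ψ t‖ ^ 2) + 1 := by
          rw [integral_add hψ2.integrableOn (by simp)]; simp
      _ ≤ _ := by
          linarith [setIntegral_le_integral (s := Set.Ioc x (x + 1)) hψ2
            (ae_of_all _ fun _ => by positivity)]
  have b2 : ∀ y ∈ Set.Ioc x (x + 1), ‖θ x‖ ≤ ‖θ y‖ ^ 2 + 1 + ((∫ t, ‖ψ t‖ ^ 2) + 1) := by
    intro y hy
    have e := h.sub_eq x y
    have : ‖∫ t in x..y, ψ t‖ ≤ ∫ t in Set.Ioc x (x + 1), ‖ψ t‖ := by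
      refine (intervalIntegral.norm_integral_le_integral_norm hy.1.le).trans ?_
      rw [intervalIntegral.integral_of_le hy.1.le]
      exact setIntegral_mono_set hψx (ae_of_all _ fun _ => norm_nonneg _)
        (Set.Ioc_subset_Ioc_right hy.2).eventuallyLE
    have e2 : θ x = θ y - ∫ t in x..y, ψ t := by rw [← e]; ring
    have e3 : ‖θ x‖ ≤ ‖θ y‖ + ‖∫ t in x..y, ψ t‖ := by rw [e2]; exact norm_sub_le _ _
    nlinarith [sq_nonneg (‖θ y‖ - 1)]
  have b3 : ∫ y in Set.Ioc x (x + 1), ‖θ x‖ ≤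
      ∫ y in Set.Ioc x (x + 1), (‖θ y‖ ^ 2 + (1 + ((∫ t, ‖ψ t‖ ^ 2) + 1))) := by
    refine setIntegral_mono_on (by simp [integrableOn_const_iff])
      (hθ2.integrableOn.add (by simp [integrableOn_const_iff])) measurableSet_Ioc fun y hy => ?_
    linarith [b2 y hy]
  rw [integral_add hθ2.integrableOn (by simp)] at b3
  have b4 : ∫ t in Set.Ioc x (x + 1), ‖θ t‖ ^ 2 ≤ ∫ t, ‖θ t‖ ^ 2 :=
    setIntegral_le_integral hθ2 (ae_of_all _ fun _ => by positivity)
  simp at b3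
  linarith

/-- The class `H¹` is stable under multiplication by bounded `C¹` functions with bounded
derivative. -/
lemma SobH1.mul {θ ψ B B' : ℝ → ℂ} (h : SobH1 θ ψ) (hB : ∀ s, HasDerivAt B (B' s) s)
    (hB' : Continuous B') {C : ℝ} (hb : ∀ s, ‖B s‖ ≤ C) (hb' : ∀ s, ‖B' s‖ ≤ C) :
    SobH1 (fun s => θ s * B s) (fun s => ψ s * B s + θ s * B' s) := by
  have hBc : Continuous B := continuous_iff_continuousAt.2 fun s => (hB s).continuousAt
  have m : ∀ {u v : ℝ → ℂ}, MemLp u 2 → Continuous v → (∀ s, ‖v s‖ ≤ C) →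
      MemLp (fun s => u s * v s) 2 := by
    intro u v hu hv hC
    refine (hu.const_mul (C : ℂ)).mono (hu.1.mul hv.aestronglyMeasurable)
      (ae_of_all _ fun s => ?_)
    have : 0 ≤ C := (norm_nonneg _).trans (hC 0)
    rw [norm_mul, norm_mul, mul_comm, Complex.norm_real, Real.norm_of_nonneg this]
    gcongr; exact hC s
  refine ⟨m h.memLp hBc hb, (m h.memLp_deriv hBc hb).add (m h.memLp hB' hb'), fun a b => ?_⟩
  exact primitive_mul_sub (locallyIntegrable_of_memLp_two h.memLp_deriv) h.sub_eq
    (fun s _ => hB s) hB'.continuousOn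

/-- Integration by parts on the line against a `C¹` function for which all products are
integrable. -/
lemma SobH1.integral_mul_deriv {θ ψ B B' : ℝ → ℂ} (h : SobH1 θ ψ)
    (hB : ∀ s, HasDerivAt B (B' s) s) (hB' : Continuous B') (i0 : Integrable fun s => θ s * B s)
    (i1 : Integrable fun s => ψ s * B s) (i2 : Integrable fun s => θ s * B' s) :
    ∫ s, θ s * B' s = -∫ s, ψ s * B s := by
  have hp : ∀ a b, θ b * B b - θ a * B a = ∫ t in a..b, (ψ t * B t + θ t * B' t) := fun a b =>
    primitive_mul_sub (locallyIntegrable_of_memLp_two h.memLp_deriv) h.sub_eq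
      (fun s _ => hB s) hB'.continuousOn
  have e1 := integral_Iic_of_sub (F := fun t => θ t * B t) (c := 0) (fun a _ => hp a 0)
    i0.integrableOn (i1.add i2).integrableOn
  have e2 := integral_Ioi_of_sub (F := fun t => θ t * B t) (c := 0) (fun b _ => hp 0 b)
    i0.integrableOn (i1.add i2).integrableOn
  have e3 := intervalIntegral.integral_Iic_add_Ioi (b := (0:ℝ)) (i1.add i2).integrableOn
    (i1.add i2).integrableOn
  simp only [Pi.add_apply] at e1 e2 e3
  rw [e1, e2, integral_add i1 i2] at e3
  linear_combination -e3

/-! ### Weak convergence in `L²` -/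

/-- Integrals of an `L²` function against a bounded family in `L²` that converges almost everywhere
converge. The part of the integral where the member `k i` of the family exceeds `N ‖ψ‖` is at most
`C / N`, and the remaining part converges by dominated convergence. -/
theorem tendsto_integral_mul_of_L2_bounded {ι : Type*} {l : Filter ι} [l.IsCountablyGenerated]
    {ψ : ℝ → ℂ} (hψ : MemLp ψ 2) {k : ι → ℝ → ℂ} {k0 : ℝ → ℂ} {C : ℝ}
    (hk : ∀ᶠ i in l, MemLp (k i) 2 ∧ ∫ s, ‖k i s‖ ^ 2 ≤ C)
    (hk0 : MemLp k0 2) (hlim : ∀ᵐ s, Tendsto (fun i => k i s) l (𝓝 (k0 s))) :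
    Tendsto (fun i => ∫ s, ψ s * k i s) l (𝓝 (∫ s, ψ s * k0 s)) := by
  have hψ2 : Integrable fun t => ‖ψ t‖ ^ 2 := hψ.integrable_norm_pow (by norm_num)
  set D : ℝ := max C (∫ s, ‖k0 s‖ ^ 2) with hD
  -- the clipped kernel has modulus at most `N ‖ψ‖`
  let cl : ℝ → ℂ → ℂ → ℂ := fun N p z => (((N * ‖p‖) / max (N * ‖p‖) ‖z‖ : ℝ) : ℂ) * z
  have cl_le : ∀ N p z, 0 ≤ N → ‖cl N p z‖ ≤ N * ‖p‖ := by
    intro N p z hN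
    have h0 : 0 ≤ N * ‖p‖ := by positivity
    rcases eq_or_lt_of_le (le_max_of_le_left h0 : 0 ≤ max (N * ‖p‖) ‖z‖) with h | h
    · simp only [cl, ← h, div_zero]; simpa using h0
    · simp only [cl, norm_mul, Complex.norm_real]
      rw [Real.norm_of_nonneg (by positivity), div_mul_eq_mul_div, div_le_iff₀ h]
      gcongr; exact le_max_right _ _
  have cl_err : ∀ N p z, 0 < N → ‖p * z - p * cl N p z‖ ≤ ‖z‖ ^ 2 / N := by
    intro N p z hN
    have h0 : 0 ≤ N * ‖p‖ := by positivity
    rcases le_or_gt ‖z‖ (N * ‖p‖) with h | h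
    · rcases eq_or_lt_of_le h0 with h' | h'
      · have : z = 0 := by rw [← h'] at h; simpa using h
        simp [this, cl]
      · simp only [cl, max_eq_left h, div_self h'.ne']
        simp; positivity
    · have hz : 0 < ‖z‖ := h0.trans_lt h
      simp only [cl, max_eq_right h.le]
      have : p * z - p * (((N * ‖p‖ / ‖z‖ : ℝ) : ℂ) * z) =
          ((1 - N * ‖p‖ / ‖z‖ : ℝ) : ℂ) * (p * z) := by push_cast; ring
      rw [this, norm_mul, Complex.norm_real, norm_mul, Real.norm_of_nonneg]
      · calc (1 - N * ‖p‖ / ‖z‖) * (‖p‖ * ‖z‖) ≤ 1 * (‖p‖ * ‖z‖) := by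
              gcongr; linarith [show 0 ≤ N * ‖p‖ / ‖z‖ by positivity]
          _ ≤ ‖z‖ ^ 2 / N := by
              rw [le_div_iff₀ hN]; nlinarith
      · rw [sub_nonneg, div_le_one hz]; exact h.le
  have cl_meas : ∀ N, ∀ u : ℝ → ℂ, MemLp u 2 →
      AEStronglyMeasurable (fun s => ψ s * cl N (ψ s) (u s)) := by
    intro N u hu
    have h1 : AEMeasurable ψ := hψ.1.aemeasurable
    have h2 : AEMeasurable u := hu.1.aemeasurable
    refine (h1.mul (AEMeasurable.mul ?_ h2)).aestronglyMeasurable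
    exact Complex.measurable_ofReal.comp_aemeasurable
      ((h1.norm.const_mul N).div ((h1.norm.const_mul N).max h2.norm))
  have cl_int : ∀ N, 0 < N → ∀ u : ℝ → ℂ, MemLp u 2 →
      Integrable (fun s => ψ s * cl N (ψ s) (u s)) := by
    intro N hN u hu
    refine (hψ2.const_mul N).mono' (cl_meas N u hu) (ae_of_all _ fun s => ?_)
    rw [norm_mul]
    nlinarith [cl_le N (ψ s) (u s) hN.le, norm_nonneg (ψ s)]
  have err_int : ∀ N, 0 < N → ∀ u : ℝ → ℂ, MemLp u 2 → ∫ s, ‖u s‖ ^ 2 ≤ D →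
      ‖(∫ s, ψ s * u s) - ∫ s, ψ s * cl N (ψ s) (u s)‖ ≤ D / N := by
    intro N hN u hu hD
    have hu2 : Integrable fun t => ‖u t‖ ^ 2 := hu.integrable_norm_pow (by norm_num)
    rw [← integral_sub (integrable_mul_of_memLp_two hψ hu) (cl_int N hN u hu)]
    calc _ ≤ ∫ s, ‖u s‖ ^ 2 / N :=
          norm_integral_le_of_norm_le (hu2.div_const N) (ae_of_all _ fun s => cl_err N _ _ hN)
      _ ≤ D / N := by rw [integral_div]; gcongr
  have cl_tendsto : ∀ N, 0 < N → Tendsto (fun i => ∫ s, ψ s * cl N (ψ s) (k i s)) l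
      (𝓝 (∫ s, ψ s * cl N (ψ s) (k0 s))) := by
    intro N hN
    refine tendsto_integral_filter_of_dominated_convergence (fun s => N * ‖ψ s‖ ^ 2) ?_ ?_
      (hψ2.const_mul N) ?_
    · filter_upwards [hk] with i hi using cl_meas N _ hi.1
    · refine Eventually.of_forall fun i => ae_of_all _ fun s => ?_
      rw [norm_mul]
      nlinarith [cl_le N (ψ s) (k i s) hN.le, norm_nonneg (ψ s)]
    · filter_upwards [hlim] with s hs
      by_cases hp : ψ s = 0
      · simp [hp, tendsto_const_nhds]
      have hp' : 0 < ‖ψ s‖ := norm_pos_iff.2 hp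
      refine tendsto_const_nhds.mul (Tendsto.mul ?_ hs)
      refine (Complex.continuous_ofReal.tendsto _).comp ?_
      refine tendsto_const_nhds.div (tendsto_const_nhds.max hs.norm) ?_
      exact (lt_max_of_lt_left (by positivity)).ne'
  rw [Metric.tendsto_nhds]
  intro ε hε
  have hD0 : 0 ≤ D := le_max_of_le_right (integral_nonneg fun s => by positivity)
  obtain ⟨N, hN, hNε⟩ : ∃ N : ℝ, 0 < N ∧ D / N < ε / 3 := by
    refine ⟨3 * D / ε + 1, by positivity, ?_⟩
    rw [div_lt_iff₀ (by positivity)]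
    have : ε / 3 * (3 * D / ε + 1) = D + ε / 3 := by field_simp
    linarith
  filter_upwards [hk, (Metric.tendsto_nhds.1 (cl_tendsto N hN)) (ε / 3) (by positivity)]
    with i hi hi2
  have e1 := err_int N hN (k i) hi.1 (hi.2.trans (le_max_left _ _))
  have e2 := err_int N hN k0 hk0 (le_max_right _ _)
  rw [← dist_eq_norm] at e1 e2
  rw [dist_comm] at e2
  have := dist_triangle4 (∫ s, ψ s * k i s) (∫ s, ψ s * cl N (ψ s) (k i s))
    (∫ s, ψ s * cl N (ψ s) (k0 s)) (∫ s, ψ s * k0 s)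
  linarith

/-! ### Regularity of the interface -/

/-- A smooth compactly supported function on the line with vanishing integral is the derivative of
a smooth compactly supported function. -/
lemma exists_primitive_of_integral_eq_zero {G : ℝ → ℝ} (hG : ContDiff ℝ ∞ G)
    (hc : HasCompactSupport G) (h0 : ∫ t, G t = 0) :
    ∃ η : ℝ → ℝ, ContDiff ℝ ∞ η ∧ HasCompactSupport η ∧ deriv η = G := by
  obtain ⟨R, hR⟩ := hc.isBounded.subset_closedBall (0 : ℝ)
  have hsupp : ∀ t, R < |t| → G t = 0 := fun t ht => by
    by_contra h
    have := hR (subset_tsupport _ h)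
    simp at this
    linarith
  have hi : ∀ a b, IntervalIntegrable G volume a b := fun a b =>
    hG.continuous.intervalIntegrable a b
  let m : ℝ := -(max R 0) - 1
  have hm : m < 0 := by simp only [m]; linarith [le_max_right R 0]
  have hmR : R < |m| := by rw [abs_of_neg hm]; simp only [m]; linarith [le_max_left R 0]
  let η : ℝ → ℝ := fun x => ∫ t in m..x, G t
  have hd : ∀ x, HasDerivAt η (G x) x := fun x =>
    intervalIntegral.integral_hasDerivAt_right (hi _ _)
      (hG.continuous.stronglyMeasurableAtFilter _ _) hG.continuous.continuousAt
  have hd' : deriv η = G := funext fun x => (hd x).deriv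
  refine ⟨η, ?_, ?_, hd'⟩
  · rw [contDiff_infty_iff_deriv, hd']
    exact ⟨fun x => (hd x).differentiableAt, hG⟩
  · refine HasCompactSupport.intro (K := Set.Icc m (-m)) isCompact_Icc fun x hx => ?_
    have hx' : -m < |x| := by
      by_contra hcon
      exact hx ⟨by linarith [neg_abs_le x], by linarith [le_abs_self x]⟩
    have hzero : ∀ t, -m ≤ |t| → G t = 0 := fun t ht => hsupp t (by
      rw [abs_of_neg hm] at hmR; linarith)
    rcases le_or_gt x m with h | h
    · simp only [η]
      rw [intervalIntegral.integral_congr (g := fun _ => (0:ℝ)), intervalIntegral.integral_zero]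
      intro t ht
      rw [Set.uIcc_of_ge h] at ht
      refine hzero t ?_
      rw [abs_of_nonpos (by linarith [ht.2])]; linarith [ht.2]
    · have hxm : -m < x := by
        rcases lt_abs.1 hx' with h' | h'
        · exact h'
        · linarith
      simp only [η]
      rw [intervalIntegral.integral_eq_integral_of_support_subset, h0]
      intro t ht
      by_contra hcon
      refine ht (hzero t ?_)
      by_contra hlt
      push Not at hlt
      exact hcon ⟨by linarith [neg_abs_le t], by linarith [le_abs_self t]⟩

/-- If the distributional derivative of `u ∈ L²` is `v ∈ L²`, then `u` agrees almost everywhere with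
a primitive of `v`: the difference to a primitive has vanishing derivative, and is constant by the
du Bois-Reymond lemma. -/
theorem exists_sobH1_of_weak {u v : ℝ → ℂ} (hu : MemLp u 2) (hv : MemLp v 2)
    (h : ∀ η : ℝ → ℝ, ContDiff ℝ ∞ η → HasCompactSupport η →
      ∫ s, η s • v s = -∫ s, deriv η s • u s) :
    ∃ θ, u =ᵐ[volume] θ ∧ SobH1 θ v := by
  have hvl := locallyIntegrable_of_memLp_two hv
  have hvi : ∀ x y, IntervalIntegrable v volume x y := fun x y => by
    rw [intervalIntegrable_iff']
    exact LocallyIntegrable.integrableOn_isCompact hvl isCompact_uIcc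
  let V : ℝ → ℂ := fun x => ∫ t in (0:ℝ)..x, v t
  have hVc : Continuous V := intervalIntegral.continuous_primitive hvi 0
  have hVsub : ∀ a b, V b - V a = ∫ t in a..b, v t := fun a b =>
    intervalIntegral.integral_interval_sub_left (hvi _ _) (hvi _ _)
  have hul := locallyIntegrable_of_memLp_two hu
  have hwl : LocallyIntegrable (fun t => u t - V t) :=
    LocallyIntegrable.sub hul hVc.locallyIntegrable
  have hint : ∀ {g : ℝ → ℝ} {w : ℝ → ℂ}, Continuous g → HasCompactSupport g →
      LocallyIntegrable w → Integrable fun s => g s • w s := fun hg hgc hw =>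
    LocallyIntegrable.integrable_smul_left_of_hasCompactSupport hw hg hgc
  have hw : ∀ η : ℝ → ℝ, ContDiff ℝ ∞ η → HasCompactSupport η →
      ∫ s, deriv η s • (u s - V s) = 0 := by
    intro η hη hηc
    have hη' : Continuous (deriv η) := hη.continuous_deriv (by simp)
    have hηc' : HasCompactSupport (deriv η) := hηc.deriv
    have key : ∫ s, (η s • v s + deriv η s • V s) = 0 := by
      obtain ⟨R, hR⟩ := hηc.isBounded.subset_closedBall (0 : ℝ)
      have hsupp : ∀ t, R < |t| → η t = 0 := fun t ht => by
        by_contra h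
        have := hR (subset_tsupport _ h)
        simp at this
        linarith
      have hsupp' : ∀ t, R < |t| → deriv η t = 0 := fun t ht => by
        by_contra h
        have := hR ((tsupport_deriv_subset (𝕜 := ℝ)) (subset_tsupport _ h))
        simp at this
        linarith
      let m := max R 0 + 1
      have hm0 : 0 < m := by positivity
      have hmR : R < m := by simp only [m]; linarith [le_max_left R 0]
      have e := primitive_mul_sub (B := fun s => ((η s : ℝ) : ℂ))
        (B' := fun s => ((deriv η s : ℝ) : ℂ)) (a := -m) (b := m) hvl hVsub
        (fun s _ => ((hη.differentiable (by simp) s).hasDerivAt).ofReal_comp)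
        (Complex.continuous_ofReal.comp hη').continuousOn
      rw [hsupp m (by rw [abs_of_pos hm0]; exact hmR),
        hsupp (-m) (by rw [abs_neg, abs_of_pos hm0]; exact hmR)] at e
      rw [intervalIntegral.integral_eq_integral_of_support_subset] at e
      · simp only [Complex.ofReal_zero, mul_zero, sub_zero] at e
        rw [e]
        refine integral_congr_ae (ae_of_all _ fun s => ?_)
        simp only [Complex.real_smul]; ring
      · intro t ht
        by_contra hcon
        have : R < |t| := by
          by_contra hlt
          push Not at hlt
          exact hcon ⟨by linarith [neg_abs_le t], by linarith [le_abs_self t]⟩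
        exact ht (by simp [hsupp t this, hsupp' t this])
    rw [integral_add (hint hη.continuous hηc hvl)
      (hint hη' hηc' hVc.locallyIntegrable), h η hη hηc] at key
    have : (fun s => deriv η s • (u s - V s)) =
        fun s => deriv η s • u s - deriv η s • V s := by
      funext s; rw [smul_sub]
    rw [this, integral_sub (hint hη' hηc' hul) (hint hη' hηc' hVc.locallyIntegrable)]
    linear_combination -key
  -- `u - V` annihilates all derivatives of test functions, and every test function is such a
  -- derivative up to a multiple of a fixed bump function `ρ` with integral one
  let b : ContDiffBump (0 : ℝ) := ⟨1, 2, one_pos, one_lt_two⟩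
  let ρ : ℝ → ℝ := b.normed volume
  have hρ : ContDiff ℝ ∞ ρ := b.contDiff_normed
  have hρc : HasCompactSupport ρ := b.hasCompactSupport_normed
  have hρ1 : ∫ t, ρ t = 1 := b.integral_normed
  let c : ℂ := ∫ s, ρ s • (u s - V s)
  have hae : ∀ᵐ x, u x - V x = c := by
    refine ae_eq_of_integral_contDiff_smul_eq hwl (continuous_const (y := c)).locallyIntegrable
      fun g hg hgc => ?_
    let I : ℝ := ∫ t, g t
    obtain ⟨η, hη, hηc, hηd⟩ := exists_primitive_of_integral_eq_zero
      (G := fun t => g t - I * ρ t) (hg.sub (contDiff_const.mul hρ)) (hgc.sub hρc.mul_left) (by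
        rw [integral_sub (hg.continuous.integrable_of_hasCompactSupport hgc)
          ((hρ.continuous.integrable_of_hasCompactSupport hρc).const_mul I),
          integral_const_mul, hρ1]
        simp [I])
    have e := hw η hη hηc
    rw [hηd] at e
    have : (fun s => (g s - I * ρ s) • (u s - V s)) =
        fun s => g s • (u s - V s) - I • (ρ s • (u s - V s)) := by
      funext s; rw [sub_smul, mul_smul]
    rw [this, integral_sub (hint hg.continuous hgc hwl)
      (((hint hρ.continuous hρc hwl)).fun_smul I), integral_smul] at e
    rw [integral_smul_const]
    exact sub_eq_zero.1 e
  refine ⟨fun x => V x + c, ?_, ?_⟩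
  · filter_upwards [hae] with x hx
    rw [← hx]; ring
  · have hae' : u =ᵐ[volume] fun x => V x + c := by
      filter_upwards [hae] with x hx
      rw [← hx]; ring
    exact ⟨(memLp_congr_ae hae').1 hu, hv, fun a b => by rw [← hVsub a b]; ring⟩

open scoped LineDeriv SchwartzMap in
/-- A Sobolev function of order at least one has a weak derivative which is a Sobolev function of
one order less. -/
lemma exists_weak_deriv_of_memSobolev {s : ℝ} (hs : 1 ≤ s) {u : Lp ℂ 2 (volume : Measure ℝ)}
    (hu : TemperedDistribution.MemSobolev s 2 (u : 𝓢'(ℝ, ℂ))) :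
    ∃ v : Lp ℂ 2 (volume : Measure ℝ),
      TemperedDistribution.MemSobolev (s - 1) 2 (v : 𝓢'(ℝ, ℂ)) ∧
      ∀ η : ℝ → ℝ, ContDiff ℝ ∞ η → HasCompactSupport η →
        ∫ s, η s • v s = -∫ s, deriv η s • u s := by
  have h1 := hu.lineDerivOp (m := (1 : ℝ))
  obtain ⟨v, hv⟩ := TemperedDistribution.memSobolev_zero_iff.1 (h1.mono (by linarith : 0 ≤ s - 1))
  rw [hv] at h1
  refine ⟨v, h1, fun η hη hηc => ?_⟩
  have hc : HasCompactSupport (fun t => (η t : ℂ)) :=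
    hηc.comp_left (g := ((↑) : ℝ → ℂ)) Complex.ofReal_zero
  let S : 𝓢(ℝ, ℂ) := hc.toSchwartzMap (Complex.ofRealCLM.contDiff.comp hη)
  have e := congrArg (fun T : 𝓢'(ℝ, ℂ) => T S) hv
  simp only [TemperedDistribution.lineDerivOp_apply_apply, Lp.toTemperedDistribution_apply] at e
  have e1 : ∀ x, S x = (η x : ℂ) := fun x => rfl
  have e2 : ∀ x, (-∂_{(1:ℝ)} S) x = -((deriv η x : ℝ) : ℂ) := by
    intro x
    have hd : HasDerivAt (fun t => (η t : ℂ)) ((deriv η x : ℝ) : ℂ) x :=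
      ((hη.differentiable (by simp) x).hasDerivAt).ofReal_comp
    have : (∂_{(1:ℝ)} S) x = fderiv ℝ (fun t => (η t : ℂ)) x 1 := rfl
    rw [neg_apply, this, hd.hasFDerivAt.fderiv]
    simp
  simp only [e1, e2] at e
  simp only [Complex.real_smul]
  rw [← integral_neg]
  simpa using e.symm

/-- A complex valued continuous primitive of a real valued function is its derivative. -/
lemma hasDerivAt_of_sub_eq {f : ℝ → ℝ} {θ : ℝ → ℂ} (hθ : Continuous θ)
    (h : ∀ a b, (f b : ℂ) - f a = ∫ t in a..b, θ t) (t : ℝ) :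
    HasDerivAt f (deriv f t) t ∧ ((deriv f t : ℝ) : ℂ) = θ t := by
  have h1 : HasDerivAt (fun t => (f t : ℂ)) (θ t) t := by
    have : (fun t => (f t : ℂ)) = fun t => (f 0 : ℂ) + ∫ s in (0:ℝ)..t, θ s := by
      funext t; rw [← h 0 t]; ring
    rw [this]
    exact (intervalIntegral.integral_hasDerivAt_right (hθ.intervalIntegrable _ _)
      (hθ.stronglyMeasurableAtFilter _ _) hθ.continuousAt).const_add _
  have h2 : HasDerivAt f (θ t).re t := by
    have := (Complex.reCLM.hasFDerivAt (x := (f t : ℂ))).comp_hasDerivAt t h1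
    simpa [Function.comp_def] using this
  have h3 := h2.ofReal_comp.unique h1
  rw [h2.deriv]
  exact ⟨h2, h3⟩

/-- A continuous representative of a function in `H³(ℝ)` is twice continuously differentiable, and
its first two derivatives are of class `H¹`. -/
theorem MemH.regularity {f : ℝ → ℝ} (hfc : Continuous f) (hf : MemH 3 f) :
    ContDiff ℝ 2 f ∧
    SobH1 (fun t => ((deriv f t : ℝ) : ℂ)) (fun t => ((deriv (deriv f) t : ℝ) : ℂ)) ∧
    ∃ f3 : ℝ → ℂ, SobH1 (fun t => ((deriv (deriv f) t : ℝ) : ℂ)) f3 := by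
  obtain ⟨hm, hS⟩ := hf
  obtain ⟨u1, hS1, w1⟩ := exists_weak_deriv_of_memSobolev (by norm_num) hS
  obtain ⟨u2, hS2, w2⟩ := exists_weak_deriv_of_memSobolev (by norm_num) hS1
  obtain ⟨u3, -, w3⟩ := exists_weak_deriv_of_memSobolev (by norm_num) hS2
  obtain ⟨θ0, a0, s0⟩ := exists_sobH1_of_weak (Lp.memLp _) (Lp.memLp _) w1
  obtain ⟨θ1, a1, s1⟩ := exists_sobH1_of_weak (Lp.memLp _) (Lp.memLp _) w2
  obtain ⟨θ2, a2, s2⟩ := exists_sobH1_of_weak (Lp.memLp _) (Lp.memLp _) w3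
  have hfθ : (fun t => (f t : ℂ)) = θ0 :=
    Continuous.ae_eq_iff_eq volume (Complex.continuous_ofReal.comp hfc) s0.continuous |>.1
      (hm.coeFn_toLp.symm.trans a0)
  have d0 := hasDerivAt_of_sub_eq (f := f) s1.continuous (fun a b => by
    rw [← intervalIntegral.integral_congr_ae (a1.mono fun x hx _ => hx), ← s0.sub_eq a b, ← hfθ])
  have hfθ1 : (fun t => ((deriv f t : ℝ) : ℂ)) = θ1 := funext fun t => (d0 t).2
  have d1 := hasDerivAt_of_sub_eq (f := deriv f) s2.continuous (fun a b => by
    rw [← intervalIntegral.integral_congr_ae (a2.mono fun x hx _ => hx), ← s1.sub_eq a b, ← hfθ1])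
  have hfθ2 : (fun t => ((deriv (deriv f) t : ℝ) : ℂ)) = θ2 := funext fun t => (d1 t).2
  have hc2 : Continuous (deriv (deriv f)) := by
    have : deriv (deriv f) = fun t => (θ2 t).re := by
      funext t; rw [← congrFun hfθ2 t]; simp
    rw [this]
    exact Complex.continuous_re.comp s2.continuous
  refine ⟨?_, ?_, u3, ?_⟩
  · rw [show (2 : WithTop ℕ∞) = 1 + 1 by norm_num, contDiff_succ_iff_deriv]
    refine ⟨fun t => (d0 t).1.differentiableAt, by simp, ?_⟩
    rw [contDiff_one_iff_deriv]
    exact ⟨fun t => (d1 t).1.differentiableAt, hc2⟩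
  · rw [hfθ1, hfθ2]
    exact ⟨s1.memLp, s2.memLp, fun a b => by
      rw [s1.sub_eq a b]
      exact intervalIntegral.integral_congr_ae (a2.mono fun x hx _ => hx)⟩
  · rw [hfθ2]; exact s2

/-! ### A square integrable majorant for the kernels -/

/-- An integrable function with a singularity of order `1/2` at the origin and quadratic decay; it
majorizes the squares of all kernels, up to translation and a factor. -/
noncomputable def majorant (b : ℝ) : ℝ :=
  (Metric.ball (0 : ℝ) 2).indicator (fun b => |b| ^ (-(1 / 2) : ℝ)) b + (1 + b ^ 2)⁻¹

lemma integrable_majorant : Integrable majorant := by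
  refine Integrable.add ?_ integrable_inv_one_add_sq
  rw [integrable_indicator_iff Metric.isOpen_ball.measurableSet]
  refine integrableOn_ball_of_norm_le_rpow (C := 1) (α := 1 / 2) (by simp) ?_
    (ae_of_all _ fun x => ?_) ?_
  · simp only [Module.finrank_self, Nat.cast_one]; norm_num
  · rw [one_mul, Real.norm_of_nonneg (by positivity), Real.norm_eq_abs]
  · exact (by fun_prop : Measurable fun b : ℝ => |b| ^ (-(1 / 2) : ℝ)).aestronglyMeasurable

lemma inv_one_add_sq_le_majorant (b : ℝ) : (1 + b ^ 2)⁻¹ ≤ majorant b := by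
  unfold majorant
  have : 0 ≤ (Metric.ball (0 : ℝ) 2).indicator (fun b : ℝ => |b| ^ (-(1 / 2) : ℝ)) b :=
    Set.indicator_nonneg (fun b _ => by positivity) b
  linarith

lemma majorant_nonneg (b : ℝ) : 0 ≤ majorant b :=
  (by positivity : (0 : ℝ) ≤ (1 + b ^ 2)⁻¹).trans (inv_one_add_sq_le_majorant b)

lemma sq_le_majorant {N C b : ℝ} (hN : 0 ≤ N) (h : N * (1 + |b|) ≤ C) :
    N ^ 2 ≤ C ^ 2 * majorant b := by
  have h1 : N ^ 2 * (1 + b ^ 2) ≤ C ^ 2 := by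
    have : N ^ 2 * (1 + |b|) ^ 2 ≤ C ^ 2 := by
      rw [← mul_pow]; gcongr
    nlinarith [sq_abs b, abs_nonneg b, sq_nonneg N, mul_nonneg (sq_nonneg N) (abs_nonneg b)]
  calc N ^ 2 ≤ C ^ 2 * (1 + b ^ 2)⁻¹ := by rw [← div_eq_mul_inv, le_div_iff₀ (by positivity)]; exact h1
    _ ≤ _ := by gcongr; exact inv_one_add_sq_le_majorant b

/-- Kernels majorized by a translate of `majorant` are bounded in `L²`, independently of the
translation. -/
lemma memLp_of_sq_le_majorant {k : ℝ → ℂ} {C a : ℝ} (hk : AEStronglyMeasurable k)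
    (h : ∀ᵐ s, ‖k s‖ ^ 2 ≤ C * majorant (s - a)) :
    MemLp k 2 ∧ ∫ s, ‖k s‖ ^ 2 ≤ C * ∫ b, majorant b := by
  have hi : Integrable fun s => C * majorant (s - a) :=
    (integrable_majorant.comp_sub_right a).const_mul C
  have hk2 : Integrable fun s => ‖k s‖ ^ 2 := by
    refine hi.mono' (hk.norm.pow 2) ?_
    filter_upwards [h] with s hs
    rwa [Real.norm_of_nonneg (by positivity)]
  refine ⟨(memLp_two_iff_integrable_sq_norm hk).2 hk2, ?_⟩
  calc ∫ s, ‖k s‖ ^ 2 ≤ ∫ s, C * majorant (s - a) := integral_mono_ae hk2 hi h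
    _ = C * ∫ b, majorant b := by
      rw [integral_const_mul, integral_sub_right_eq_self]

/-! ### The logarithmic kernel -/

lemma one_add_abs_im_le {z : ℂ} {Λ : ℝ} (hΛ : 0 ≤ Λ) (h : -Λ * |z.im| ≤ z.re) :
    1 + |z.im| ≤ (2 + Λ) * ‖z + 1‖ := by
  have h1 : |z.im| ≤ ‖z + 1‖ := by simpa using Complex.abs_im_le_norm (z + 1)
  have h2 : z.re + 1 ≤ ‖z + 1‖ := by simpa using Complex.re_le_norm (z + 1)
  nlinarith

lemma one_add_inv_mem_slitPlane {z : ℂ} (h : z ∈ Complex.slitPlane) :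
    1 + 1 / z ∈ Complex.slitPlane := by
  have hz : z ≠ 0 := Complex.slitPlane_ne_zero h
  rw [Complex.mem_slitPlane_iff] at h ⊢
  have hn : 0 < Complex.normSq z := Complex.normSq_pos.2 hz
  by_cases him : z.im = 0
  · left
    have hre : 0 < z.re := by simpa [him] using h
    simp only [one_div, Complex.add_re, Complex.one_re, Complex.inv_re]
    positivity
  · right
    simp only [one_div, Complex.add_im, Complex.one_im, Complex.inv_im, zero_add]
    exact div_ne_zero (neg_ne_zero.2 him) hn.ne'

/-- The kernel `Log (1 + 1/z)` in a sector around the right half-plane has a logarithmic singularity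
at the origin and decays like `1/|z|`. -/
lemma norm_log_one_add_inv_le {z : ℂ} {Λ : ℝ} (hΛ : 0 ≤ Λ) (h : -Λ * |z.im| ≤ z.re)
    (him : z.im ≠ 0) :
    ‖Complex.log (1 + 1 / z)‖ ^ 2 ≤ (2 * (Real.pi + Real.log (3 + Λ) + 4) ^ 2 + 8) *
      majorant z.im := by
  have hz : z ≠ 0 := fun h => him (by simp [h])
  have hb : 0 < |z.im| := abs_pos.2 him
  have hlog3 : 0 ≤ Real.log (3 + Λ) := Real.log_nonneg (by linarith)
  -- near the origin `log R ≤ 4 R ^ (1/4)` absorbs the logarithm into the power `-1/4` of `|z.im|`;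
  -- away from it `log (1 + w)` is comparable to `w`
  rcases lt_or_ge |z.im| 2 with hlt | hge
  · have hzn : 0 < ‖z‖ := norm_pos_iff.2 hz
    have hz1 : 1 ≤ (2 + Λ) * ‖z + 1‖ := by linarith [one_add_abs_im_le hΛ h]
    have hz1' : 0 < ‖z + 1‖ := by
      by_contra hc
      have : ‖z + 1‖ = 0 := le_antisymm (not_lt.1 hc) (norm_nonneg _)
      rw [this] at hz1; linarith
    have hbz : |z.im| ≤ ‖z‖ := Complex.abs_im_le_norm z
    have e : ‖1 + 1 / z‖ = ‖z + 1‖ / ‖z‖ := by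
      rw [← norm_div]; congr 1; field_simp
    have t1 : ‖z + 1‖ ≤ ‖z‖ + 1 := by simpa using norm_add_le z 1
    have t2 : ‖z‖ ≤ ‖z + 1‖ + 1 := by simpa using norm_sub_le (z + 1) 1
    set R : ℝ := 3 / |z.im| with hR
    have hR1 : 1 ≤ R := by rw [hR, le_div_iff₀ hb]; linarith
    have up : Real.log ‖1 + 1 / z‖ ≤ Real.log R := by
      refine Real.log_le_log (by rw [e]; positivity) ?_
      rw [e, div_le_iff₀ hzn, hR, div_mul_eq_mul_div, le_div_iff₀ hb]
      nlinarith
    have lo : -Real.log (3 + Λ) ≤ Real.log ‖1 + 1 / z‖ := by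
      rw [← Real.log_inv]
      refine Real.log_le_log (by positivity) ?_
      rw [e, le_div_iff₀ hzn, inv_mul_le_iff₀ (by positivity)]
      nlinarith
    have hlogR : Real.log R ≤ 4 * R ^ (1 / 4 : ℝ) := by
      have := Real.log_le_rpow_div (x := R) (ε := 1 / 4) (by linarith) (by norm_num)
      linarith
    have hR4 : 1 ≤ R ^ (1 / 4 : ℝ) := Real.one_le_rpow hR1 (by norm_num)
    have hn : ‖Complex.log (1 + 1 / z)‖ ≤
        (Real.pi + Real.log (3 + Λ) + 4) * R ^ (1 / 4 : ℝ) := by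
      refine (Complex.norm_le_abs_re_add_abs_im _).trans ?_
      rw [Complex.log_re, Complex.log_im]
      have a1 : |Real.log ‖1 + 1 / z‖| ≤ Real.log (3 + Λ) + 4 * R ^ (1 / 4 : ℝ) := by
        rw [abs_le]; constructor <;> linarith
      have a2 := Complex.abs_arg_le_pi (1 + 1 / z)
      nlinarith [Real.pi_pos]
    have hRR : (R ^ (1 / 4 : ℝ)) ^ 2 ≤ 2 * |z.im| ^ (-(1 / 2) : ℝ) := by
      rw [← Real.rpow_natCast, ← Real.rpow_mul (by linarith), hR, Real.div_rpow (by norm_num) hb.le,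
        Real.rpow_neg hb.le, ← div_eq_mul_inv]
      norm_num
      gcongr
      rw [← Real.sqrt_eq_rpow, Real.sqrt_le_iff]
      norm_num
    have hmaj : |z.im| ^ (-(1 / 2) : ℝ) ≤ majorant z.im := by
      unfold majorant
      rw [Set.indicator_of_mem (by simpa using hlt)]
      have : 0 ≤ (1 + z.im ^ 2)⁻¹ := by positivity
      linarith
    calc ‖Complex.log (1 + 1 / z)‖ ^ 2 ≤
        ((Real.pi + Real.log (3 + Λ) + 4) * R ^ (1 / 4 : ℝ)) ^ 2 := by gcongr
      _ = (Real.pi + Real.log (3 + Λ) + 4) ^ 2 * (R ^ (1 / 4 : ℝ)) ^ 2 := by ring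
      _ ≤ (Real.pi + Real.log (3 + Λ) + 4) ^ 2 * (2 * majorant z.im) := by
          gcongr; linarith
      _ ≤ _ := by nlinarith [majorant_nonneg z.im]
  · have hzn : |z.im| ≤ ‖z‖ := Complex.abs_im_le_norm z
    have h2 : ‖1 / z‖ ≤ 1 / |z.im| := by
      rw [norm_div, norm_one]; gcongr
    have h3 := Complex.norm_log_one_add_half_le_self (z := 1 / z)
      (h2.trans (by gcongr))
    have h4 : ‖Complex.log (1 + 1 / z)‖ * (1 + |z.im|) ≤ 9 / 4 := by
      calc ‖Complex.log (1 + 1 / z)‖ * (1 + |z.im|) ≤ (3 / 2 * (1 / |z.im|)) * (1 + |z.im|) := by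
            gcongr; linarith
        _ = 3 / 2 * (1 / |z.im|) + 3 / 2 := by field_simp
        _ ≤ 3 / 2 * (1 / 2) + 3 / 2 := by gcongr
        _ = 9 / 4 := by norm_num
    refine (sq_le_majorant (norm_nonneg _) h4).trans ?_
    gcongr
    · exact majorant_nonneg _
    · nlinarith [sq_nonneg (Real.pi + Real.log (3 + Λ) + 4)]

/-! ### The interface and its complement -/

/-- The regularity of the graph that the potential theory uses: `f` is twice continuously
differentiable with `f', f''` of class `H¹`. -/
structure IsInterface (f : ℝ → ℝ) : Prop where
  contDiff : ContDiff ℝ 2 f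
  sobH1_deriv : SobH1 (fun t => ((deriv f t : ℝ) : ℂ)) (fun t => ((deriv (deriv f) t : ℝ) : ℂ))
  exists_sobH1 : ∃ f3 : ℝ → ℂ, SobH1 (fun t => ((deriv (deriv f) t : ℝ) : ℂ)) f3

namespace IsInterface

lemma hasDerivAt {f : ℝ → ℝ} (hf : IsInterface f) (t : ℝ) : HasDerivAt f (deriv f t) t :=
  (hf.contDiff.differentiable (by norm_num) t).hasDerivAt

lemma continuous {f : ℝ → ℝ} (hf : IsInterface f) : Continuous f := hf.contDiff.continuous

lemma contDiff_deriv {f : ℝ → ℝ} (hf : IsInterface f) : ContDiff ℝ 1 (deriv f) :=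
  ((contDiff_succ_iff_deriv (n := 1)).1 (by rw [one_add_one_eq_two]; exact hf.contDiff)).2.2

lemma continuous_deriv {f : ℝ → ℝ} (hf : IsInterface f) : Continuous (deriv f) := hf.contDiff_deriv.continuous

lemma hasDerivAt_deriv {f : ℝ → ℝ} (hf : IsInterface f) (t : ℝ) : HasDerivAt (deriv f) (deriv (deriv f) t) t :=
  (hf.contDiff_deriv.differentiable (by norm_num) t).hasDerivAt

lemma continuous_deriv2 {f : ℝ → ℝ} (hf : IsInterface f) : Continuous (deriv (deriv f)) :=
  hf.contDiff_deriv.continuous_deriv (by norm_num)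

lemma exists_bound {f : ℝ → ℝ} (hf : IsInterface f) :
    ∃ Λ, 0 ≤ Λ ∧ (∀ t, |deriv f t| ≤ Λ) ∧ (∀ t, |deriv (deriv f) t| ≤ Λ) ∧
    ∀ s t, |f s - f t| ≤ Λ * |s - t| := by
  obtain ⟨C1, h1⟩ := hf.sobH1_deriv.bounded
  obtain ⟨f3, h3⟩ := hf.exists_sobH1
  obtain ⟨C2, h2⟩ := h3.bounded
  simp only [Complex.norm_real, Real.norm_eq_abs] at h1 h2
  have h1' : ∀ t, |deriv f t| ≤ max C1 C2 := fun t => (h1 t).trans (le_max_left _ _)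
  refine ⟨max C1 C2, (abs_nonneg _).trans (h1' 0), h1', fun t => (h2 t).trans (le_max_right _ _),
    fun s t => ?_⟩
  have := Convex.norm_image_sub_le_of_norm_deriv_le (f := f) (s := Set.univ) (C := max C1 C2)
    (x := t) (y := s) (fun x _ => (hf.hasDerivAt x).differentiableAt)
    (fun x _ => by simpa using h1' x) convex_univ trivial trivial
  simpa using this

end IsInterface

/-- The vector `x - (s, f s)` as a complex number. -/
noncomputable def relC (f : ℝ → ℝ) (x : Plane) (s : ℝ) : ℂ :=
  ((x 0 - s : ℝ) : ℂ) + ((x 1 - f s : ℝ) : ℂ) * Complex.I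

/-- The tangent vector `(1, f' s)` as a complex number. -/
noncomputable def tang (f : ℝ → ℝ) (s : ℝ) : ℂ := 1 + ((deriv f s : ℝ) : ℂ) * Complex.I

/-- The signed vertical distance from `x` to the graph. -/
noncomputable def gap (f : ℝ → ℝ) (x : Plane) : ℝ := x 1 - f (x 0)

/-- The vertical translate `x + ε e₂`. -/
noncomputable def shift (ε : ℝ) (x : Plane) : Plane := !₂[x 0, x 1 + ε]

/-- The domain above (`ε = 1`) or below (`ε = -1`) the graph. -/
def side (f : ℝ → ℝ) (ε : ℝ) : Set Plane := {x | 0 < ε * gap f x}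

@[simp] lemma relC_re (f : ℝ → ℝ) (x : Plane) (s : ℝ) : (relC f x s).re = x 0 - s := by simp [relC]
@[simp] lemma relC_im (f : ℝ → ℝ) (x : Plane) (s : ℝ) : (relC f x s).im = x 1 - f s := by
  simp [relC]
@[simp] lemma tang_re (f : ℝ → ℝ) (s : ℝ) : (tang f s).re = 1 := by simp [tang]
@[simp] lemma tang_im (f : ℝ → ℝ) (s : ℝ) : (tang f s).im = deriv f s := by simp [tang]
@[simp] lemma shift_zero (ε : ℝ) (x : Plane) : shift ε x 0 = x 0 := by simp [shift]
@[simp] lemma shift_one (ε : ℝ) (x : Plane) : shift ε x 1 = x 1 + ε := by simp [shift]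

lemma gap_shift (f : ℝ → ℝ) (ε : ℝ) (x : Plane) : gap f (shift ε x) = gap f x + ε := by
  simp [gap]; ring

lemma relC_shift (f : ℝ → ℝ) (ε : ℝ) (x : Plane) (s : ℝ) :
    relC f (shift ε x) s = relC f x s + ε * Complex.I := by
  simp only [relC, shift_zero, shift_one]; push_cast; ring

lemma tang_ne_zero (f : ℝ → ℝ) (s : ℝ) : tang f s ≠ 0 := fun h => by
  simpa using congrArg Complex.re h

lemma relC_ne_zero_of_ne {f : ℝ → ℝ} {x : Plane} {s : ℝ} (h : s ≠ x 0) : relC f x s ≠ 0 := by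
  intro h0
  have := congrArg Complex.re h0
  simp only [relC_re, Complex.zero_re] at this
  exact h (by linarith)

lemma relC_ne_zero {f : ℝ → ℝ} {x : Plane} (h : gap f x ≠ 0) (s : ℝ) : relC f x s ≠ 0 := by
  by_cases hs : s = x 0
  · intro h0
    have := congrArg Complex.im h0
    simp only [relC_im, Complex.zero_im, hs] at this
    exact h this
  · exact relC_ne_zero_of_ne hs

lemma norm_relC (f : ℝ → ℝ) (x : Plane) (s : ℝ) : ‖relC f x s‖ = ‖x - Xi f s‖ := by
  rw [EuclideanSpace.norm_eq, Fin.sum_univ_two, Complex.norm_eq_sqrt_sq_add_sq]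
  simp [Xi]

lemma norm_relC_sub (f : ℝ → ℝ) (x p : Plane) (s : ℝ) : ‖relC f x s - relC f p s‖ = ‖x - p‖ := by
  rw [EuclideanSpace.norm_eq, Fin.sum_univ_two, Complex.norm_eq_sqrt_sq_add_sq]
  simp

lemma continuous_relC_left (f : ℝ → ℝ) (s : ℝ) : Continuous fun x : Plane => relC f x s := by
  unfold relC; fun_prop

lemma continuous_relC {f : ℝ → ℝ} (hf : Continuous f) (x : Plane) : Continuous (relC f x) := by
  unfold relC; fun_prop

lemma continuous_shift (ε : ℝ) : Continuous (shift ε) := by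
  unfold shift; fun_prop

lemma continuous_gap {f : ℝ → ℝ} (hf : Continuous f) : Continuous (gap f) := by
  unfold gap; fun_prop

lemma isOpen_side {f : ℝ → ℝ} (hf : Continuous f) (ε : ℝ) : IsOpen (side f ε) :=
  isOpen_lt continuous_const (continuous_const.mul (continuous_gap hf))

lemma mem_gam_iff {f : ℝ → ℝ} {x : Plane} : x ∈ Gam f ↔ gap f x = 0 := by
  constructor
  · rintro ⟨s, rfl⟩; simp [gap, Xi]
  · intro h
    refine ⟨x 0, ?_⟩
    ext i
    fin_cases i
    · simp [Xi]
    · simp only [gap] at h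
      simp [Xi]; linarith

lemma tendsto_relC_cobounded (f : ℝ → ℝ) (s : ℝ) :
    Tendsto (fun x : Plane => relC f x s) (Bornology.cobounded Plane) (Bornology.cobounded ℂ) := by
  rw [← tendsto_norm_atTop_iff_cobounded]
  refine tendsto_atTop_mono (f := fun x => ‖x‖ - ‖Xi f s‖) (fun x => ?_) ?_
  · rw [norm_relC]; exact norm_sub_norm_le x _
  · exact tendsto_atTop_add_const_right _ _ tendsto_norm_cobounded_atTop

lemma tendsto_shift_cobounded (ε : ℝ) :
    Tendsto (shift ε) (Bornology.cobounded Plane) (Bornology.cobounded Plane) := by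
  rw [← tendsto_norm_atTop_iff_cobounded]
  refine tendsto_atTop_mono (f := fun x => ‖x‖ - ‖(!₂[0, -ε] : Plane)‖) (fun x => ?_) ?_
  · have : shift ε x = x - !₂[0, -ε] := by
      ext i; fin_cases i <;> simp
    rw [this]; exact norm_sub_norm_le x _
  · exact tendsto_atTop_add_const_right _ _ tendsto_norm_cobounded_atTop

lemma IsInterface.hasDerivAt_relC {f : ℝ → ℝ} (hf : IsInterface f) (x : Plane) (s : ℝ) :
    HasDerivAt (relC f x) (-tang f s) s := by
  have h1 : HasDerivAt (fun s => ((x 0 - s : ℝ) : ℂ)) (((-1 : ℝ)) : ℂ) s :=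
    ((hasDerivAt_id s).const_sub (x 0)).ofReal_comp
  have h2 : HasDerivAt (fun s => ((x 1 - f s : ℝ) : ℂ)) (((-deriv f s : ℝ)) : ℂ) s :=
    ((hf.hasDerivAt s).const_sub (x 1)).ofReal_comp
  unfold relC
  refine (h1.fun_add (h2.mul_const Complex.I)).congr_deriv ?_
  unfold tang; push_cast; ring

lemma IsInterface.continuous_tang {f : ℝ → ℝ} (hf : IsInterface f) : Continuous (tang f) := by
  have := hf.continuous_deriv
  unfold tang; fun_prop

lemma IsInterface.hasDerivAt_tang {f : ℝ → ℝ} (hf : IsInterface f) (s : ℝ) :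
    HasDerivAt (tang f) (((deriv (deriv f) s : ℝ) : ℂ) * Complex.I) s :=
  ((hf.hasDerivAt_deriv s).ofReal_comp.mul_const Complex.I).const_add 1

lemma one_le_norm_tang (f : ℝ → ℝ) (s : ℝ) : 1 ≤ ‖tang f s‖ := by
  simpa using Complex.re_le_norm (tang f s)

/-- Away from the graph, `|x - (s, f s)|` is bounded below by a multiple of `1 + |s - x₁|`. -/
lemma one_add_abs_le_norm_relC {f : ℝ → ℝ} {Λ d : ℝ} (hΛ : 0 ≤ Λ)
    (hL : ∀ s t, |f s - f t| ≤ Λ * |s - t|) (hd : 0 < d) {x : Plane} (hx : d ≤ |gap f x|) (s : ℝ) :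
    1 + |s - x 0| ≤ ((1 + Λ) / d + 1) * ‖relC f x s‖ := by
  have h1 : |s - x 0| ≤ ‖relC f x s‖ := by
    rw [abs_sub_comm]; simpa using Complex.abs_re_le_norm (relC f x s)
  have h2 : |x 1 - f s| ≤ ‖relC f x s‖ := by simpa using Complex.abs_im_le_norm (relC f x s)
  have h3 : |gap f x| ≤ |x 1 - f s| + |f s - f (x 0)| := by
    have : gap f x = (x 1 - f s) + (f s - f (x 0)) := by simp [gap]
    rw [this]; exact abs_add_le _ _
  have h4 : d ≤ (1 + Λ) * ‖relC f x s‖ := by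
    nlinarith [hL s (x 0)]
  have h5 : 1 ≤ (1 + Λ) / d * ‖relC f x s‖ := by
    rw [div_mul_eq_mul_div, le_div_iff₀ hd]; linarith
  nlinarith

/-! ### The Cauchy integral over the graph -/

/-- The Cauchy integral `∫ θ dζ / (z - ζ)` over the graph. -/
noncomputable def cauchyC (f : ℝ → ℝ) (θ : ℝ → ℂ) (x : Plane) : ℂ :=
  ∫ s, θ s * (tang f s / relC f x s)

/-- The logarithmic kernel arising from the Cauchy kernel at `x` minus the Cauchy kernel at
`x + ε e₂` by integration by parts. For `ε = ±1` and `x` on the corresponding side of the graph the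
argument of the logarithm stays in the slit plane. -/
noncomputable def logKer (f : ℝ → ℝ) (ε : ℝ) (x : Plane) (s : ℝ) : ℂ :=
  -Complex.log (1 + 1 / (-(ε : ℂ) * Complex.I * relC f x s))

lemma rotC_re (f : ℝ → ℝ) (ε : ℝ) (x : Plane) (s : ℝ) :
    (-(ε : ℂ) * Complex.I * relC f x s).re = ε * (x 1 - f s) := by
  simp
lemma rotC_im (f : ℝ → ℝ) (ε : ℝ) (x : Plane) (s : ℝ) :
    (-(ε : ℂ) * Complex.I * relC f x s).im = ε * (s - x 0) := by
  simp; ring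

lemma majorant_neg (b : ℝ) : majorant (-b) = majorant b := by
  unfold majorant
  congr 1
  · by_cases h : b ∈ Metric.ball (0 : ℝ) 2
    · rw [Set.indicator_of_mem h, Set.indicator_of_mem (by simpa using h), abs_neg]
    · rw [Set.indicator_of_notMem h, Set.indicator_of_notMem (by simpa using h)]
  · simp

/-- The two sides of the graph are labelled by signs `ε`, given by the equation `ε ^ 2 = 1`. -/
lemma abs_eq_one_of_sq {ε : ℝ} (hε : ε ^ 2 = 1) : |ε| = 1 := by
  rw [← sq_eq_sq₀ (abs_nonneg _) zero_le_one, sq_abs, hε, one_pow]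

lemma gap_shift_abs {f : ℝ → ℝ} {ε : ℝ} (hε : ε ^ 2 = 1) {x : Plane} (hx : 0 ≤ ε * gap f x) :
    1 ≤ |gap f (shift ε x)| := by
  have h1 : |gap f (shift ε x)| = |ε * gap f (shift ε x)| := by
    rw [abs_mul, abs_eq_one_of_sq hε, one_mul]
  rw [h1, gap_shift]
  refine le_trans ?_ (le_abs_self _)
  nlinarith

lemma rotC_sector {f : ℝ → ℝ} {Λ : ℝ} (hL : ∀ s t, |f s - f t| ≤ Λ * |s - t|)
    {ε : ℝ} (hε : ε ^ 2 = 1) {x : Plane} (hx : 0 ≤ ε * gap f x) (s : ℝ) :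
    -Λ * |(-(ε : ℂ) * Complex.I * relC f x s).im| ≤ (-(ε : ℂ) * Complex.I * relC f x s).re := by
  rw [rotC_re, rotC_im, abs_mul, abs_eq_one_of_sq hε, one_mul]
  have h1 : |ε * (f (x 0) - f s)| ≤ Λ * |s - x 0| := by
    rw [abs_mul, abs_eq_one_of_sq hε, one_mul, abs_sub_comm]; exact hL _ _
  have h2 := neg_le_of_abs_le h1
  have h3 : ε * (x 1 - f s) = ε * gap f x + ε * (f (x 0) - f s) := by simp only [gap]; ring
  linarith

lemma rotC_mem_slitPlane {f : ℝ → ℝ} {ε : ℝ} (hε : ε ^ 2 = 1) {x : Plane} {s : ℝ}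
    (hx : 0 < ε * gap f x ∨ s ≠ x 0) :
    -(ε : ℂ) * Complex.I * relC f x s ∈ Complex.slitPlane := by
  rw [Complex.mem_slitPlane_iff, rotC_re, rotC_im]
  have hε0 : ε ≠ 0 := fun h => by simp [h] at hε
  by_cases hs : s = x 0
  · left
    rcases hx with hx | hx
    · rw [hs]; exact hx
    · exact absurd hs hx
  · right
    exact mul_ne_zero hε0 (sub_ne_zero.2 hs)

lemma IsInterface.exists_logKer_bound {f : ℝ → ℝ} (hf : IsInterface f) :
    ∃ C, 0 ≤ C ∧ ∀ ε : ℝ, ε ^ 2 = 1 → ∀ x : Plane, 0 ≤ ε * gap f x → ∀ s, s ≠ x 0 →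
      ‖logKer f ε x s‖ ^ 2 ≤ C * majorant (s - x 0) := by
  obtain ⟨Λ, hΛ, -, -, hL⟩ := hf.exists_bound
  refine ⟨2 * (Real.pi + Real.log (3 + Λ) + 4) ^ 2 + 8, by positivity, fun ε hε x hx s hs => ?_⟩
  have hε0 : ε ≠ 0 := fun h => by simp [h] at hε
  have h := norm_log_one_add_inv_le hΛ (rotC_sector hL hε hx s)
    (by rw [rotC_im]; exact mul_ne_zero hε0 (sub_ne_zero.2 hs))
  have h2 : majorant (-(ε : ℂ) * Complex.I * relC f x s).im = majorant (s - x 0) := by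
    rw [rotC_im]
    rcases (abs_eq zero_le_one).1 (abs_eq_one_of_sq hε) with rfl | rfl
    · simp
    · rw [neg_one_mul, majorant_neg]
  rw [h2] at h
  rw [logKer, norm_neg]
  exact h

lemma aestronglyMeasurable_logKer {f : ℝ → ℝ} (hf : Continuous f) (ε : ℝ) (x : Plane) :
    AEStronglyMeasurable (logKer f ε x) := by
  have := (continuous_relC hf x).measurable
  unfold logKer
  exact (by fun_prop : Measurable _).aestronglyMeasurable

lemma IsInterface.exists_cauchyKer_bound {f : ℝ → ℝ} (hf : IsInterface f) {d : ℝ} (hd : 0 < d) :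
    ∃ C, 0 ≤ C ∧ ∀ x : Plane, d ≤ |gap f x| → ∀ s, ∀ τ : ℂ, ‖τ‖ ≤ ‖tang f s‖ / ‖relC f x s‖ →
      ‖τ‖ ^ 2 ≤ C * majorant (s - x 0) := by
  obtain ⟨Λ, hΛ, hb, -, hL⟩ := hf.exists_bound
  refine ⟨((1 + Λ) * ((1 + Λ) / d + 1)) ^ 2, by positivity, fun x hx s τ hτ => ?_⟩
  refine sq_le_majorant (norm_nonneg _) ?_
  have h1 := one_add_abs_le_norm_relC hΛ hL hd hx s
  have h2 : relC f x s ≠ 0 := relC_ne_zero (by rw [← abs_pos]; linarith) s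
  have h3 : 0 < ‖relC f x s‖ := norm_pos_iff.2 h2
  have h4 : ‖tang f s‖ ≤ 1 + Λ := by
    have := Complex.norm_le_abs_re_add_abs_im (tang f s)
    rw [tang_re, tang_im, abs_one] at this
    linarith [hb s]
  calc ‖τ‖ * (1 + |s - x 0|) ≤ ((1 + Λ) / ‖relC f x s‖) * (((1 + Λ) / d + 1) * ‖relC f x s‖) := by
        gcongr
        exact hτ.trans (by gcongr)
    _ = (1 + Λ) * ((1 + Λ) / d + 1) := by field_simp

/-- A family of kernels bounded by the Cauchy kernel, at a fixed point off the graph. -/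
lemma IsInterface.memLp_of_le_cauchyKer {f : ℝ → ℝ} (hf : IsInterface f) {x : Plane}
    (hx : gap f x ≠ 0) {k : ℝ → ℂ} (hk : Continuous k)
    (h : ∀ s, ‖k s‖ ≤ ‖tang f s‖ / ‖relC f x s‖) : MemLp k 2 := by
  obtain ⟨C, -, hC⟩ := hf.exists_cauchyKer_bound (abs_pos.2 hx)
  exact (memLp_of_sq_le_majorant hk.aestronglyMeasurable
    (ae_of_all _ fun s => hC x le_rfl s _ (h s))).1

lemma IsInterface.continuous_cauchyKer {f : ℝ → ℝ} (hf : IsInterface f) {x : Plane}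
    (hx : gap f x ≠ 0) : Continuous fun s => tang f s / relC f x s :=
  hf.continuous_tang.div (continuous_relC hf.continuous x) (relC_ne_zero hx)

lemma IsInterface.memLp_cauchyKer {f : ℝ → ℝ} (hf : IsInterface f) {x : Plane}
    (hx : gap f x ≠ 0) : MemLp (fun s => tang f s / relC f x s) 2 :=
  hf.memLp_of_le_cauchyKer hx (hf.continuous_cauchyKer hx) fun s => by rw [norm_div]

lemma side_gap_ne {f : ℝ → ℝ} {ε : ℝ} {x : Plane} (hx : 0 < ε * gap f x) : gap f x ≠ 0 :=
  fun h => by simp [h] at hx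

lemma IsInterface.memLp_logKer {f : ℝ → ℝ} (hf : IsInterface f) {ε : ℝ} (hε : ε ^ 2 = 1)
    {x : Plane} (hx : 0 ≤ ε * gap f x) : MemLp (logKer f ε x) 2 := by
  obtain ⟨C, -, hC⟩ := hf.exists_logKer_bound
  refine (memLp_of_sq_le_majorant (C := C) (a := x 0) (aestronglyMeasurable_logKer hf.continuous ε x) ?_).1
  filter_upwards [Measure.ae_ne volume (x 0)] with s hs using hC ε hε x hx s hs

/-- Integration by parts turns the Cauchy integral into an integral with a logarithmic kernel and
a Cauchy integral at unit distance from the graph. -/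
lemma IsInterface.cauchyC_eq {f : ℝ → ℝ} (hf : IsInterface f) {θ ψ : ℝ → ℂ} (h : SobH1 θ ψ)
    {ε : ℝ} (hε : ε ^ 2 = 1) {x : Plane} (hx : 0 < ε * gap f x) :
    cauchyC f θ x = (∫ s, ψ s * logKer f ε x s) + cauchyC f θ (shift ε x) := by
  have hx' : gap f (shift ε x) ≠ 0 := by
    rw [← abs_pos]; linarith [gap_shift_abs hε hx.le]
  have hx0 := side_gap_ne hx
  have hc1 := hf.continuous_cauchyKer hx0
  have hc2 := hf.continuous_cauchyKer hx'
  have i1 := integrable_mul_of_memLp_two h.memLp (hf.memLp_cauchyKer hx0)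
  have i2 := integrable_mul_of_memLp_two h.memLp (hf.memLp_cauchyKer hx')
  have hεC : (ε : ℂ) ^ 2 = 1 := by exact_mod_cast hε
  have hεC0 : (ε : ℂ) ≠ 0 := fun h => by simp [h] at hεC
  -- `1 + 1/ω = (ω + 1)/ω` with `ω = -iε w`, where `ω + 1` belongs to the translated point; hence
  -- the derivative of the logarithmic kernel is a difference of two Cauchy kernels
  have key := h.integral_mul_deriv (B := logKer f ε x)
    (B' := fun s => tang f (s) / relC f (shift ε x) s - tang f s / relC f x s) (fun s => ?_)
    (hc2.sub hc1) (integrable_mul_of_memLp_two h.memLp (hf.memLp_logKer hε hx.le))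
    (integrable_mul_of_memLp_two h.memLp_deriv (hf.memLp_logKer hε hx.le)) ?_
  · have e : (fun s => θ s * (tang f (s) / relC f (shift ε x) s - tang f s / relC f x s)) =
        fun s => θ s * (tang f (s) / relC f (shift ε x) s) - θ s * (tang f s / relC f x s) := by
      funext s; ring
    rw [e, integral_sub i2 i1] at key
    unfold cauchyC
    linear_combination -key
  · have hsl := rotC_mem_slitPlane hε (s := s) (Or.inl hx)
    have h0 : relC f x s ≠ 0 := relC_ne_zero hx0 s
    have h0' := relC_ne_zero hx' s
    have d1 : HasDerivAt (fun s => 1 + 1 / (-(ε : ℂ) * Complex.I * relC f x s)) _ s :=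
      ((((hf.hasDerivAt_relC x s).const_mul (-(ε : ℂ) * Complex.I)).fun_inv
        (Complex.slitPlane_ne_zero hsl)).const_add 1).congr_of_eventuallyEq
        (Eventually.of_forall fun s => by simp only [one_div])
    have d2 := (d1.clog_real (one_add_inv_mem_slitPlane hsl)).neg
    refine d2.congr_deriv ?_
    have e1 : 1 + 1 / (-(ε : ℂ) * Complex.I * relC f x s) =
        relC f (shift ε x) s / relC f x s := by
      rw [relC_shift]
      field_simp
      linear_combination -Complex.I ^ 2 * hεC - Complex.I_sq
    rw [e1]
    rw [relC_shift] at h0' ⊢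
    field_simp
    linear_combination tang f s * Complex.I ^ 2 * hεC + tang f s * Complex.I_sq
  · refine (i2.sub i1).congr (ae_of_all _ fun s => ?_)
    simp only [Pi.sub_apply]; ring

/-- Continuous kernels off the origin that are bounded by `1/|w|`. -/
structure IsCauchyKernel (G : ℂ → ℂ) : Prop where
  continuousOn : ContinuousOn G {0}ᶜ
  norm_le : ∀ w, ‖G w‖ ≤ ‖w‖⁻¹

/-- The potential `∫ θ G(z - ζ) dζ` over the graph. -/
noncomputable def potC (f : ℝ → ℝ) (G : ℂ → ℂ) (θ : ℝ → ℂ) (x : Plane) : ℂ :=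
  ∫ s, θ s * (tang f s * G (relC f x s))

lemma isCauchyKernel_inv : IsCauchyKernel fun w => w⁻¹ :=
  ⟨continuousOn_inv₀, fun w => by rw [norm_inv]⟩

lemma isCauchyKernel_conj : IsCauchyKernel fun w => conj w / w ^ 2 := by
  refine ⟨ContinuousOn.div (by fun_prop) (by fun_prop) fun w hw => pow_ne_zero 2 hw, fun w => ?_⟩
  rcases eq_or_ne w 0 with rfl | hw
  · simp
  · rw [norm_div, RCLike.norm_conj, norm_pow]
    have : ‖w‖ ≠ 0 := norm_ne_zero_iff.2 hw
    field_simp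
    rfl

lemma potC_inv (f : ℝ → ℝ) (θ : ℝ → ℂ) (x : Plane) :
    potC f (fun w => w⁻¹) θ x = cauchyC f θ x := by
  simp only [potC, cauchyC, div_eq_mul_inv]

lemma IsCauchyKernel.continuous_ker {G : ℂ → ℂ} (hG : IsCauchyKernel G) {f : ℝ → ℝ}
    (hf : IsInterface f) {x : Plane} (hx : gap f x ≠ 0) :
    Continuous fun s => tang f s * G (relC f x s) := by
  refine hf.continuous_tang.mul ?_
  rw [← continuousOn_univ]
  exact hG.continuousOn.comp (continuous_relC hf.continuous x).continuousOn
    fun s _ => relC_ne_zero hx s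

lemma IsCauchyKernel.norm_ker_le {G : ℂ → ℂ} (hG : IsCauchyKernel G) (f : ℝ → ℝ) (x : Plane)
    (s : ℝ) : ‖tang f s * G (relC f x s)‖ ≤ ‖tang f s‖ / ‖relC f x s‖ := by
  rw [norm_mul, div_eq_mul_inv]
  gcongr
  exact hG.norm_le _

lemma IsCauchyKernel.memLp {G : ℂ → ℂ} (hG : IsCauchyKernel G) {f : ℝ → ℝ}
    (hf : IsInterface f) {x : Plane} (hx : gap f x ≠ 0) :
    MemLp (fun s => tang f s * G (relC f x s)) 2 :=
  hf.memLp_of_le_cauchyKer hx (hG.continuous_ker hf hx) (hG.norm_ker_le f x)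

instance : (Bornology.cobounded Plane).IsCountablyGenerated := by
  rw [← comap_norm_atTop]; infer_instance

lemma IsCauchyKernel.continuousAt_potC {G : ℂ → ℂ} (hG : IsCauchyKernel G) {f : ℝ → ℝ}
    (hf : IsInterface f) {θ : ℝ → ℂ} (hθ : MemLp θ 2) {p : Plane} (hp : gap f p ≠ 0) :
    ContinuousAt (potC f G θ) p := by
  obtain ⟨C, -, hC⟩ := hf.exists_cauchyKer_bound (d := |gap f p| / 2)
    (half_pos (abs_pos.2 hp))
  refine tendsto_integral_mul_of_L2_bounded hθ (C := C * ∫ b, majorant b) ?_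
    (hG.memLp hf hp) (ae_of_all _ fun s => ?_)
  · filter_upwards [(continuous_gap hf.continuous).abs.continuousAt.eventually
      (lt_mem_nhds (half_lt_self (abs_pos.2 hp)))] with x hx
    have hx0 : gap f x ≠ 0 := by
      rw [← abs_pos]; exact (half_pos (abs_pos.2 hp)).trans hx
    exact memLp_of_sq_le_majorant (hG.continuous_ker hf hx0).aestronglyMeasurable
      (ae_of_all _ fun s => hC x hx.le s _ (hG.norm_ker_le f x s))
  · refine tendsto_const_nhds.mul ?_
    have h1 := hG.continuousOn.continuousAt (isOpen_compl_singleton.mem_nhds (relC_ne_zero hp s))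
    exact h1.tendsto.comp ((continuous_relC_left f s).tendsto p)

/-- Potentials with a Cauchy type kernel vanish at infinity along points at distance at least one
from the graph. -/
lemma IsCauchyKernel.tendsto_potC_shift {G : ℂ → ℂ} (hG : IsCauchyKernel G) {f : ℝ → ℝ}
    (hf : IsInterface f) {θ : ℝ → ℂ} (hθ : MemLp θ 2) {ε : ℝ} (hε : ε ^ 2 = 1) :
    Tendsto (fun x => potC f G θ (shift ε x)) (Bornology.cobounded Plane ⊓ 𝓟 (side f ε))
      (𝓝 0) := by
  obtain ⟨C, -, hC⟩ := hf.exists_cauchyKer_bound (d := 1) one_pos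
  have key := tendsto_integral_mul_of_L2_bounded hθ (C := C * ∫ b, majorant b)
    (l := Bornology.cobounded Plane ⊓ 𝓟 (side f ε))
    (k := fun x s => tang f s * G (relC f (shift ε x) s)) (k0 := fun _ => 0) ?_ MemLp.zero
    (ae_of_all _ fun s => ?_)
  · simpa [potC] using key
  · filter_upwards [mem_inf_of_right (mem_principal_self (side f ε))] with x hx
    have h1 := gap_shift_abs hε (x := x) (f := f) (le_of_lt hx)
    have hx0 : gap f (shift ε x) ≠ 0 := by
      rw [← abs_pos]; linarith
    exact memLp_of_sq_le_majorant (hG.continuous_ker hf hx0).aestronglyMeasurable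
      (ae_of_all _ fun s => hC _ h1 s _ (hG.norm_ker_le f _ s))
  · have h1 : Tendsto (fun x => (relC f (shift ε x) s)) (Bornology.cobounded Plane ⊓ 𝓟 (side f ε))
        (Bornology.cobounded ℂ) :=
      ((tendsto_relC_cobounded f s).comp (tendsto_shift_cobounded ε)).mono_left inf_le_left
    have h2 := (tendsto_inv₀_cobounded.comp h1).norm
    rw [norm_zero] at h2
    have h3 : Tendsto (fun x => G (relC f (shift ε x) s))
        (Bornology.cobounded Plane ⊓ 𝓟 (side f ε)) (𝓝 0) := by
      refine squeeze_zero_norm (fun x => ?_) h2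
      simpa using hG.norm_le (relC f (shift ε x) s)
    simpa using tendsto_const_nhds.mul h3

/-- The boundary value of the Cauchy integral from the side `ε` of the graph. -/
noncomputable def cauchyBdry (f : ℝ → ℝ) (θ ψ : ℝ → ℂ) (ε : ℝ) (y : Plane) : ℂ :=
  (∫ s, ψ s * logKer f ε y s) + cauchyC f θ (shift ε y)

lemma tendsto_logKer {f : ℝ → ℝ} {ε : ℝ} (hε : ε ^ 2 = 1) {y : Plane} {s : ℝ}
    (hs : s ≠ y 0) : Tendsto (fun x => logKer f ε x s) (𝓝 y) (𝓝 (logKer f ε y s)) := by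
  have h0 := rotC_mem_slitPlane (f := f) hε (x := y) (Or.inr hs)
  have h1 : Tendsto (fun x => -(ε : ℂ) * Complex.I * relC f x s) (𝓝 y)
      (𝓝 (-(ε : ℂ) * Complex.I * relC f y s)) :=
    ((continuous_relC_left f s).const_mul _).tendsto y
  exact ((tendsto_const_nhds.add (tendsto_const_nhds.div h1
    (Complex.slitPlane_ne_zero h0))).clog (one_add_inv_mem_slitPlane h0)).neg

lemma tendsto_logKer_cobounded (f : ℝ → ℝ) (ε : ℝ) (s : ℝ) :
    Tendsto (fun x => logKer f ε x s) (Bornology.cobounded Plane) (𝓝 0) := by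
  have h1 := (tendsto_inv₀_cobounded.comp (tendsto_relC_cobounded f s)).const_mul
    ((-(ε : ℂ) * Complex.I)⁻¹)
  have h2 : Tendsto (fun x => 1 / (-(ε : ℂ) * Complex.I * relC f x s)) (Bornology.cobounded Plane)
      (𝓝 0) := by
    simpa [Function.comp_def, mul_comm] using h1
  have h3 := ((tendsto_const_nhds (x := (1:ℂ))).add h2).clog (by simp)
  simpa [logKer] using h3.neg

/-- The one-sided limits of a Cauchy integral with `H¹` density at a point of the graph. -/
theorem IsInterface.tendsto_cauchyC {f : ℝ → ℝ} (hf : IsInterface f) {θ ψ : ℝ → ℂ}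
    (h : SobH1 θ ψ) {ε : ℝ} (hε : ε ^ 2 = 1) {y : Plane} (hy : gap f y = 0) :
    Tendsto (cauchyC f θ) (𝓝[side f ε] y) (𝓝 (cauchyBdry f θ ψ ε y)) := by
  obtain ⟨C, -, hC⟩ := hf.exists_logKer_bound
  have hself : ∀ᶠ x in 𝓝[side f ε] y, x ∈ side f ε := self_mem_nhdsWithin
  have t1 : Tendsto (fun x => ∫ s, ψ s * logKer f ε x s) (𝓝[side f ε] y)
      (𝓝 (∫ s, ψ s * logKer f ε y s)) := by
    refine tendsto_integral_mul_of_L2_bounded h.memLp_deriv (C := C * ∫ b, majorant b) ?_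
      (hf.memLp_logKer hε (by simp [hy])) ?_
    · filter_upwards [hself] with x hx
      refine memLp_of_sq_le_majorant (a := x 0) (aestronglyMeasurable_logKer hf.continuous ε x) ?_
      filter_upwards [Measure.ae_ne volume (x 0)] with s hs using hC ε hε x (le_of_lt hx) s hs
    · filter_upwards [Measure.ae_ne volume (y 0)] with s hs
      exact (tendsto_logKer hε hs).mono_left nhdsWithin_le_nhds
  have hy' : gap f (shift ε y) ≠ 0 := by
    rw [← abs_pos]; linarith [gap_shift_abs hε (x := y) (f := f) (by simp [hy])]
  have t2 : Tendsto (fun x => cauchyC f θ (shift ε x)) (𝓝[side f ε] y)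
      (𝓝 (cauchyC f θ (shift ε y))) := by
    have := (isCauchyKernel_inv.continuousAt_potC hf h.memLp hy').tendsto.comp
      ((continuous_shift ε).tendsto y)
    simp only [Function.comp_def, potC_inv] at this
    exact this.mono_left nhdsWithin_le_nhds
  refine (t1.add t2).congr' ?_
  filter_upwards [hself] with x hx
  exact (hf.cauchyC_eq h hε hx).symm

/-- A Cauchy integral with `H¹` density vanishes at infinity, also along points close to the graph. -/
theorem IsInterface.tendsto_cauchyC_infty {f : ℝ → ℝ} (hf : IsInterface f) {θ ψ : ℝ → ℂ}
    (h : SobH1 θ ψ) {ε : ℝ} (hε : ε ^ 2 = 1) :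
    Tendsto (cauchyC f θ) (Bornology.cobounded Plane ⊓ 𝓟 (side f ε)) (𝓝 0) := by
  obtain ⟨C, -, hC⟩ := hf.exists_logKer_bound
  have hself : ∀ᶠ x in Bornology.cobounded Plane ⊓ 𝓟 (side f ε), x ∈ side f ε :=
    mem_inf_of_right (mem_principal_self _)
  have t1 : Tendsto (fun x => ∫ s, ψ s * logKer f ε x s)
      (Bornology.cobounded Plane ⊓ 𝓟 (side f ε)) (𝓝 (∫ s, ψ s * (0 : ℂ))) := by
    refine tendsto_integral_mul_of_L2_bounded h.memLp_deriv (C := C * ∫ b, majorant b)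
      (k0 := fun _ => 0) ?_ MemLp.zero (ae_of_all _ fun s => ?_)
    · filter_upwards [hself] with x hx
      refine memLp_of_sq_le_majorant (a := x 0) (aestronglyMeasurable_logKer hf.continuous ε x) ?_
      filter_upwards [Measure.ae_ne volume (x 0)] with s hs using hC ε hε x (le_of_lt hx) s hs
    · exact (tendsto_logKer_cobounded f ε s).mono_left inf_le_left
  have t2 := isCauchyKernel_inv.tendsto_potC_shift hf h.memLp hε
  simp only [potC_inv] at t2
  have t3 := t1.add t2
  simp only [mul_zero, integral_zero, add_zero] at t3
  refine t3.congr' ?_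
  filter_upwards [hself] with x hx
  exact (hf.cauchyC_eq h hε hx).symm

/-- For `w` and `w + u` in the right half-plane the principal logarithm of the quotient is the
difference of the logarithms. -/
lemma log_one_add_div {w u : ℂ} (hw : 0 < w.re) (hu : 0 < (w + u).re) :
    Complex.log (1 + u / w) = Complex.log (w + u) - Complex.log w := by
  have hw0 : w ≠ 0 := fun h => by simp [h] at hw
  have hu0 : w + u ≠ 0 := fun h => by simp [h] at hu
  have a1 := abs_lt.1 (Complex.abs_arg_lt_pi_div_two_iff.2 (Or.inl hw))
  have a2 := abs_lt.1 (Complex.abs_arg_lt_pi_div_two_iff.2 (Or.inl hu))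
  have hπ : w.arg ≠ Real.pi := by intro h; linarith [Real.pi_pos]
  have e : 1 + u / w = (w + u) * w⁻¹ := by field_simp
  have a3 : (w⁻¹).arg = -w.arg := by rw [Complex.arg_inv, if_neg hπ]
  rw [e, (Complex.log_mul_eq_add_log_iff hu0 (inv_ne_zero hw0)).2, Complex.log_inv _ hπ]
  · ring
  · rw [a3]; constructor <;> linarith

/-- The Plemelj jump relation for the Cauchy integral. -/
theorem IsInterface.cauchyBdry_jump {f : ℝ → ℝ} (hf : IsInterface f) {θ ψ : ℝ → ℂ}
    (h : SobH1 θ ψ) {y : Plane} (hy : gap f y = 0) :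
    cauchyBdry f θ ψ 1 y - cauchyBdry f θ ψ (-1) y = -(2 * Real.pi * Complex.I) * θ (y 0) := by
  set w : ℝ → ℂ := relC f y with hw
  have hwy : w (y 0) = 0 := by
    apply Complex.ext
    · simp [hw]
    · simpa [hw, gap] using hy
  have hre : ∀ s, (w s).re = y 0 - s := fun s => by simp [hw]
  have hp1 : gap f (shift 1 y) ≠ 0 := by rw [gap_shift, hy]; norm_num
  have hm1 : gap f (shift (-1) y) ≠ 0 := by rw [gap_shift, hy]; norm_num
  have wp : ∀ s, relC f (shift 1 y) s = w s + Complex.I := fun s => by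
    rw [relC_shift]; simp [hw]
  have wm : ∀ s, relC f (shift (-1) y) s = w s - Complex.I := fun s => by
    rw [relC_shift]; simp [hw, sub_eq_add_neg]
  have np : ∀ s, w s + Complex.I ≠ 0 := fun s => by rw [← wp]; exact relC_ne_zero hp1 s
  have nm : ∀ s, w s - Complex.I ≠ 0 := fun s => by rw [← wm]; exact relC_ne_zero hm1 s
  have hd : ∀ s, HasDerivAt w (-tang f s) s := fun s => hf.hasDerivAt_relC y s
  have kp := hf.memLp_cauchyKer hp1
  have km := hf.memLp_cauchyKer hm1
  have lp := hf.memLp_logKer (ε := 1) (by norm_num) (x := y) (by simp [hy])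
  have lm := hf.memLp_logKer (ε := -1) (by norm_num) (x := y) (by simp [hy])
  have cp := hf.continuous_cauchyKer hp1
  have cm := hf.continuous_cauchyKer hm1
  simp only [wp] at kp cp
  simp only [wm] at km cm
  have elp : ∀ s, logKer f 1 y s = -Complex.log (1 + Complex.I / w s) := fun s => by
    simp only [logKer]
    congr 3
    rw [← hw]
    rcases eq_or_ne (w s) 0 with h0 | h0
    · simp [h0]
    · push_cast; field_simp; linear_combination -Complex.I_sq
  have elm : ∀ s, logKer f (-1) y s = -Complex.log (1 + -Complex.I / w s) := fun s => by
    simp only [logKer]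
    congr 3
    rw [← hw]
    rcases eq_or_ne (w s) 0 with h0 | h0
    · simp [h0]
    · push_cast; field_simp; linear_combination Complex.I_sq
  -- the integrand of the jump, up to sign, is the weak derivative of `θ * A` for an angle function
  -- `A` which jumps at the point `y`
  let G : ℝ → ℂ := fun s => ψ s * (logKer f (-1) y s - logKer f 1 y s) +
    θ s * (tang f s / (w s - Complex.I) - tang f s / (w s + Complex.I))
  have iF : Integrable fun s => θ s * (logKer f (-1) y s - logKer f 1 y s) :=
    integrable_mul_of_memLp_two h.memLp (lm.sub lp)
  have iψ : Integrable fun s => ψ s * (logKer f (-1) y s - logKer f 1 y s) :=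
    integrable_mul_of_memLp_two h.memLp_deriv (lm.sub lp)
  have iθ : Integrable fun s => θ s * (tang f s / (w s - Complex.I) - tang f s / (w s + Complex.I)) :=
    integrable_mul_of_memLp_two h.memLp (km.sub kp)
  have iG : Integrable G := iψ.add iθ
  have hψl := locallyIntegrable_of_memLp_two h.memLp_deriv
  -- for `s < y₁` the numbers `w s ± i` lie in the right half-plane, and the difference of their
  -- angles at `s = y₁` is `π`
  have left : ∫ s in Set.Iic (y 0), G s = Real.pi * Complex.I * θ (y 0) := by
    let A : ℝ → ℂ := fun s => Complex.log (w s + Complex.I) - Complex.log (w s - Complex.I)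
    have hA : ∀ s < y 0, A s = logKer f (-1) y s - logKer f 1 y s := by
      intro s hs
      have h1 : 0 < (w s).re := by rw [hre]; linarith
      rw [elp, elm, log_one_add_div h1 (by simpa using h1), log_one_add_div h1 (by simpa using h1)]
      simp only [A]; ring_nf
    have hAd : ∀ s ≤ y 0, HasDerivAt A
        (tang f s / (w s - Complex.I) - tang f s / (w s + Complex.I)) s := by
      intro s hs
      have m1 : w s + Complex.I ∈ Complex.slitPlane := by
        rw [Complex.mem_slitPlane_iff]
        rcases hs.eq_or_lt with rfl | hs
        · right; simp [hwy]
        · left; simp only [Complex.add_re, hre, Complex.I_re]; linarith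
      have m2 : w s - Complex.I ∈ Complex.slitPlane := by
        rw [Complex.mem_slitPlane_iff]
        rcases hs.eq_or_lt with rfl | hs
        · right; simp [hwy]
        · left; simp only [Complex.sub_re, hre, Complex.I_re]; linarith
      refine ((((hd s).add_const Complex.I).clog_real m1).sub
        (((hd s).sub_const Complex.I).clog_real m2)).congr_deriv ?_
      ring
    have hev : ∀ᵐ s ∂volume.restrict (Set.Iic (y 0)), A s =
        logKer f (-1) y s - logKer f 1 y s := by
      filter_upwards [ae_restrict_mem measurableSet_Iic,
        ae_restrict_of_ae (Measure.ae_ne volume (y 0))] with s hs hs'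
      exact hA s (lt_of_le_of_ne hs hs')
    have key := integral_Iic_of_sub (F := fun s => θ s * A s)
      (G := fun s => ψ s * A s + θ s * (tang f s / (w s - Complex.I) -
        tang f s / (w s + Complex.I))) (c := y 0) (fun a ha => ?_) ?_ ?_
    · rw [show (∫ s in Set.Iic (y 0), G s) = ∫ s in Set.Iic (y 0), (ψ s * A s + θ s *
        (tang f s / (w s - Complex.I) - tang f s / (w s + Complex.I))) from
        integral_congr_ae (by filter_upwards [hev] with s hs; simp only [G, hs]), key]
      simp only [A, hwy, zero_add, zero_sub, Complex.log_I, Complex.log_neg_I]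
      ring
    · refine primitive_mul_sub hψl h.sub_eq (fun s hs => hAd s ?_) (cm.sub cp).continuousOn
      rw [Set.uIcc_of_le ha] at hs; exact hs.2
    · exact iF.integrableOn.congr (by filter_upwards [hev] with s hs; simp only [hs])
    · exact iG.integrableOn.congr (by filter_upwards [hev] with s hs; simp only [G, hs])
  -- for `s > y₁` the numbers `-(w s ± i)` do
  have right : ∫ s in Set.Ioi (y 0), G s = Real.pi * Complex.I * θ (y 0) := by
    let A : ℝ → ℂ := fun s => Complex.log (-(w s + Complex.I)) - Complex.log (-(w s - Complex.I))
    have hA : ∀ s > y 0, A s = logKer f (-1) y s - logKer f 1 y s := by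
      intro s hs
      have h1 : 0 < (-w s).re := by rw [Complex.neg_re, hre]; linarith
      have e1 : Complex.I / w s = (-Complex.I) / (-w s) := by rw [neg_div_neg_eq]
      have e2 : -Complex.I / w s = Complex.I / (-w s) := by rw [div_neg, neg_div]
      rw [elp, elm, e1, e2, log_one_add_div h1 (by simpa using h1),
        log_one_add_div h1 (by simpa using h1)]
      simp only [A]; ring_nf
    have hAd : ∀ s ≥ y 0, HasDerivAt A
        (tang f s / (w s - Complex.I) - tang f s / (w s + Complex.I)) s := by
      intro s hs
      have m1 : -(w s + Complex.I) ∈ Complex.slitPlane := by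
        rw [Complex.mem_slitPlane_iff]
        rcases (show y 0 ≤ s from hs).eq_or_lt with rfl | hs
        · right; simp [hwy]
        · left; simp only [Complex.neg_re, Complex.add_re, hre, Complex.I_re]; linarith
      have m2 : -(w s - Complex.I) ∈ Complex.slitPlane := by
        rw [Complex.mem_slitPlane_iff]
        rcases (show y 0 ≤ s from hs).eq_or_lt with rfl | hs
        · right; simp [hwy]
        · left; simp only [Complex.neg_re, Complex.sub_re, hre, Complex.I_re]; linarith
      refine (((((hd s).add_const Complex.I).fun_neg).clog_real m1).sub
        ((((hd s).sub_const Complex.I).fun_neg).clog_real m2)).congr_deriv ?_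
      rw [div_neg, div_neg]
      ring
    have hev : ∀ᵐ s ∂volume.restrict (Set.Ioi (y 0)), A s =
        logKer f (-1) y s - logKer f 1 y s := by
      filter_upwards [ae_restrict_mem measurableSet_Ioi] with s hs
      exact hA s hs
    have key := integral_Ioi_of_sub (F := fun s => θ s * A s)
      (G := fun s => ψ s * A s + θ s * (tang f s / (w s - Complex.I) -
        tang f s / (w s + Complex.I))) (c := y 0) (fun b hb => ?_) ?_ ?_
    · rw [show (∫ s in Set.Ioi (y 0), G s) = ∫ s in Set.Ioi (y 0), (ψ s * A s + θ s *
        (tang f s / (w s - Complex.I) - tang f s / (w s + Complex.I))) from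
        integral_congr_ae (by filter_upwards [hev] with s hs; simp only [G, hs]), key]
      simp only [A, hwy, zero_add, zero_sub, neg_neg, Complex.log_I, Complex.log_neg_I]
      ring
    · refine primitive_mul_sub hψl h.sub_eq (fun s hs => hAd s ?_) (cm.sub cp).continuousOn
      rw [Set.uIcc_of_le hb] at hs; exact hs.1
    · exact iF.integrableOn.congr (by filter_upwards [hev] with s hs; simp only [hs])
    · exact iG.integrableOn.congr (by filter_upwards [hev] with s hs; simp only [G, hs])
  have tot : ∫ s, G s = 2 * Real.pi * Complex.I * θ (y 0) := by
    rw [← intervalIntegral.integral_Iic_add_Ioi (b := y 0) iG.integrableOn iG.integrableOn, left,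
      right]
    ring
  have e1 : ∫ s, G s = ((∫ s, ψ s * logKer f (-1) y s) - ∫ s, ψ s * logKer f 1 y s) +
      ((∫ s, θ s * (tang f s / (w s - Complex.I))) -
        ∫ s, θ s * (tang f s / (w s + Complex.I))) := by
    simp only [G]
    rw [integral_add iψ iθ]
    simp only [mul_sub]
    rw [integral_sub (integrable_mul_of_memLp_two h.memLp_deriv lm)
      (integrable_mul_of_memLp_two h.memLp_deriv lp),
      integral_sub (integrable_mul_of_memLp_two h.memLp km)
      (integrable_mul_of_memLp_two h.memLp kp)]
  simp only [cauchyBdry, cauchyC, wp, wm]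
  rw [e1] at tot
  linear_combination -tot

/-! ### The second kernel -/

lemma IsInterface.sobH1_div_tang {f : ℝ → ℝ} (hf : IsInterface f) {θ ψ : ℝ → ℂ} (h : SobH1 θ ψ) :
    ∃ ψ', SobH1 (fun s => θ s / tang f s) ψ' := by
  obtain ⟨Λ, hΛ, hb, hb2, hL⟩ := hf.exists_bound
  have hd : ∀ s, HasDerivAt (fun s => (tang f s)⁻¹)
      (-(((deriv (deriv f) s : ℝ) : ℂ) * Complex.I) / tang f s ^ 2) s := fun s =>
    (hf.hasDerivAt_tang s).fun_inv (tang_ne_zero f s)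
  have hc : Continuous fun s => -(((deriv (deriv f) s : ℝ) : ℂ) * Complex.I) / tang f s ^ 2 := by
    have h2 := hf.continuous_deriv2
    have h1 := hf.continuous_tang
    exact (by fun_prop : Continuous fun s => -(((deriv (deriv f) s : ℝ) : ℂ) * Complex.I)).div
      (h1.pow 2) fun s => pow_ne_zero 2 (tang_ne_zero f s)
  have key := h.mul (C := 1 + Λ) hd hc (fun s => ?_) (fun s => ?_)
  · exact ⟨_, by simpa only [div_eq_mul_inv] using key⟩
  · rw [norm_inv]
    exact (inv_le_one_of_one_le₀ (one_le_norm_tang f s)).trans (by linarith)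
  · rw [norm_div, norm_neg, norm_mul, Complex.norm_I, mul_one, Complex.norm_real, norm_pow]
    refine (div_le_self (norm_nonneg _) (one_le_pow₀ (one_le_norm_tang f s))).trans ?_
    rw [Real.norm_eq_abs]; linarith [hb2 s]

lemma IsInterface.hasDerivAt_conj_tang {f : ℝ → ℝ} (hf : IsInterface f) (s : ℝ) :
    HasDerivAt (fun s => conj (tang f s)) (conj (((deriv (deriv f) s : ℝ) : ℂ) * Complex.I)) s := by
  have h := (hf.hasDerivAt_tang s)
  exact h.star

lemma IsInterface.sobH1_mul_conj_tang {f : ℝ → ℝ} (hf : IsInterface f) {θ ψ : ℝ → ℂ}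
    (h : SobH1 θ ψ) : ∃ ψ', SobH1 (fun s => θ s * conj (tang f s)) ψ' := by
  obtain ⟨Λ, hΛ, hb, hb2, hL⟩ := hf.exists_bound
  have hc : Continuous fun s => conj (((deriv (deriv f) s : ℝ) : ℂ) * Complex.I) := by
    have h2 := hf.continuous_deriv2
    fun_prop
  refine ⟨_, h.mul (C := 1 + Λ) hf.hasDerivAt_conj_tang hc (fun s => ?_) (fun s => ?_)⟩
  · rw [RCLike.norm_conj]
    have := Complex.norm_le_abs_re_add_abs_im (tang f s)
    rw [tang_re, tang_im, abs_one] at this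
    linarith [hb s]
  · rw [RCLike.norm_conj, norm_mul, Complex.norm_I, mul_one, Complex.norm_real, Real.norm_eq_abs]
    linarith [hb2 s]

/-- The density of the Cauchy integral with the same jump as `dauC f θ`. -/
noncomputable def rotDens (f : ℝ → ℝ) (θ : ℝ → ℂ) (s : ℝ) : ℂ := θ s * (conj (tang f s) / tang f s)

lemma IsInterface.sobH1_rot {f : ℝ → ℝ} (hf : IsInterface f) {θ ψ : ℝ → ℂ} (h : SobH1 θ ψ) :
    ∃ ψ', SobH1 (rotDens f θ) ψ' := by
  obtain ⟨ψ1, h1⟩ := hf.sobH1_mul_conj_tang h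
  obtain ⟨ψ2, h2⟩ := hf.sobH1_div_tang h1
  simp only [mul_div_assoc] at h2
  exact ⟨ψ2, h2⟩

/-- The potential `∫ θ conj(z - ζ) (z - ζ)⁻² dζ` over the graph. -/
noncomputable def dauC (f : ℝ → ℝ) (θ : ℝ → ℂ) (x : Plane) : ℂ :=
  potC f (fun w => conj w / w ^ 2) θ x

/-- The part of `dauC` that is continuous across the graph. -/
noncomputable def regC (f : ℝ → ℝ) (θ : ℝ → ℂ) (x : Plane) : ℂ :=
  dauC f θ x - cauchyC f (rotDens f θ) x

/-- The bounded kernel `conj w / w`, which is discontinuous at the origin only. -/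
noncomputable def angKer (f : ℝ → ℝ) (x : Plane) (s : ℝ) : ℂ := conj (relC f x s) / relC f x s

lemma norm_angKer_sub_le {f : ℝ → ℝ} {x p : Plane} {s : ℝ} (hp : relC f p s ≠ 0) :
    ‖angKer f x s - angKer f p s‖ ≤ 2 * ‖x - p‖ / ‖relC f p s‖ := by
  have hn : 0 < ‖relC f p s‖ := norm_pos_iff.2 hp
  rw [← norm_relC_sub f x p s, le_div_iff₀ hn]
  unfold angKer
  rcases eq_or_ne (relC f x s) 0 with h0 | h0
  · rw [h0]
    simp only [map_zero, zero_div, zero_sub, norm_neg, norm_div, RCLike.norm_conj]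
    rw [div_self hn.ne']; linarith
  · have hn0 : 0 < ‖relC f x s‖ := norm_pos_iff.2 h0
    have e : (conj (relC f x s) / relC f x s - conj (relC f p s) / relC f p s) * relC f p s =
        (conj (relC f x s) / relC f x s) * (relC f p s - relC f x s) +
          conj (relC f x s - relC f p s) := by
      rw [map_sub]; field_simp; ring
    rw [← norm_mul, e]
    refine (norm_add_le _ _).trans ?_
    rw [norm_mul, norm_div, RCLike.norm_conj, RCLike.norm_conj, div_self hn0.ne', one_mul,
      norm_sub_rev]
    linarith

lemma measurable_angKer {f : ℝ → ℝ} (hf : Continuous f) (x : Plane) : Measurable (angKer f x) := by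
  have h1 := (continuous_relC hf x).measurable
  have h2 : Measurable fun s => conj (relC f x s) :=
    (Complex.continuous_conj.comp (continuous_relC hf x)).measurable
  exact h2.div h1

lemma IsInterface.exists_angKer_bound {f : ℝ → ℝ} (hf : IsInterface f) {d : ℝ} (hd : 0 < d) :
    ∃ C, 0 ≤ C ∧ ∀ x p : Plane, d ≤ |gap f p| → ∀ s,
      ‖angKer f x s - angKer f p s‖ ^ 2 ≤ 4 * ‖x - p‖ ^ 2 * C * majorant (s - p 0) := by
  obtain ⟨C, hC0, hC⟩ := hf.exists_cauchyKer_bound hd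
  refine ⟨C, hC0, fun x p hp s => ?_⟩
  have hp0 : gap f p ≠ 0 := by rw [← abs_pos]; linarith
  have h0 : 0 < ‖relC f p s‖ := norm_pos_iff.2 (relC_ne_zero hp0 s)
  have h1 := norm_angKer_sub_le (x := x) (relC_ne_zero hp0 s)
  have h2 := hC p hp s (relC f p s)⁻¹ (by
    rw [norm_inv, ← one_div]; gcongr; exact one_le_norm_tang f s)
  calc ‖angKer f x s - angKer f p s‖ ^ 2 ≤ (2 * ‖x - p‖ / ‖relC f p s‖) ^ 2 := by gcongr
    _ = 4 * ‖x - p‖ ^ 2 * ‖(relC f p s)⁻¹‖ ^ 2 := by rw [norm_inv]; ring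
    _ ≤ 4 * ‖x - p‖ ^ 2 * (C * majorant (s - p 0)) := by gcongr
    _ = _ := by ring

lemma IsInterface.memLp_angKer_sub {f : ℝ → ℝ} (hf : IsInterface f) (x : Plane) {p : Plane}
    (hp : gap f p ≠ 0) : MemLp (fun s => angKer f x s - angKer f p s) 2 := by
  obtain ⟨C, -, hC⟩ := hf.exists_angKer_bound (abs_pos.2 hp)
  exact (memLp_of_sq_le_majorant ((measurable_angKer hf.continuous x).sub
    (measurable_angKer hf.continuous p)).aestronglyMeasurable
    (ae_of_all _ fun s => hC x p le_rfl s)).1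

/-- The differences of `regC` are integrals with a bounded kernel. -/
lemma IsInterface.regC_sub {f : ℝ → ℝ} (hf : IsInterface f) {θ ψ : ℝ → ℂ} (h : SobH1 θ ψ)
    {x p : Plane} (hx : gap f x ≠ 0) (hp : gap f p ≠ 0) :
    regC f θ x = regC f θ p - ∫ s, ψ s * (angKer f x s - angKer f p s) := by
  obtain ⟨ψ2, h2⟩ := hf.sobH1_rot h
  have hd : ∀ {y : Plane}, gap f y ≠ 0 → ∀ s, HasDerivAt (angKer f y)
      (tang f s * (conj (relC f y s) / relC f y s ^ 2) - conj (tang f s) / relC f y s) s := by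
    intro y hy s
    have h0 := relC_ne_zero hy s
    have d1 := hf.hasDerivAt_relC y s
    have d2 : HasDerivAt (fun s => conj (relC f y s)) (conj (-tang f s)) s := d1.star
    refine (d2.fun_div d1 h0).congr_deriv ?_
    rw [map_neg]; field_simp; ring
  have hc : ∀ {y : Plane}, gap f y ≠ 0 → Continuous fun s =>
      tang f s * (conj (relC f y s) / relC f y s ^ 2) - conj (tang f s) / relC f y s := by
    intro y hy
    refine (isCauchyKernel_conj.continuous_ker hf hy).sub (Continuous.div ?_
      (continuous_relC hf.continuous y) (relC_ne_zero hy))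
    exact Complex.continuous_conj.comp hf.continuous_tang
  have i1 : ∀ {y : Plane}, gap f y ≠ 0 →
      Integrable fun s => θ s * (tang f s * (conj (relC f y s) / relC f y s ^ 2)) := fun hy =>
    integrable_mul_of_memLp_two h.memLp (isCauchyKernel_conj.memLp hf hy)
  have i2 : ∀ {y : Plane}, gap f y ≠ 0 →
      Integrable fun s => rotDens f θ s * (tang f s / relC f y s) := fun hy =>
    integrable_mul_of_memLp_two h2.memLp (hf.memLp_cauchyKer hy)
  have e : ∀ {y : Plane}, gap f y ≠ 0 → ∀ s,
      θ s * (tang f s * (conj (relC f y s) / relC f y s ^ 2) - conj (tang f s) / relC f y s) =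
        θ s * (tang f s * (conj (relC f y s) / relC f y s ^ 2)) -
          rotDens f θ s * (tang f s / relC f y s) := by
    intro y hy s
    have h0 := relC_ne_zero hy s
    have h1 := tang_ne_zero f s
    unfold rotDens
    field_simp
  have i3 : ∀ {y : Plane}, gap f y ≠ 0 → Integrable fun s =>
      θ s * (tang f s * (conj (relC f y s) / relC f y s ^ 2) - conj (tang f s) / relC f y s) := by
    intro y hy
    simp only [e hy]
    exact (i1 hy).sub (i2 hy)
  have r : ∀ {y : Plane}, gap f y ≠ 0 → regC f θ y = ∫ s,
      θ s * (tang f s * (conj (relC f y s) / relC f y s ^ 2) - conj (tang f s) / relC f y s) := by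
    intro y hy
    simp only [e hy]
    rw [integral_sub (i1 hy) (i2 hy)]
    rfl
  -- `d/ds (conj w / w)` is the second kernel minus the Cauchy kernel with the rotated tangent; only
  -- the difference of the angular kernels at two points is square integrable at infinity
  have key := h.integral_mul_deriv (B := fun s => angKer f x s - angKer f p s)
    (fun s => (hd hx s).fun_sub (hd hp s)) ((hc hx).sub (hc hp))
    (integrable_mul_of_memLp_two h.memLp (hf.memLp_angKer_sub x hp))
    (integrable_mul_of_memLp_two h.memLp_deriv (hf.memLp_angKer_sub x hp)) (by
      refine ((i3 hx).sub (i3 hp)).congr (ae_of_all _ fun s => ?_)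
      simp only [Pi.sub_apply]; ring)
  simp only [mul_sub (θ _) (_ - _) (_ - _)] at key
  rw [integral_sub (i3 hx) (i3 hp), ← r hx, ← r hp] at key
  linear_combination key

lemma tendsto_angKer {f : ℝ → ℝ} {y : Plane} {s : ℝ} (hs : s ≠ y 0) :
    Tendsto (fun x => angKer f x s) (𝓝 y) (𝓝 (angKer f y s)) := by
  have h1 := (continuous_relC_left f s).tendsto y
  exact (((Complex.continuous_conj.tendsto _).comp h1).div h1 (relC_ne_zero_of_ne hs))

/-- `regC` has a limit at the graph from the whole complement, because `angKer` is bounded and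
continuous off one point. -/
lemma IsInterface.exists_tendsto_regC {f : ℝ → ℝ} (hf : IsInterface f) {θ ψ : ℝ → ℂ}
    (h : SobH1 θ ψ) {y : Plane} (hy : gap f y = 0) :
    ∃ e, Tendsto (regC f θ) (𝓝[{x | gap f x ≠ 0}] y) (𝓝 e) := by
  have hp : gap f (shift 1 y) ≠ 0 := by rw [gap_shift, hy]; norm_num
  obtain ⟨C, hC0, hC⟩ := hf.exists_angKer_bound (abs_pos.2 hp)
  refine ⟨regC f θ (shift 1 y) - ∫ s, ψ s * (angKer f y s - angKer f (shift 1 y) s), ?_⟩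
  have t1 : Tendsto (fun x => ∫ s, ψ s * (angKer f x s - angKer f (shift 1 y) s))
      (𝓝[{x | gap f x ≠ 0}] y) (𝓝 (∫ s, ψ s * (angKer f y s - angKer f (shift 1 y) s))) := by
    refine tendsto_integral_mul_of_L2_bounded h.memLp_deriv
      (C := 4 * (‖y - shift 1 y‖ + 1) ^ 2 * C * ∫ b, majorant b) ?_
      (hf.memLp_angKer_sub y hp) ?_
    · have hev : ∀ᶠ x in 𝓝[{x | gap f x ≠ 0}] y, ‖x - shift 1 y‖ < ‖y - shift 1 y‖ + 1 :=
        nhdsWithin_le_nhds ((continuous_id.sub continuous_const).norm.tendsto y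
          (Iio_mem_nhds (lt_add_one _)))
      filter_upwards [hev] with x hx
      refine memLp_of_sq_le_majorant (a := shift 1 y 0) ((measurable_angKer hf.continuous x).sub
        (measurable_angKer hf.continuous _)).aestronglyMeasurable (ae_of_all _ fun s => ?_)
      refine (hC x _ le_rfl s).trans ?_
      have := majorant_nonneg (s - shift 1 y 0)
      gcongr
    · filter_upwards [Measure.ae_ne volume (y 0)] with s hs
      exact ((tendsto_angKer hs).sub tendsto_const_nhds).mono_left nhdsWithin_le_nhds
  refine (tendsto_const_nhds.sub t1).congr' ?_
  filter_upwards [self_mem_nhdsWithin] with x hx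
  exact (hf.regC_sub h hx hp).symm

lemma IsInterface.tendsto_regC_infty {f : ℝ → ℝ} (hf : IsInterface f) {θ ψ : ℝ → ℂ}
    (h : SobH1 θ ψ) {ε : ℝ} (hε : ε ^ 2 = 1) :
    Tendsto (regC f θ) (Bornology.cobounded Plane ⊓ 𝓟 (side f ε)) (𝓝 0) := by
  obtain ⟨ψ2, h2⟩ := hf.sobH1_rot h
  obtain ⟨C, hC0, hC⟩ := hf.exists_angKer_bound one_pos
  have hself : ∀ᶠ x in Bornology.cobounded Plane ⊓ 𝓟 (side f ε), x ∈ side f ε :=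
    mem_inf_of_right (mem_principal_self _)
  have hnorm : ∀ x : Plane, ‖x - shift ε x‖ = 1 := by
    intro x
    rw [EuclideanSpace.norm_eq, Fin.sum_univ_two]
    simp [abs_eq_one_of_sq hε]
  have t1 : Tendsto (fun x => ∫ s, ψ s * (angKer f x s - angKer f (shift ε x) s))
      (Bornology.cobounded Plane ⊓ 𝓟 (side f ε)) (𝓝 (∫ s, ψ s * (0 : ℂ))) := by
    refine tendsto_integral_mul_of_L2_bounded h.memLp_deriv (C := 4 * C * ∫ b, majorant b)
      (k0 := fun _ => 0) ?_ MemLp.zero (ae_of_all _ fun s => ?_)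
    · filter_upwards [hself] with x hx
      refine memLp_of_sq_le_majorant (a := x 0) ((measurable_angKer hf.continuous x).sub
        (measurable_angKer hf.continuous _)).aestronglyMeasurable (ae_of_all _ fun s => ?_)
      have := hC x _ (gap_shift_abs hε (le_of_lt hx)) s
      rw [hnorm] at this
      simpa using this
    · have h1 : Tendsto (fun x => (relC f (shift ε x) s))
          (Bornology.cobounded Plane ⊓ 𝓟 (side f ε)) (Bornology.cobounded ℂ) :=
        ((tendsto_relC_cobounded f s).comp (tendsto_shift_cobounded ε)).mono_left inf_le_left
      have h3 := (tendsto_inv₀_cobounded.comp h1).norm.const_mul 2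
      rw [norm_zero, mul_zero] at h3
      refine squeeze_zero_norm' ?_ h3
      filter_upwards [hself] with x hx
      have hp : gap f (shift ε x) ≠ 0 := by
        rw [← abs_pos]; linarith [gap_shift_abs hε (x := x) (f := f) (le_of_lt hx)]
      have := norm_angKer_sub_le (x := x) (relC_ne_zero hp s)
      rw [hnorm] at this
      simpa [div_eq_mul_inv] using this
  have t2 := isCauchyKernel_inv.tendsto_potC_shift hf h2.memLp hε
  have t3 := isCauchyKernel_conj.tendsto_potC_shift hf h.memLp hε
  simp only [potC_inv] at t2
  have t4 := (t3.sub t2).sub t1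
  simp only [mul_zero, integral_zero, sub_zero] at t4
  refine t4.congr' ?_
  filter_upwards [hself] with x hx
  have hp : gap f (shift ε x) ≠ 0 := by
    rw [← abs_pos]; linarith [gap_shift_abs hε (x := x) (f := f) (le_of_lt hx)]
  exact (hf.regC_sub h (side_gap_ne hx) hp).symm

/-! ### Boundary behaviour of potentials with kernels of degree `-1` -/

/-- The kernel `Re (a / z + b conj z / z²)`; these are the odd kernels of degree `-1` that occur in
the Stokes system. -/
noncomputable def kerAB (a b z : ℂ) : ℝ := (a * z⁻¹ + b * (conj z / z ^ 2)).re

/-- The jump symbol of `kerAB a b`. -/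
noncomputable def jumpAB (f : ℝ → ℝ) (a b : ℂ) (s : ℝ) : ℝ :=
  (-(2 * Real.pi * Complex.I) * (a / tang f s + b * conj (tang f s) / tang f s ^ 2)).re

/-- The potential with kernel `kerAB a b` and density `φ`. -/
noncomputable def potAB (f : ℝ → ℝ) (a b : ℂ) (φ : ℝ → ℝ) (x : Plane) : ℝ :=
  ∫ s, φ s * kerAB a b (relC f x s)

lemma IsInterface.integrable_potAB {f : ℝ → ℝ} (hf : IsInterface f) {φ : ℝ → ℝ}
    (hφ : MemLp (fun s => (φ s : ℂ)) 2) {x : Plane} (hx : gap f x ≠ 0) :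
    Integrable (fun s => (φ s : ℂ) * (relC f x s)⁻¹) ∧
    Integrable (fun s => (φ s : ℂ) * (conj (relC f x s) / relC f x s ^ 2)) := by
  have hc := continuous_relC hf.continuous x
  have h0 := relC_ne_zero hx
  refine ⟨integrable_mul_of_memLp_two hφ (hf.memLp_of_le_cauchyKer hx (hc.inv₀ h0) fun s => ?_),
    integrable_mul_of_memLp_two hφ (hf.memLp_of_le_cauchyKer hx ?_ fun s => ?_)⟩
  · rw [norm_inv, ← one_div]; gcongr; exact one_le_norm_tang f s
  · exact (Complex.continuous_conj.comp hc).div (hc.pow 2) fun s => pow_ne_zero 2 (h0 s)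
  · refine (isCauchyKernel_conj.norm_le _).trans ?_
    rw [← one_div]; gcongr; exact one_le_norm_tang f s

/-- The line element of the Cauchy integrals is `tang f s`; division of the density by it gives the
integrals with respect to `s`. -/
lemma IsInterface.potAB_eq {f : ℝ → ℝ} (hf : IsInterface f) (a b : ℂ) {φ : ℝ → ℝ}
    (hφ : MemLp (fun s => (φ s : ℂ)) 2) {x : Plane} (hx : gap f x ≠ 0) :
    potAB f a b φ x = (a * cauchyC f (fun s => φ s / tang f s) x +
      b * dauC f (fun s => φ s / tang f s) x).re := by
  obtain ⟨i1, i2⟩ := hf.integrable_potAB hφ hx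
  have e1 : cauchyC f (fun s => φ s / tang f s) x = ∫ s, (φ s : ℂ) * (relC f x s)⁻¹ := by
    refine integral_congr_ae (ae_of_all _ fun s => ?_)
    have := tang_ne_zero f s
    simp only; field_simp
  have e2 : dauC f (fun s => φ s / tang f s) x =
      ∫ s, (φ s : ℂ) * (conj (relC f x s) / relC f x s ^ 2) := by
    refine integral_congr_ae (ae_of_all _ fun s => ?_)
    have := tang_ne_zero f s
    simp only; field_simp
  rw [e1, e2, ← integral_const_mul, ← integral_const_mul,
    ← integral_add (i1.const_mul a) (i2.const_mul b)]
  have := integral_re ((i1.const_mul a).add (i2.const_mul b))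
  simp only [RCLike.re_to_complex, Pi.add_apply] at this
  rw [← this]
  refine integral_congr_ae (ae_of_all _ fun s => ?_)
  simp only [kerAB]
  rw [show a * (↑(φ s) * (relC f x s)⁻¹) + b * (↑(φ s) * (conj (relC f x s) / relC f x s ^ 2)) =
    (φ s : ℂ) * (a * (relC f x s)⁻¹ + b * (conj (relC f x s) / relC f x s ^ 2)) by ring,
    Complex.re_ofReal_mul]

/-- Potentials with an `H¹` density have one-sided limits at the graph, whose difference is the jump
symbol times the density. -/
theorem IsInterface.potAB_jump {f : ℝ → ℝ} (hf : IsInterface f) (a b : ℂ) {φ : ℝ → ℝ} {ψ : ℝ → ℂ}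
    (h : SobH1 (fun s => (φ s : ℂ)) ψ) (ξ : ℝ) :
    ∃ L : ℝ → ℝ, (∀ ε, ε ^ 2 = 1 → Tendsto (potAB f a b φ) (𝓝[side f ε] (Xi f ξ)) (𝓝 (L ε))) ∧
      L 1 - L (-1) = jumpAB f a b ξ * φ ξ := by
  obtain ⟨ψ1, h1⟩ := hf.sobH1_div_tang h
  obtain ⟨ψ2, h2⟩ := hf.sobH1_rot h1
  have hy : gap f (Xi f ξ) = 0 := by simp [gap, Xi]
  obtain ⟨e, he⟩ := hf.exists_tendsto_regC h1 hy
  have hsub : ∀ ε, side f ε ⊆ {x | gap f x ≠ 0} := fun ε x hx => side_gap_ne hx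
  refine ⟨fun ε => (a * cauchyBdry f (fun s => φ s / tang f s) ψ1 ε (Xi f ξ) +
    b * (e + cauchyBdry f (rotDens f fun s => φ s / tang f s) ψ2 ε (Xi f ξ))).re,
    fun ε hε => ?_, ?_⟩
  · have t1 := hf.tendsto_cauchyC h1 hε hy
    have t2 := hf.tendsto_cauchyC h2 hε hy
    have t3 := (he.mono_left (nhdsWithin_mono _ (hsub ε))).add t2
    have t4 := (Complex.continuous_re.tendsto _).comp ((t1.const_mul a).add (t3.const_mul b))
    refine t4.congr' ?_
    filter_upwards [self_mem_nhdsWithin] with x hx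
    rw [hf.potAB_eq a b h.memLp (side_gap_ne hx)]
    simp only [Function.comp, regC]
    congr 1
    ring
  · have j1 := hf.cauchyBdry_jump h1 hy
    have j2 := hf.cauchyBdry_jump h2 hy
    have hx0 : Xi f ξ 0 = ξ := by simp [Xi]
    rw [hx0] at j1 j2
    simp only
    rw [← Complex.sub_re]
    have : (a * cauchyBdry f (fun s => φ s / tang f s) ψ1 1 (Xi f ξ) +
        b * (e + cauchyBdry f (rotDens f fun s => φ s / tang f s) ψ2 1 (Xi f ξ))) -
        (a * cauchyBdry f (fun s => φ s / tang f s) ψ1 (-1) (Xi f ξ) +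
        b * (e + cauchyBdry f (rotDens f fun s => φ s / tang f s) ψ2 (-1) (Xi f ξ))) =
        (φ ξ : ℂ) * (-(2 * Real.pi * Complex.I) *
          (a / tang f ξ + b * conj (tang f ξ) / tang f ξ ^ 2)) := by
      have ht := tang_ne_zero f ξ
      have : (φ ξ : ℂ) * (-(2 * Real.pi * Complex.I) *
          (a / tang f ξ + b * conj (tang f ξ) / tang f ξ ^ 2)) =
          a * (-(2 * Real.pi * Complex.I) * (φ ξ / tang f ξ)) +
          b * (-(2 * Real.pi * Complex.I) * (φ ξ / tang f ξ * (conj (tang f ξ) / tang f ξ))) := by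
        field_simp
        ring
      simp only [rotDens] at j1 j2 ⊢
      rw [this, ← j1, ← j2]
      ring
    rw [this, Complex.re_ofReal_mul, jumpAB, mul_comm]

/-- Potentials with an `H¹` density vanish at infinity. -/
theorem IsInterface.potAB_tendsto_infty {f : ℝ → ℝ} (hf : IsInterface f) (a b : ℂ) {φ : ℝ → ℝ}
    {ψ : ℝ → ℂ} (h : SobH1 (fun s => (φ s : ℂ)) ψ) {ε : ℝ} (hε : ε ^ 2 = 1) :
    Tendsto (potAB f a b φ) (Bornology.cobounded Plane ⊓ 𝓟 (side f ε)) (𝓝 0) := by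
  obtain ⟨ψ1, h1⟩ := hf.sobH1_div_tang h
  obtain ⟨ψ2, h2⟩ := hf.sobH1_rot h1
  have t1 := hf.tendsto_cauchyC_infty h1 hε
  have t2 := hf.tendsto_cauchyC_infty h2 hε
  have t3 := (hf.tendsto_regC_infty h1 hε).add t2
  have t4 := (Complex.continuous_re.tendsto _).comp ((t1.const_mul a).add (t3.const_mul b))
  simp only [mul_zero, add_zero, Complex.zero_re] at t4
  refine t4.congr' ?_
  filter_upwards [mem_inf_of_right (mem_principal_self (side f ε))] with x hx
  rw [hf.potAB_eq a b h.memLp (side_gap_ne hx)]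
  simp only [Function.comp, regC]
  congr 1
  ring

/-! ### Potentials with homogeneous kernels off the graph -/

/-- Kernels that are smooth off the origin and positively homogeneous of degree `-m`. -/
structure IsHomKernel (m : ℕ) (K : Plane → ℝ) : Prop where
  contDiffOn : ContDiffOn ℝ ∞ K {0}ᶜ
  homog : ∀ t : ℝ, 0 < t → ∀ y : Plane, y ≠ 0 → K (t • y) = (t ^ m)⁻¹ * K y

lemma IsHomKernel.contDiffAt {m : ℕ} {K : Plane → ℝ} (hK : IsHomKernel m K) {y : Plane}
    (hy : y ≠ 0) : ContDiffAt ℝ ∞ K y :=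
  hK.contDiffOn.contDiffAt (isOpen_compl_singleton.mem_nhds hy)

lemma IsHomKernel.differentiableAt {m : ℕ} {K : Plane → ℝ} (hK : IsHomKernel m K) {y : Plane}
    (hy : y ≠ 0) : DifferentiableAt ℝ K y :=
  (hK.contDiffAt hy).differentiableAt (by simp)

lemma IsHomKernel.pd {m : ℕ} {K : Plane → ℝ} (hK : IsHomKernel m K) (i : Fin 2) :
    IsHomKernel (m + 1) (pd i K) := by
  constructor
  · have h := hK.contDiffOn.fderiv_of_isOpen isOpen_compl_singleton (m := ∞) (by simp)
    exact h.clm_apply contDiffOn_const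
  · intro t ht y hy
    have hty : t • y ≠ 0 := smul_ne_zero ht.ne' hy
    have h1 : HasFDerivAt (fun y => K (t • y)) ((fderiv ℝ K (t • y)).comp
        (t • ContinuousLinearMap.id ℝ Plane)) y :=
      (hK.differentiableAt hty).hasFDerivAt.comp y ((hasFDerivAt_id y).const_smul t)
    have h2 : HasFDerivAt (fun y => K (t • y)) ((t ^ m)⁻¹ • fderiv ℝ K y) y := by
      refine ((hK.differentiableAt hy).hasFDerivAt.const_mul ((t ^ m)⁻¹)).congr_of_eventuallyEq ?_
      filter_upwards [isOpen_compl_singleton.mem_nhds hy] with z hz using hK.homog t ht z hz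
    have h3 := congrArg (fun L => L (EuclideanSpace.single i 1)) (h1.unique h2)
    simp only [ContinuousLinearMap.comp_apply, smul_apply, map_smul,
      ContinuousLinearMap.id_apply, smul_eq_mul] at h3
    simp only [StokesGraph.pd]
    rw [pow_succ, mul_inv, mul_right_comm, ← h3]
    field_simp

lemma IsHomKernel.exists_bound {m : ℕ} {K : Plane → ℝ} (hK : IsHomKernel m K) :
    ∃ C, 0 ≤ C ∧ ∀ y : Plane, y ≠ 0 → |K y| ≤ C * (‖y‖ ^ m)⁻¹ := by
  have hc : ContinuousOn K (Metric.sphere 0 1) := hK.contDiffOn.continuousOn.mono fun y hy => by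
    rintro rfl
    simp at hy
  obtain ⟨C, hC⟩ := (isCompact_sphere (0 : Plane) 1).exists_bound_of_continuousOn hc
  refine ⟨|C|, abs_nonneg C, fun y hy => ?_⟩
  have hn : 0 < ‖y‖ := norm_pos_iff.2 hy
  have hm : ‖y‖⁻¹ • y ∈ Metric.sphere (0 : Plane) 1 := by
    rw [mem_sphere_zero_iff_norm, norm_smul, norm_inv, norm_norm, inv_mul_cancel₀ hn.ne']
  have h1 := hC _ hm
  have hne : ‖y‖⁻¹ • y ≠ 0 := smul_ne_zero (inv_ne_zero hn.ne') hy
  have h2 := hK.homog ‖y‖ hn _ hne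
  rw [smul_smul, mul_inv_cancel₀ hn.ne', one_smul] at h2
  rw [h2, abs_mul, abs_of_pos (by positivity), mul_comm]
  exact mul_le_mul_of_nonneg_right (h1.trans (le_abs_self C)) (by positivity)

lemma clm_eq_sum_proj (L : Plane →L[ℝ] ℝ) :
    L = ∑ i, L (EuclideanSpace.single i 1) • (EuclideanSpace.proj i : Plane →L[ℝ] ℝ) := by
  ext v
  have hv : v = ∑ i, v i • (EuclideanSpace.single i 1 : Plane) := by
    ext j
    fin_cases j <;> simp
  conv_lhs => rw [hv]
  simp [mul_comm]

lemma fderiv_eq_sum_pd (u : Plane → ℝ) (x : Plane) :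
    fderiv ℝ u x = ∑ i, pd i u x • (EuclideanSpace.proj i : Plane →L[ℝ] ℝ) :=
  clm_eq_sum_proj _

lemma norm_proj_le (i : Fin 2) : ‖(EuclideanSpace.proj i : Plane →L[ℝ] ℝ)‖ ≤ 1 :=
  ContinuousLinearMap.opNorm_le_bound _ zero_le_one fun v => by
    rw [one_mul]; exact EuclideanSpace.norm_eq v ▸ by
      rw [← Real.sqrt_sq (norm_nonneg _)]
      exact Real.sqrt_le_sqrt (Finset.single_le_sum (f := fun i => ‖v i‖ ^ 2)
        (fun _ _ => by positivity) (Finset.mem_univ i))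

lemma norm_fderiv_le_sum_pd (u : Plane → ℝ) (x : Plane) : ‖fderiv ℝ u x‖ ≤ ∑ i, |pd i u x| := by
  rw [fderiv_eq_sum_pd]
  refine (norm_sum_le _ _).trans (Finset.sum_le_sum fun i _ => ?_)
  rw [norm_smul, Real.norm_eq_abs]
  exact mul_le_of_le_one_right (abs_nonneg _) (norm_proj_le i)

/-- The potential `∫ φ(s) K(x - (s, f s)) ds`. -/
noncomputable def potK (f : ℝ → ℝ) (K : Plane → ℝ) (φ : ℝ → ℝ) (x : Plane) : ℝ :=
  ∫ s, φ s * K (x - Xi f s)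

lemma continuous_Xi {f : ℝ → ℝ} (hf : Continuous f) : Continuous (Xi f) := by
  unfold Xi; fun_prop

lemma sub_Xi_ne_zero {f : ℝ → ℝ} {x : Plane} (hx : gap f x ≠ 0) (s : ℝ) : x - Xi f s ≠ 0 := by
  rw [← norm_pos_iff, ← norm_relC, norm_pos_iff]; exact relC_ne_zero hx s

lemma IsInterface.exists_norm_sub_Xi_ge {f : ℝ → ℝ} (hf : IsInterface f) {x₀ : Plane}
    (hx : gap f x₀ ≠ 0) : ∃ C, 0 < C ∧ ∀ᶠ x in 𝓝 x₀, gap f x ≠ 0 ∧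
      ∀ s, 1 + |s - x₀ 0| ≤ C * ‖x - Xi f s‖ := by
  obtain ⟨Λ, hΛ, -, -, hL⟩ := hf.exists_bound
  have hd : 0 < |gap f x₀| / 2 := by have := abs_pos.2 hx; positivity
  refine ⟨2 * ((1 + Λ) / (|gap f x₀| / 2) + 1), by positivity, ?_⟩
  have e1 : ∀ᶠ x in 𝓝 x₀, |gap f x₀| / 2 < |gap f x| :=
    (continuous_gap hf.continuous).abs.continuousAt.eventually_const_lt (by linarith)
  have e2 : ∀ᶠ x : Plane in 𝓝 x₀, |x 0 - x₀ 0| < 1 := by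
    have : Continuous fun x : Plane => |x 0 - x₀ 0| := by fun_prop
    exact this.continuousAt.eventually_lt_const (by simp)
  filter_upwards [e1, e2] with x h1 h2
  refine ⟨abs_pos.1 (hd.trans h1), fun s => ?_⟩
  have h3 := one_add_abs_le_norm_relC hΛ hL hd h1.le s
  rw [norm_relC] at h3
  have h4 : |s - x₀ 0| ≤ |s - x 0| + |x 0 - x₀ 0| := abs_sub_le _ _ _
  have h5 := abs_nonneg (s - x 0)
  nlinarith

lemma memLp_inv_one_add_abs (a : ℝ) : MemLp (fun s : ℝ => (1 + |s - a|)⁻¹) 2 := by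
  have h1 : MemLp (fun s : ℝ => (((1 + |s - a|)⁻¹ : ℝ) : ℂ)) 2 := by
    refine (memLp_of_sq_le_majorant (C := 1) (a := a) ?_ (ae_of_all _ fun s => ?_)).1
    · have : Continuous fun s : ℝ => (((1 + |s - a|)⁻¹ : ℝ) : ℂ) := by
        refine Complex.continuous_ofReal.comp (Continuous.inv₀ (by fun_prop) fun s => ?_)
        positivity
      exact this.aestronglyMeasurable
    · have hp : 0 < 1 + |s - a| := by positivity
      have := sq_le_majorant (b := s - a) (N := (1 + |s - a|)⁻¹) (C := 1) (by positivity)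
        (by rw [inv_mul_cancel₀ hp.ne'])
      rw [Complex.norm_real, Real.norm_eq_abs, abs_of_pos (by positivity)]
      simpa using this
  exact h1.re

/-- Kernels of negative degree are square integrable along the graph, locally uniformly with
respect to points off the graph. -/
lemma IsHomKernel.exists_le {m : ℕ} (hm : 1 ≤ m) {K : Plane → ℝ} (hK : IsHomKernel m K)
    {f : ℝ → ℝ} (hf : IsInterface f) {x₀ : Plane} (hx : gap f x₀ ≠ 0) :
    ∃ C, 0 ≤ C ∧ ∀ᶠ x in 𝓝 x₀, ∀ s, |K (x - Xi f s)| ≤ C * (1 + |s - x₀ 0|)⁻¹ := by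
  obtain ⟨A, hA0, hA⟩ := hK.exists_bound
  obtain ⟨C, hC0, hC⟩ := hf.exists_norm_sub_Xi_ge hx
  refine ⟨A * C ^ m, by positivity, ?_⟩
  filter_upwards [hC] with x hx s
  obtain ⟨hg, hx⟩ := hx
  have hne := sub_Xi_ne_zero hg s
  have hn : 0 < ‖x - Xi f s‖ := norm_pos_iff.2 hne
  have hp : 1 ≤ 1 + |s - x₀ 0| := by linarith [abs_nonneg (s - x₀ 0)]
  refine (hA _ hne).trans ?_
  rw [mul_assoc]
  gcongr
  rw [inv_le_iff_one_le_mul₀ (by positivity)]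
  have h1 : (1 + |s - x₀ 0|) ^ m ≤ (C * ‖x - Xi f s‖) ^ m := by gcongr; exact hx s
  have h2 : 1 + |s - x₀ 0| ≤ (1 + |s - x₀ 0|) ^ m := le_self_pow₀ hp (by omega)
  rw [mul_pow] at h1
  calc (1 : ℝ) = (1 + |s - x₀ 0|) * (1 + |s - x₀ 0|)⁻¹ := by
        rw [mul_inv_cancel₀ (by positivity)]
    _ ≤ (C ^ m * ‖x - Xi f s‖ ^ m) * (1 + |s - x₀ 0|)⁻¹ := by gcongr; linarith
    _ = _ := by ring

lemma IsHomKernel.continuous_comp {m : ℕ} {K : Plane → ℝ} (hK : IsHomKernel m K)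
    {f : ℝ → ℝ} (hf : Continuous f) {x : Plane} (hx : gap f x ≠ 0) :
    Continuous fun s => K (x - Xi f s) :=
  hK.contDiffOn.continuousOn.comp_continuous (continuous_const.sub (continuous_Xi hf))
    fun s => sub_Xi_ne_zero hx s

lemma IsHomKernel.memLp {m : ℕ} (hm : 1 ≤ m) {K : Plane → ℝ} (hK : IsHomKernel m K)
    {f : ℝ → ℝ} (hf : IsInterface f) {x : Plane} (hx : gap f x ≠ 0) :
    MemLp (fun s => K (x - Xi f s)) 2 := by
  obtain ⟨C, hC0, hC⟩ := hK.exists_le hm hf hx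
  refine ((memLp_inv_one_add_abs (x 0)).const_mul C).mono
    (hK.continuous_comp hf.continuous hx).aestronglyMeasurable (ae_of_all _ fun s => ?_)
  rw [Real.norm_eq_abs, Real.norm_eq_abs]
  exact (hC.self_of_nhds s).trans (le_abs_self _)

lemma IsHomKernel.integrable {m : ℕ} (hm : 1 ≤ m) {K : Plane → ℝ} (hK : IsHomKernel m K)
    {f : ℝ → ℝ} (hf : IsInterface f) {φ : ℝ → ℝ} (hφ : MemLp φ 2) {x : Plane} (hx : gap f x ≠ 0) :
    Integrable fun s => φ s * K (x - Xi f s) :=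
  hφ.integrable_mul (hK.memLp hm hf hx)

/-- Differentiation under the integral sign off the graph. -/
lemma IsHomKernel.hasFDerivAt_potK {m : ℕ} (hm : 1 ≤ m) {K : Plane → ℝ} (hK : IsHomKernel m K)
    {f : ℝ → ℝ} (hf : IsInterface f) {φ : ℝ → ℝ} (hφ : MemLp φ 2) {x : Plane} (hx : gap f x ≠ 0) :
    HasFDerivAt (potK f K φ)
      (∑ i, potK f (StokesGraph.pd i K) φ x • (EuclideanSpace.proj i : Plane →L[ℝ] ℝ)) x := by
  have hm1 : 1 ≤ m + 1 := by omega
  obtain ⟨C0, hC0, h0⟩ := (hK.pd 0).exists_le hm1 hf hx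
  obtain ⟨C1, hC1, h1⟩ := (hK.pd 1).exists_le hm1 hf hx
  have hg : ∀ᶠ z in 𝓝 x, gap f z ≠ 0 := (continuous_gap hf.continuous).continuousAt.eventually_ne hx
  have hev := h0.and (h1.and hg)
  have key := hasFDerivAt_integral_of_dominated_of_fderiv_le (𝕜 := ℝ) (μ := volume)
    (F := fun z s => φ s * K (z - Xi f s))
    (F' := fun z s => φ s • fderiv ℝ K (z - Xi f s)) (x₀ := x)
    (bound := fun s => |φ s| * ((C0 + C1) * (1 + |s - x 0|)⁻¹)) hev ?_ ?_ ?_ ?_ ?_ ?_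
  · have e : (∫ s, φ s • fderiv ℝ K (x - Xi f s)) =
        ∑ i, potK f (StokesGraph.pd i K) φ x • (EuclideanSpace.proj i : Plane →L[ℝ] ℝ) := by
      simp only [fderiv_eq_sum_pd K, Finset.smul_sum, smul_smul]
      rw [integral_finsetSum _ fun i _ => ((hK.pd i).integrable hm1 hf hφ hx).smul_const _]
      refine Finset.sum_congr rfl fun i _ => ?_
      rw [integral_smul_const]; rfl
    rw [← e]; exact key
  · filter_upwards [hg] with z hz using (hK.integrable hm hf hφ hz).aestronglyMeasurable
  · exact hK.integrable hm hf hφ hx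
  · refine hφ.aestronglyMeasurable.smul (Continuous.aestronglyMeasurable ?_)
    exact (hK.contDiffOn.fderiv_of_isOpen isOpen_compl_singleton (m := 0)
      (by simp)).continuousOn.comp_continuous (continuous_const.sub (continuous_Xi hf.continuous))
      fun s => sub_Xi_ne_zero hx s
  · refine ae_of_all _ fun s z hz => ?_
    obtain ⟨a, b, c⟩ := hz
    rw [norm_smul, Real.norm_eq_abs]
    gcongr
    refine (norm_fderiv_le_sum_pd _ _).trans ?_
    rw [Fin.sum_univ_two, add_mul]
    exact add_le_add (a s) (b s)
  · exact hφ.abs.integrable_mul ((memLp_inv_one_add_abs (x 0)).const_mul _)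
  · refine ae_of_all _ fun s z hz => ?_
    have hz' := sub_Xi_ne_zero hz.2.2 s
    have := ((hK.differentiableAt hz').hasFDerivAt.comp z
      ((hasFDerivAt_id z).sub_const (Xi f s))).const_mul (φ s)
    exact this

lemma IsHomKernel.pd_potK {m : ℕ} (hm : 1 ≤ m) {K : Plane → ℝ} (hK : IsHomKernel m K)
    {f : ℝ → ℝ} (hf : IsInterface f) {φ : ℝ → ℝ} (hφ : MemLp φ 2) {x : Plane} (hx : gap f x ≠ 0)
    (i : Fin 2) : StokesGraph.pd i (potK f K φ) x = potK f (StokesGraph.pd i K) φ x := by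
  rw [StokesGraph.pd, (hK.hasFDerivAt_potK hm hf hφ hx).fderiv]
  fin_cases i <;> simp

lemma isOpen_gap_ne {f : ℝ → ℝ} (hf : Continuous f) : IsOpen {x | gap f x ≠ 0} :=
  isOpen_ne_fun (continuous_gap hf) continuous_const

lemma IsHomKernel.contDiffOn_potK (n : ℕ) : ∀ {m : ℕ} (_ : 1 ≤ m) {K : Plane → ℝ}
    (_ : IsHomKernel m K) {f : ℝ → ℝ} (_ : IsInterface f) {φ : ℝ → ℝ} (_ : MemLp φ 2),
    ContDiffOn ℝ n (potK f K φ) {x | gap f x ≠ 0} := by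
  induction n with
  | zero =>
    intro m hm K hK f hf φ hφ
    rw [Nat.cast_zero, contDiffOn_zero]
    exact fun x hx => (hK.hasFDerivAt_potK hm hf hφ hx).continuousAt.continuousWithinAt
  | succ n ih =>
    intro m hm K hK f hf φ hφ
    have ho := isOpen_gap_ne hf.continuous
    rw [Nat.cast_add, Nat.cast_one, contDiffOn_succ_iff_fderiv_of_isOpen ho]
    refine ⟨fun x hx => (hK.hasFDerivAt_potK hm hf hφ hx).differentiableAt.differentiableWithinAt,
      by simp, ?_⟩
    have : ContDiffOn ℝ n (fun x => ∑ i, potK f (StokesGraph.pd i K) φ x •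
        (EuclideanSpace.proj i : Plane →L[ℝ] ℝ)) {x | gap f x ≠ 0} :=
      ContDiffOn.sum fun i _ => (ih (by omega) (hK.pd i) hf hφ).smul contDiffOn_const
    exact this.congr fun x hx => (hK.hasFDerivAt_potK hm hf hφ hx).fderiv

/-! ### The derivatives of the fundamental solution -/

/-- A point of the plane as a complex number. -/
noncomputable def toC (y : Plane) : ℂ := (y 0 : ℂ) + (y 1 : ℂ) * Complex.I

/-- The unit vectors `e₁, e₂` as complex numbers. -/
noncomputable def unitC (l : Fin 2) : ℂ := ![1, Complex.I] l

lemma relC_eq_toC (f : ℝ → ℝ) (x : Plane) (s : ℝ) : relC f x s = toC (x - Xi f s) := by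
  simp [relC, toC, Xi]

lemma toC_ne_zero {y : Plane} (hy : y ≠ 0) : toC y ≠ 0 := by
  intro h
  have h0 := congrArg Complex.re h
  have h1 := congrArg Complex.im h
  simp [toC] at h0 h1
  exact hy (by ext i; fin_cases i <;> simpa)

lemma toC_add_smul (y : Plane) (l : Fin 2) (t : ℝ) :
    toC (y + t • EuclideanSpace.single l 1) = toC y + t * unitC l := by
  fin_cases l <;> simp [toC, unitC] <;> ring

lemma toC_smul (y : Plane) (t : ℝ) : toC (t • y) = t * toC y := by
  simp [toC]; ring

lemma pd_eq_of_hasDerivAt {u : Plane → ℝ} {x : Plane} {l : Fin 2} {d : ℝ}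
    (hu : DifferentiableAt ℝ u x)
    (h : HasDerivAt (fun t : ℝ => u (x + t • EuclideanSpace.single l 1)) d 0) : pd l u x = d := by
  have h1 : HasFDerivAt u (fderiv ℝ u x) (x + (0 : ℝ) • EuclideanSpace.single l 1) := by
    simpa using hu.hasFDerivAt
  have h2 := h1.comp_hasDerivAt (0 : ℝ)
    (((hasDerivAt_id (0 : ℝ)).smul_const (EuclideanSpace.single l (1 : ℝ))).const_add x)
  have := h2.unique h
  simpa [pd] using this

lemma normSq_pos {y : Plane} (hy : y ≠ 0) : 0 < y 0 ^ 2 + y 1 ^ 2 := by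
  have : 0 < ‖y‖ ^ 2 := by have := norm_pos_iff.2 hy; positivity
  rw [EuclideanSpace.norm_sq_eq, Fin.sum_univ_two] at this
  simpa using this

lemma norm_sq_plane (y : Plane) : ‖y‖ ^ 2 = y 0 ^ 2 + y 1 ^ 2 := by
  rw [EuclideanSpace.norm_sq_eq, Fin.sum_univ_two]; simp

/-- `kerAB` in real coordinates. -/
lemma kerAB_toC (a b : ℂ) {y : Plane} (hy : y ≠ 0) :
    kerAB a b (toC y) = (a.re * y 0 + a.im * y 1) / (y 0 ^ 2 + y 1 ^ 2) +
      (b.re * (y 0 ^ 3 - 3 * y 0 * y 1 ^ 2) + b.im * (3 * y 0 ^ 2 * y 1 - y 1 ^ 3)) /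
        (y 0 ^ 2 + y 1 ^ 2) ^ 2 := by
  have hN := (normSq_pos hy).ne'
  have hz := toC_ne_zero hy
  have hNC : ((y 0 : ℂ) ^ 2 + (y 1 : ℂ) ^ 2) ≠ 0 := by
    have := Complex.ofReal_ne_zero.2 hN
    push_cast at this
    exact this
  have e : toC y * conj (toC y) = (y 0 : ℂ) ^ 2 + (y 1 : ℂ) ^ 2 := by
    simp [toC]; linear_combination -(y 1 : ℂ) ^ 2 * Complex.I_sq
  have e1 : (toC y)⁻¹ = conj (toC y) / ((y 0 ^ 2 + y 1 ^ 2 : ℝ) : ℂ) := by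
    push_cast
    rw [eq_div_iff hNC, ← e]; field_simp
  have e2 : conj (toC y) / toC y ^ 2 = conj (toC y) ^ 3 / (((y 0 ^ 2 + y 1 ^ 2) ^ 2 : ℝ) : ℂ) := by
    push_cast
    rw [eq_div_iff (pow_ne_zero 2 hNC), ← e]; field_simp
  rw [kerAB, e1, e2, ← mul_div_assoc, ← mul_div_assoc, Complex.add_re, Complex.div_ofReal_re,
    Complex.div_ofReal_re]
  congr 2
  · simp [toC]
  · simp [toC, pow_succ]; ring

lemma contDiffOn_kerAB_toC (a b : ℂ) : ContDiffOn ℝ ∞ (fun y => kerAB a b (toC y)) {0}ᶜ := by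
  have h : ContDiffOn ℝ ∞ (fun y : Plane => (a.re * y 0 + a.im * y 1) / (y 0 ^ 2 + y 1 ^ 2) +
      (b.re * (y 0 ^ 3 - 3 * y 0 * y 1 ^ 2) + b.im * (3 * y 0 ^ 2 * y 1 - y 1 ^ 3)) /
        (y 0 ^ 2 + y 1 ^ 2) ^ 2) {0}ᶜ := by
    refine ContDiffOn.add (ContDiffOn.div ?_ ?_ fun y hy => (normSq_pos hy).ne')
      (ContDiffOn.div ?_ ?_ fun y hy => pow_ne_zero 2 (normSq_pos hy).ne') <;> fun_prop
  exact h.congr fun y hy => kerAB_toC a b hy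

lemma isHomKernel_kerAB (a b : ℂ) : IsHomKernel 1 fun y => kerAB a b (toC y) := by
  refine ⟨contDiffOn_kerAB_toC a b, fun t ht y hy => ?_⟩
  have htC : (t : ℂ) ≠ 0 := by exact_mod_cast ht.ne'
  have hz := toC_ne_zero hy
  simp only [kerAB, toC_smul, pow_one]
  rw [← Complex.re_ofReal_mul]
  congr 1
  simp only [map_mul, Complex.conj_ofReal, Complex.ofReal_inv]
  field_simp

/-- The derivative of `kerAB a b`. -/
lemma pd_kerAB (a b : ℂ) (l : Fin 2) {y : Plane} (hy : y ≠ 0) :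
    pd l (fun y => kerAB a b (toC y)) y =
      ((-a * unitC l + b * conj (unitC l)) / toC y ^ 2 -
        2 * b * unitC l * conj (toC y) / toC y ^ 3).re := by
  refine pd_eq_of_hasDerivAt ((isHomKernel_kerAB a b).differentiableAt hy) ?_
  simp only [toC_add_smul]
  have hz := toC_ne_zero hy
  have h0 : HasDerivAt (fun t : ℝ => toC y + t * unitC l) (unitC l) 0 := by
    simpa using ((hasDerivAt_id (0 : ℝ)).ofReal_comp.mul_const (unitC l)).const_add (toC y)
  have hz' : toC y + ((0 : ℝ) : ℂ) * unitC l ≠ 0 := by simpa using hz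
  have h1 := (h0.fun_inv hz').const_mul a
  have h2 : HasDerivAt (fun t : ℝ => conj (toC y + t * unitC l)) (conj (unitC l)) 0 := h0.star
  have h3 := (h2.fun_div (h0.fun_pow 2) (pow_ne_zero 2 hz')).const_mul b
  have h4 := Complex.reCLM.hasFDerivAt.comp_hasDerivAt (0 : ℝ) (h1.fun_add h3)
  refine h4.congr_deriv ?_
  simp only [Complex.reCLM_apply]
  congr 1
  simp only [Complex.ofReal_zero, zero_mul, add_zero]
  field_simp
  push_cast
  ring

/-- The first coefficient of `∂ₗ 𝒰ᵏⱼ` as a kernel `kerAB`. -/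
noncomputable def stokesA (μ : ℝ) (j k l : Fin 2) : ℂ :=
  -(1 / (4 * Real.pi * μ) : ℝ) * ((if j = l then 1 else 0) * unitC k
    + (if k = l then 1 else 0) * unitC j - (if j = k then 1 else 0) * unitC l
    - (unitC j * unitC k * conj (unitC l) + unitC j * conj (unitC k) * unitC l
      + conj (unitC j) * unitC k * unitC l) / 2)

/-- The second coefficient of `∂ₗ 𝒰ᵏⱼ` as a kernel `kerAB`. -/
noncomputable def stokesB (μ : ℝ) (j k l : Fin 2) : ℂ :=
  (1 / (8 * Real.pi * μ) : ℝ) * (unitC j * unitC k * unitC l)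

/-- The coefficient of `𝒫ᵏ` as a kernel `kerAB`. -/
noncomputable def pressA (k : Fin 2) : ℂ := -(1 / (2 * Real.pi) : ℝ) * unitC k

lemma U_apply (μ : ℝ) (k : Fin 2) (y : Plane) (j : Fin 2) :
    U μ k y j = -(1 / (4 * Real.pi * μ)) * ((if j = k then 1 else 0) *
      (-(1 / 2) * Real.log (y 0 ^ 2 + y 1 ^ 2)) + y j * y k / (y 0 ^ 2 + y 1 ^ 2)) := by
  simp only [U]
  rw [← norm_sq_plane, one_div ‖y‖, Real.log_inv, Real.log_pow]
  push_cast
  ring_nf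

lemma contDiffOn_U (μ : ℝ) (k j : Fin 2) : ContDiffOn ℝ ∞ (fun y => U μ k y j) {0}ᶜ := by
  simp only [U_apply]
  refine contDiffOn_const.mul ((contDiffOn_const.mul (contDiffOn_const.mul
    (ContDiffOn.log ?_ fun y hy => (normSq_pos hy).ne'))).add
    (ContDiffOn.div ?_ ?_ fun y hy => (normSq_pos hy).ne')) <;> fun_prop

lemma differentiableAt_U_apply (μ : ℝ) (k j : Fin 2) {y : Plane} (hy : y ≠ 0) :
    DifferentiableAt ℝ (fun y => U μ k y j) y :=
  ((contDiffOn_U μ k j).contDiffAt (isOpen_compl_singleton.mem_nhds hy)).differentiableAt (by simp)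

lemma differentiableAt_U (μ : ℝ) (k : Fin 2) {y : Plane} (hy : y ≠ 0) :
    DifferentiableAt ℝ (U μ k) y :=
  differentiableAt_euclidean.2 fun j => differentiableAt_U_apply μ k j hy

lemma pd_U_real (μ : ℝ) (j k l : Fin 2) {y : Plane} (hy : y ≠ 0) :
    pd l (fun y => U μ k y j) y = -(1 / (4 * Real.pi * μ)) *
      ((if j = k then 1 else 0) * (-(y l / (y 0 ^ 2 + y 1 ^ 2))) +
        (((if j = l then 1 else 0) * y k + (if k = l then 1 else 0) * y j) *
          (y 0 ^ 2 + y 1 ^ 2) - y j * y k * (2 * y l)) / (y 0 ^ 2 + y 1 ^ 2) ^ 2) := by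
  refine pd_eq_of_hasDerivAt (differentiableAt_U_apply μ k j hy) ?_
  simp only [U_apply]
  have hN := (normSq_pos hy).ne'
  have hc : ∀ i, HasDerivAt (fun t : ℝ => (y + t • EuclideanSpace.single l (1 : ℝ) : Plane) i)
      (if i = l then 1 else 0) 0 := by
    intro i
    have := ((hasDerivAt_id (0 : ℝ)).mul_const (if i = l then (1 : ℝ) else 0)).const_add (y i)
    simpa [Pi.single_apply] using this
  have v0 : ∀ i, (y + (0 : ℝ) • EuclideanSpace.single l (1 : ℝ) : Plane) i = y i := by simp
  have hNd : HasDerivAt (fun t : ℝ => (y + t • EuclideanSpace.single l (1 : ℝ) : Plane) 0 ^ 2 +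
      (y + t • EuclideanSpace.single l (1 : ℝ) : Plane) 1 ^ 2) (2 * y l) 0 := by
    refine (((hc 0).fun_pow 2).fun_add ((hc 1).fun_pow 2)).congr_deriv ?_
    simp only [v0]
    fin_cases l <;> simp
  have hN' : (y + (0 : ℝ) • EuclideanSpace.single l (1 : ℝ) : Plane) 0 ^ 2 +
      (y + (0 : ℝ) • EuclideanSpace.single l (1 : ℝ) : Plane) 1 ^ 2 ≠ 0 := by
    simpa only [v0] using hN
  have h := (((((hNd.log hN').const_mul (-(1 / 2 : ℝ))).const_mul (if j = k then (1 : ℝ) else 0))).fun_add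
    (((hc j).fun_mul (hc k)).fun_div hNd hN')).const_mul (-(1 / (4 * Real.pi * μ)))
  refine h.congr_deriv ?_
  simp only [v0]
  ring

lemma pd_U_eq (μ : ℝ) (j k l : Fin 2) {y : Plane} (hy : y ≠ 0) :
    pd l (fun y => U μ k y j) y = kerAB (stokesA μ j k l) (stokesB μ j k l) (toC y) := by
  have hN := (normSq_pos hy).ne'
  rw [pd_U_real μ j k l hy, kerAB_toC _ _ hy, stokesA, stokesB,
    ← Complex.ofReal_neg, Complex.re_ofReal_mul, Complex.re_ofReal_mul, Complex.im_ofReal_mul,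
    Complex.im_ofReal_mul, show 1 / (8 * Real.pi * μ) = (1 / (4 * Real.pi * μ)) / 2 by
      rw [div_div]; congr 1; ring]
  generalize 1 / (4 * Real.pi * μ) = A
  fin_cases j <;> fin_cases k <;> fin_cases l <;> simp [unitC] <;> field_simp <;> ring

lemma P_eq (k : Fin 2) {y : Plane} (hy : y ≠ 0) : P k y = kerAB (pressA k) 0 (toC y) := by
  rw [kerAB_toC _ _ hy, P, norm_sq_plane, pressA, ← Complex.ofReal_neg, Complex.re_ofReal_mul,
    Complex.im_ofReal_mul]
  fin_cases k <;> simp [unitC] <;> ring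

lemma IsHomKernel.congr {m : ℕ} {K K' : Plane → ℝ} (hK : IsHomKernel m K)
    (h : ∀ y, y ≠ 0 → K' y = K y) : IsHomKernel m K' :=
  ⟨hK.contDiffOn.congr h, fun t ht y hy => by
    rw [h _ (smul_ne_zero ht.ne' hy), h _ hy, hK.homog t ht y hy]⟩

lemma isHomKernel_pd_U (μ : ℝ) (j k l : Fin 2) : IsHomKernel 1 (pd l fun y => U μ k y j) :=
  (isHomKernel_kerAB _ _).congr fun _ hy => pd_U_eq μ j k l hy

lemma isHomKernel_P (k : Fin 2) : IsHomKernel 1 (P k) :=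
  (isHomKernel_kerAB _ _).congr fun _ hy => P_eq k hy

lemma pd_congr_of_ne {u v : Plane → ℝ} (h : ∀ y, y ≠ 0 → u y = v y) (l : Fin 2) {y : Plane}
    (hy : y ≠ 0) : pd l u y = pd l v y := by
  have : u =ᶠ[𝓝 y] v := by
    filter_upwards [isOpen_compl_singleton.mem_nhds hy] with z hz using h z hz
  rw [pd, pd, this.fderiv_eq]

/-- The fundamental solution satisfies the momentum equation off the origin. -/
lemma momentum_fundamental {μ : ℝ} (hμ : 0 < μ) (j k : Fin 2) {y : Plane} (hy : y ≠ 0) :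
    μ * ∑ l, pd l (pd l fun y => U μ k y j) y = pd j (P k) y := by
  have hz := toC_ne_zero hy
  have e : ∀ l, pd l (pd l fun y => U μ k y j) y = _ := fun l =>
    (pd_congr_of_ne (fun z hz => pd_U_eq μ j k l hz) l hy).trans (pd_kerAB _ _ l hy)
  rw [Fin.sum_univ_two, e, e, pd_congr_of_ne (fun z hz => P_eq k hz) j hy, pd_kerAB _ _ j hy,
    ← Complex.add_re, ← Complex.re_ofReal_mul]
  congr 1
  have hπ : (Real.pi : ℂ) ≠ 0 := by exact_mod_cast Real.pi_ne_zero
  have hμC : (μ : ℂ) ≠ 0 := by exact_mod_cast hμ.ne'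
  have hI := Complex.I_sq
  fin_cases j <;> fin_cases k <;> simp [unitC, stokesA, stokesB, pressA] <;> field_simp <;>
    ring_nf <;> simp only [hI] <;> ring

/-- The fundamental solution is solenoidal. -/
lemma divergence_fundamental (μ : ℝ) (k : Fin 2) {y : Plane} (hy : y ≠ 0) :
    ∑ j, pd j (fun y => U μ k y j) y = 0 := by
  have hN := (normSq_pos hy).ne'
  simp only [Fin.sum_univ_two, pd_U_real μ _ k _ hy]
  fin_cases k <;> simp <;> field_simp <;> ring

/-! ### The jump symbols -/

lemma omega_sq (f : ℝ → ℝ) (s : ℝ) : omega f s ^ 2 = 1 + deriv f s ^ 2 :=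
  Real.sq_sqrt (by positivity)

lemma one_le_omega (f : ℝ → ℝ) (s : ℝ) : 1 ≤ omega f s :=
  Real.one_le_sqrt.2 (by nlinarith [sq_nonneg (deriv f s)])

lemma nu_zero (f : ℝ → ℝ) (s : ℝ) : nu f s 0 = -deriv f s / omega f s := by
  simp [nu]; ring

lemma nu_one (f : ℝ → ℝ) (s : ℝ) : nu f s 1 = 1 / omega f s := by
  simp [nu]

/-- The jump symbol in real coordinates. -/
lemma jumpAB_eq (f : ℝ → ℝ) (a b : ℂ) (s : ℝ) : jumpAB f a b s = 2 * Real.pi *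
    ((a.im - a.re * deriv f s) / (1 + deriv f s ^ 2) +
      (b.im * (1 - 3 * deriv f s ^ 2) - b.re * (3 * deriv f s - deriv f s ^ 3)) /
        (1 + deriv f s ^ 2) ^ 2) := by
  set p := deriv f s with hp
  have hy : (!₂[1, p] : Plane) ≠ 0 := fun h => by
    have := congrArg (fun v : Plane => v 0) h
    simp at this
  have ht : tang f s = toC !₂[1, p] := by simp [tang, toC, hp]
  have h := kerAB_toC (-Complex.I * a) (-Complex.I * b) hy
  have e : jumpAB f a b s = 2 * Real.pi * kerAB (-Complex.I * a) (-Complex.I * b) (toC !₂[1, p]) := by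
    rw [jumpAB, kerAB, ht,
      ← show (((2 * Real.pi : ℝ) : ℂ) * (-Complex.I * a * (toC !₂[1, p])⁻¹ + -Complex.I * b *
        (conj (toC !₂[1, p]) / toC !₂[1, p] ^ 2))).re = 2 * Real.pi * _ from
        Complex.re_ofReal_mul _ _]
    congr 1
    push_cast
    ring
  rw [e, h]
  simp
  ring

/-- The jump symbol of `∂ₗ 𝒰ᵏⱼ`: it is normal in the direction of differentiation and projects the
density to the tangent. -/
lemma jump_pd_U (f : ℝ → ℝ) {μ : ℝ} (hμ : 0 < μ) (j k l : Fin 2) (s : ℝ) :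
    jumpAB f (stokesA μ j k l) (stokesB μ j k l) s =
      1 / μ * (nu f s l * ((if j = k then 1 else 0) - nu f s j * nu f s k)) / omega f s := by
  have h1 := one_le_omega f s
  have h0 : omega f s ≠ 0 := by positivity
  have hN : 1 + deriv f s ^ 2 ≠ 0 := by positivity
  have hπ := Real.pi_ne_zero
  have hsq := omega_sq f s
  have h4 : omega f s ^ 4 = (1 + deriv f s ^ 2) ^ 2 := by rw [← hsq]; ring
  rw [jumpAB_eq, stokesA, stokesB,
    ← Complex.ofReal_neg, Complex.re_ofReal_mul, Complex.re_ofReal_mul, Complex.im_ofReal_mul,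
    Complex.im_ofReal_mul]
  have e : 1 / μ * (nu f s l * ((if j = k then 1 else 0) - nu f s j * nu f s k)) / omega f s =
      1 / μ * ((omega f s * nu f s l) * ((if j = k then 1 else 0) -
        (omega f s * nu f s j) * (omega f s * nu f s k) / (1 + deriv f s ^ 2))) /
        (1 + deriv f s ^ 2) := by
    rw [← hsq]; field_simp
  have n0 : omega f s * nu f s 0 = -deriv f s := by rw [nu_zero]; field_simp
  have n1 : omega f s * nu f s 1 = 1 := by rw [nu_one]; field_simp
  rw [e]
  fin_cases j <;> fin_cases k <;> fin_cases l <;> simp [unitC, n0, n1] <;> field_simp <;> ring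

lemma jump_P (f : ℝ → ℝ) (k : Fin 2) (s : ℝ) :
    jumpAB f (pressA k) 0 s = -(nu f s k / omega f s) := by
  have h1 := one_le_omega f s
  have h0 : omega f s ≠ 0 := by positivity
  have hN : 1 + deriv f s ^ 2 ≠ 0 := by positivity
  have hsq := omega_sq f s
  have hπ := Real.pi_ne_zero
  rw [jumpAB_eq, pressA, ← Complex.ofReal_neg, Complex.re_ofReal_mul, Complex.im_ofReal_mul, ← hsq]
  fin_cases k <;> simp [unitC, nu_zero, nu_one] <;> field_simp

/-! ### The densities -/

lemma omega_pos (f : ℝ → ℝ) (s : ℝ) : 0 < omega f s := zero_lt_one.trans_le (one_le_omega f s)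

lemma abs_deriv_le_omega (f : ℝ → ℝ) (s : ℝ) : |deriv f s| ≤ omega f s := by
  rw [omega]; exact Real.abs_le_sqrt (by linarith)

lemma IsInterface.hasDerivAt_omega {f : ℝ → ℝ} (hf : IsInterface f) (s : ℝ) :
    HasDerivAt (omega f) (deriv f s * deriv (deriv f) s / omega f s) s := by
  have h := ((hf.hasDerivAt_deriv s).fun_pow 2).const_add 1
  have h0 : (1 : ℝ) + deriv f s ^ 2 ≠ 0 := by positivity
  refine (h.sqrt h0).congr_deriv ?_
  rw [← omega]
  have := (omega_pos f s).ne'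
  push_cast
  field_simp

lemma IsInterface.continuous_omega {f : ℝ → ℝ} (hf : IsInterface f) : Continuous (omega f) :=
  continuous_iff_continuousAt.2 fun s => (hf.hasDerivAt_omega s).continuousAt

/-- `g' = κ ω ν`. -/
lemma IsInterface.hasDerivAt_g {f : ℝ → ℝ} (hf : IsInterface f) (k : Fin 2) (s : ℝ) :
    HasDerivAt (g f k) (kappa f s * omega f s * nu f s k) s := by
  have h0 := (omega_pos f s).ne'
  have hi := (hf.hasDerivAt_omega s).fun_inv h0
  have hsq := omega_sq f s
  fin_cases k
  · refine (hi.sub_const 1).congr_deriv ?_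
    simp only [Fin.zero_eta, nu_zero, kappa]
    field_simp
  · refine (hi.fun_mul (hf.hasDerivAt_deriv s)).congr_deriv ?_
    simp only [Fin.mk_one, nu_one, kappa]
    field_simp
    linear_combination deriv (deriv f) s * hsq

lemma IsInterface.deriv_g {f : ℝ → ℝ} (hf : IsInterface f) (k : Fin 2) (s : ℝ) :
    deriv (g f k) s = kappa f s * omega f s * nu f s k := (hf.hasDerivAt_g k s).deriv

lemma SobH1.mul_real {θ B B' : ℝ → ℝ} {ψ : ℝ → ℂ} (h : SobH1 (fun s => (θ s : ℂ)) ψ)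
    (hB : ∀ s, HasDerivAt B (B' s) s) (hB' : Continuous B') {C : ℝ} (hb : ∀ s, |B s| ≤ C)
    (hb' : ∀ s, |B' s| ≤ C) : ∃ ψ', SobH1 (fun s => ((θ s * B s : ℝ) : ℂ)) ψ' := by
  have := h.mul (fun s => (hB s).ofReal_comp) (Complex.continuous_ofReal.comp hB') (C := C)
    (fun s => by rw [Complex.norm_real]; exact hb s)
    (fun s => by simp only [Complex.norm_real]; exact hb' s)
  exact ⟨_, by simpa only [Complex.ofReal_mul] using this⟩

lemma SobH1.memLp_real {θ : ℝ → ℝ} {ψ : ℝ → ℂ} (h : SobH1 (fun s => (θ s : ℂ)) ψ) : MemLp θ 2 :=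
  h.memLp.re

lemma SobH1.of_hasDerivAt {θ θ' : ℝ → ℝ} (h : MemLp θ 2) (h' : MemLp θ' 2)
    (hd : ∀ s, HasDerivAt θ (θ' s) s) (hc : Continuous θ') :
    SobH1 (fun s => (θ s : ℂ)) (fun s => (θ' s : ℂ)) := by
  refine ⟨h.ofReal, h'.ofReal, fun a b => ?_⟩
  rw [intervalIntegral.integral_eq_sub_of_hasDerivAt (fun s _ => (hd s).ofReal_comp)
    ((Complex.continuous_ofReal.comp hc).intervalIntegrable a b)]

lemma abs_deriv_mul_deriv2_div_omega_le {f : ℝ → ℝ} {Λ : ℝ} (hb2 : ∀ t, |deriv (deriv f) t| ≤ Λ)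
    (s : ℝ) : |deriv f s * deriv (deriv f) s / omega f s| ≤ Λ := by
  have h0 := omega_pos f s
  rw [abs_div, abs_mul, abs_of_pos h0, div_le_iff₀ h0, mul_comm]
  exact mul_le_mul (hb2 s) (abs_deriv_le_omega f s) (abs_nonneg _) ((abs_nonneg _).trans (hb2 s))

/-- The derivatives of the densities belong to `H¹`. -/
lemma IsInterface.sobH1_deriv_g {f : ℝ → ℝ} (hf : IsInterface f) (k : Fin 2) :
    ∃ ψ, SobH1 (fun s => ((deriv (g f k) s : ℝ) : ℂ)) ψ := by
  obtain ⟨Λ, hΛ, hb, hb2, -⟩ := hf.exists_bound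
  obtain ⟨f3, h3⟩ := hf.exists_sobH1
  have hω := hf.continuous_omega
  have h1 := hf.continuous_deriv
  have h2 := hf.continuous_deriv2
  have hne : ∀ s, omega f s ≠ 0 := fun s => (omega_pos f s).ne'
  have hi : ∀ s, |(omega f s)⁻¹| ≤ 1 := fun s => by
    rw [abs_of_pos (inv_pos.2 (omega_pos f s))]; exact inv_le_one_of_one_le₀ (one_le_omega f s)
  have hcd : ∀ s, |deriv f s * (omega f s)⁻¹| ≤ 1 := fun s => by
    rw [abs_mul, abs_inv, abs_of_pos (omega_pos f s), ← div_eq_mul_inv,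
      div_le_one (omega_pos f s)]
    exact abs_deriv_le_omega f s
  fin_cases k
  -- `g₁' = -f'' f' ω⁻³` and `g₂' = f'' ω⁻³`, products of `f'' ∈ H¹` and bounded `C¹` functions
  · have hd : ∀ s, HasDerivAt (fun s => -(deriv f s * (omega f s)⁻¹) * (omega f s)⁻¹ ^ 2)
        (-(deriv (deriv f) s) * (omega f s)⁻¹ ^ 3 + 3 * ((deriv f s * (omega f s)⁻¹) *
          (deriv f s * deriv (deriv f) s / omega f s) * (omega f s)⁻¹ ^ 3)) s := by
      intro s
      have di := (hf.hasDerivAt_omega s).fun_inv (hne s)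
      refine ((((hf.hasDerivAt_deriv s).fun_mul di).fun_neg).fun_mul (di.fun_pow 2)).congr_deriv ?_
      have := hne s
      push_cast
      field_simp
      ring
    have key := h3.mul_real (C := 1 + 4 * Λ) hd (by fun_prop (disch := exact hne _))
      (fun s => ?_) (fun s => ?_)
    · obtain ⟨ψ, hψ⟩ := key
      refine ⟨ψ, ?_⟩
      convert hψ using 4 with s
      rw [hf.deriv_g]
      simp only [Fin.zero_eta, nu_zero, kappa]
      have := hne s
      field_simp
    · rw [abs_mul, abs_neg, abs_pow]
      have := mul_le_mul (hcd s) (pow_le_one₀ (n := 2) (abs_nonneg _) (hi s)) (by positivity)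
        zero_le_one
      linarith
    · have a1 : |-(deriv (deriv f) s) * (omega f s)⁻¹ ^ 3| ≤ Λ := by
        rw [abs_mul, abs_neg, abs_pow]
        exact (mul_le_of_le_one_right (abs_nonneg _)
          (pow_le_one₀ (abs_nonneg _) (hi s))).trans (hb2 s)
      have a2 : |(deriv f s * (omega f s)⁻¹) * (deriv f s * deriv (deriv f) s / omega f s) *
          (omega f s)⁻¹ ^ 3| ≤ Λ := by
        rw [abs_mul, abs_mul (deriv f s * _), abs_pow]
        refine (mul_le_of_le_one_right (by positivity)
          (pow_le_one₀ (abs_nonneg _) (hi s))).trans ?_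
        exact (mul_le_of_le_one_left (abs_nonneg _) (hcd s)).trans
          (abs_deriv_mul_deriv2_div_omega_le hb2 s)
      refine (abs_add_le _ _).trans ?_
      rw [abs_mul 3, abs_of_pos (by norm_num : (0:ℝ) < 3)]
      linarith
  · have hd : ∀ s, HasDerivAt (fun s => (omega f s)⁻¹ ^ 3)
        (-3 * ((deriv f s * deriv (deriv f) s / omega f s) * (omega f s)⁻¹ ^ 4)) s := by
      intro s
      have di := (hf.hasDerivAt_omega s).fun_inv (hne s)
      refine (di.fun_pow 3).congr_deriv ?_
      have := hne s
      push_cast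
      field_simp
    have key := h3.mul_real (C := 1 + 3 * Λ) hd (by fun_prop (disch := exact hne _))
      (fun s => ?_) (fun s => ?_)
    · obtain ⟨ψ, hψ⟩ := key
      refine ⟨ψ, ?_⟩
      convert hψ using 4 with s
      rw [hf.deriv_g]
      simp only [Fin.mk_one, nu_one, kappa]
      have := hne s
      field_simp
    · rw [abs_pow]
      have := pow_le_one₀ (n := 3) (abs_nonneg _) (hi s)
      linarith
    · rw [abs_mul, abs_mul, abs_pow, abs_neg, abs_of_pos (by norm_num : (0:ℝ) < 3)]
      have := (mul_le_of_le_one_right (abs_nonneg (deriv f s * deriv (deriv f) s / omega f s))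
        (pow_le_one₀ (n := 4) (abs_nonneg _) (hi s))).trans (abs_deriv_mul_deriv2_div_omega_le hb2 s)
      linarith

lemma abs_g_le (f : ℝ → ℝ) (k : Fin 2) (s : ℝ) : |g f k s| ≤ |deriv f s| := by
  have h0 := omega_pos f s
  have h1 := one_le_omega f s
  have h2 := abs_deriv_le_omega f s
  have hsq := omega_sq f s
  fin_cases k
  · change |(omega f s)⁻¹ - 1| ≤ |deriv f s|
    rw [abs_sub_comm, abs_of_nonneg (by linarith [inv_le_one_of_one_le₀ h1]), sub_le_iff_le_add]
    have e : omega f s - 1 ≤ |deriv f s| * omega f s := by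
      nlinarith [abs_nonneg (deriv f s), sq_abs (deriv f s)]
    have := mul_inv_cancel₀ h0.ne'
    have h3 := mul_le_mul_of_nonneg_right e (inv_pos.2 h0).le
    rw [mul_assoc, this, sub_mul, this] at h3
    linarith
  · change |(omega f s)⁻¹ * deriv f s| ≤ |deriv f s|
    rw [abs_mul, abs_of_pos (inv_pos.2 h0)]
    exact mul_le_of_le_one_left (abs_nonneg _) (inv_le_one_of_one_le₀ h1)

lemma IsInterface.continuous_g {f : ℝ → ℝ} (hf : IsInterface f) (k : Fin 2) : Continuous (g f k) :=
  continuous_iff_continuousAt.2 fun s => (hf.hasDerivAt_g k s).continuousAt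

lemma IsInterface.memLp_deriv_g {f : ℝ → ℝ} (hf : IsInterface f) (k : Fin 2) :
    MemLp (deriv (g f k)) 2 := by
  obtain ⟨ψ, h⟩ := hf.sobH1_deriv_g k
  exact h.memLp_real

lemma IsInterface.memLp_g {f : ℝ → ℝ} (hf : IsInterface f) (k : Fin 2) : MemLp (g f k) 2 :=
  hf.sobH1_deriv.memLp_real.mono (hf.continuous_g k).aestronglyMeasurable
    (ae_of_all _ fun s => abs_g_le f k s)

lemma IsInterface.continuous_deriv_g {f : ℝ → ℝ} (hf : IsInterface f) (k : Fin 2) :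
    Continuous (deriv (g f k)) := by
  obtain ⟨ψ, h⟩ := hf.sobH1_deriv_g k
  exact Complex.continuous_re.comp h.continuous

lemma IsInterface.sobH1_g {f : ℝ → ℝ} (hf : IsInterface f) (k : Fin 2) :
    SobH1 (fun s => (g f k s : ℂ)) (fun s => ((deriv (g f k) s : ℝ) : ℂ)) :=
  SobH1.of_hasDerivAt (hf.memLp_g k) (hf.memLp_deriv_g k)
    (fun s => (hf.hasDerivAt_g k s).differentiableAt.hasDerivAt) (hf.continuous_deriv_g k)

lemma IsInterface.sobH1_g_mul_deriv {f : ℝ → ℝ} (hf : IsInterface f) (k : Fin 2) :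
    ∃ ψ, SobH1 (fun s => ((g f k s * deriv f s : ℝ) : ℂ)) ψ := by
  obtain ⟨Λ, hΛ, hb, hb2, -⟩ := hf.exists_bound
  exact (hf.sobH1_g k).mul_real hf.hasDerivAt_deriv hf.continuous_deriv2 hb hb2

lemma IsInterface.memLp_g_mul_deriv {f : ℝ → ℝ} (hf : IsInterface f) (k : Fin 2) :
    MemLp (fun s => g f k s * deriv f s) 2 := by
  obtain ⟨ψ, h⟩ := hf.sobH1_g_mul_deriv k
  exact h.memLp_real

/-! ### Partial derivatives, gradient and Laplacian -/

lemma pd_apply {v : Plane → Plane} {x : Plane} (hv : DifferentiableAt ℝ v x) (l j : Fin 2) :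
    pd l v x j = pd l (fun y => v y j) x := by
  have h := ((EuclideanSpace.proj j : Plane →L[ℝ] ℝ).hasFDerivAt).comp x hv.hasFDerivAt
  have h2 : fderiv ℝ (fun y => v y j) x = (EuclideanSpace.proj j : Plane →L[ℝ] ℝ).comp (fderiv ℝ v x) :=
    h.fderiv
  rw [pd, pd, h2]; rfl

lemma fderiv_eq_sum_pd_vec {F : Type*} [NormedAddCommGroup F] [NormedSpace ℝ F] (u : Plane → F)
    (x v : Plane) : fderiv ℝ u x v = v 0 • pd 0 u x + v 1 • pd 1 u x := by
  have hv : v = v 0 • (EuclideanSpace.single 0 1 : Plane) + v 1 • EuclideanSpace.single 1 1 := by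
    ext j
    fin_cases j <;> simp
  conv_lhs => rw [hv]
  simp [pd]

lemma gradient_apply (q : Plane → ℝ) (x : Plane) (j : Fin 2) : gradient q x j = pd j q x := by
  have h : inner ℝ (gradient q x) (EuclideanSpace.single j 1) =
      fderiv ℝ q x (EuclideanSpace.single j 1) := InnerProductSpace.toDual_symm_apply
  rw [EuclideanSpace.inner_single_right] at h
  simpa [pd] using h

lemma pd_pd_eq {u : Plane → ℝ} {x : Plane} (hu : ContDiffAt ℝ 2 u x) (i j : Fin 2) :
    pd i (pd j u) x = fderiv ℝ (fderiv ℝ u) x (EuclideanSpace.single i 1)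
      (EuclideanSpace.single j 1) := by
  have hd : DifferentiableAt ℝ (fderiv ℝ u) x :=
    (hu.fderiv_right (m := 1) (by norm_num)).differentiableAt (by norm_num)
  have h := hd.hasFDerivAt.clm_apply
    (hasFDerivAt_const (EuclideanSpace.single j (1 : ℝ) : Plane) x)
  have h2 : fderiv ℝ (pd j u) x = _ := h.fderiv
  rw [pd, h2]; simp

lemma pd_comm {u : Plane → ℝ} {x : Plane} (hu : ContDiffAt ℝ 2 u x) (i j : Fin 2) :
    pd i (pd j u) x = pd j (pd i u) x := by
  rw [pd_pd_eq hu, pd_pd_eq hu]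
  exact hu.isSymmSndFDerivAt (by simp) _ _

lemma laplacian_eq_sum_pd {u : Plane → ℝ} {x : Plane} (hu : ContDiffAt ℝ 2 u x) :
    Laplacian.laplacian u x = ∑ i, pd i (pd i u) x := by
  rw [InnerProductSpace.laplacian_eq_iteratedFDeriv_orthonormalBasis u
    (EuclideanSpace.basisFun (Fin 2) ℝ)]
  refine Finset.sum_congr rfl fun i _ => ?_
  rw [pd_pd_eq hu, iteratedFDeriv_two_apply]
  simp

lemma laplacian_apply {v : Plane → Plane} {x : Plane} (hv : ContDiffAt ℝ 2 v x) (j : Fin 2) :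
    Laplacian.laplacian v x j = ∑ i, pd i (pd i fun y => v y j) x := by
  have hj : ContDiffAt ℝ 2 (fun y => v y j) x := contDiffAt_euclidean.1 hv j
  rw [← laplacian_eq_sum_pd hj]
  exact (hv.laplacian_CLM_comp_left (l := (EuclideanSpace.proj j : Plane →L[ℝ] ℝ))).symm

/-! ### The layer potentials off the graph -/

lemma IsInterface.hasDerivAt_comp_sub_Xi {f : ℝ → ℝ} (hf : IsInterface f) {F : Type*}
    [NormedAddCommGroup F] [NormedSpace ℝ F] {u : Plane → F} {x : Plane} {s : ℝ}
    (hu : DifferentiableAt ℝ u (x - Xi f s)) :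
    HasDerivAt (fun t => u (x - Xi f t))
      (-(pd 0 u (x - Xi f s) + deriv f s • pd 1 u (x - Xi f s))) s := by
  have hX : HasDerivAt (fun t => x - Xi f t) (-!₂[1, deriv f s] : Plane) s := by
    refine HasDerivAt.const_sub x ?_
    have e : Xi f = fun t => t • (EuclideanSpace.single 0 1 : Plane) +
        f t • (EuclideanSpace.single 1 1 : Plane) := by
      funext t; ext i; fin_cases i <;> simp [Xi]
    rw [e]
    refine (((hasDerivAt_id s).smul_const _).fun_add ((hf.hasDerivAt s).smul_const _)).congr_deriv ?_
    ext i; fin_cases i <;> simp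
  refine (hu.hasFDerivAt.comp_hasDerivAt s hX).congr_deriv ?_
  rw [map_neg, fderiv_eq_sum_pd_vec]
  simp

/-- Integration by parts along the graph. -/
lemma IsHomKernel.potK_deriv {m : ℕ} (hm : 1 ≤ m) {K : Plane → ℝ} (hK : IsHomKernel m K)
    {f : ℝ → ℝ} (hf : IsInterface f) {θ : ℝ → ℝ} (hθ : MemLp θ 2) (hθ' : MemLp (deriv θ) 2)
    (hθf : MemLp (fun s => θ s * deriv f s) 2) (hd : Differentiable ℝ θ) {x : Plane}
    (hx : gap f x ≠ 0) :
    potK f K (deriv θ) x = potK f (StokesGraph.pd 0 K) θ x +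
      potK f (StokesGraph.pd 1 K) (fun s => θ s * deriv f s) x := by
  have hm1 : 1 ≤ m + 1 := by omega
  have i0 := (hK.pd 0).integrable hm1 hf hθ hx
  have i1 := (hK.pd 1).integrable hm1 hf hθf hx
  have e : ∀ s, θ s * -(StokesGraph.pd 0 K (x - Xi f s) +
      deriv f s • StokesGraph.pd 1 K (x - Xi f s)) = -(θ s * StokesGraph.pd 0 K (x - Xi f s) +
      θ s * deriv f s * StokesGraph.pd 1 K (x - Xi f s)) := fun s => by
    rw [smul_eq_mul]; ring
  have key := integral_mul_deriv_eq_deriv_mul_of_integrable (u := θ) (u' := deriv θ)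
    (v := fun s => K (x - Xi f s)) (fun s _ => (hd s).hasDerivAt)
    (fun s _ => hf.hasDerivAt_comp_sub_Xi (hK.differentiableAt (sub_Xi_ne_zero hx s))) ?_
    (hK.integrable hm hf hθ' hx) (hK.integrable hm hf hθ hx)
  · simp only [e] at key
    rw [integral_neg, neg_inj, integral_add i0 i1] at key
    exact key.symm
  · refine (i0.add i1).neg.congr (ae_of_all _ fun s => ?_)
    simp only [Pi.neg_apply, Pi.add_apply, Pi.mul_apply]
    rw [e]

lemma potK_add_smul {f : ℝ → ℝ} {K L : Plane → ℝ} {φ χ : ℝ → ℝ} {x : Plane}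
    (h1 : Integrable fun s => φ s * K (x - Xi f s)) (h2 : Integrable fun s => χ s * L (x - Xi f s)) :
    ∫ s, (φ s * K (x - Xi f s) + χ s * L (x - Xi f s)) = potK f K φ x + potK f L χ x :=
  integral_add h1 h2

lemma IsInterface.velocityIntegrand_apply {f : ℝ → ℝ} (hf : IsInterface f) (μ : ℝ) {x : Plane}
    (hx : gap f x ≠ 0) (s : ℝ) (j : Fin 2) :
    velocityIntegrand f μ x s j = -∑ k, (g f k s * pd 0 (fun y => U μ k y j) (x - Xi f s) +
      g f k s * deriv f s * pd 1 (fun y => U μ k y j) (x - Xi f s)) := by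
  have hne := sub_Xi_ne_zero hx s
  rw [velocityIntegrand, ← Finset.sum_neg_distrib]
  have : (∑ k, g f k s • deriv (fun t => U μ k (x - Xi f t)) s) j =
      ∑ k, (g f k s • deriv (fun t => U μ k (x - Xi f t)) s) j := by
    simp [Fin.sum_univ_two]
  rw [this]
  refine Finset.sum_congr rfl fun k _ => ?_
  have hU := differentiableAt_U μ k hne
  rw [(hf.hasDerivAt_comp_sub_Xi hU).deriv, ← pd_apply hU, ← pd_apply hU]
  simp
  ring

lemma IsInterface.integrable_sum_pd_U {f : ℝ → ℝ} (hf : IsInterface f) (μ : ℝ) {x : Plane}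
    (hx : gap f x ≠ 0) (j k : Fin 2) : Integrable fun s =>
      g f k s * pd 0 (fun y => U μ k y j) (x - Xi f s) +
      g f k s * deriv f s * pd 1 (fun y => U μ k y j) (x - Xi f s) :=
  ((isHomKernel_pd_U μ j k 0).integrable le_rfl hf (hf.memLp_g k) hx).add
    ((isHomKernel_pd_U μ j k 1).integrable le_rfl hf (hf.memLp_g_mul_deriv k) hx)

lemma IsInterface.integrable_velocityIntegrand {f : ℝ → ℝ} (hf : IsInterface f) (μ : ℝ) {x : Plane}
    (hx : gap f x ≠ 0) : Integrable (velocityIntegrand f μ x) := by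
  refine integrable_piLp_iff.2 fun j => ?_
  simp only [hf.velocityIntegrand_apply μ hx _ j]
  exact (integrable_finsetSum _ fun k _ => hf.integrable_sum_pd_U μ hx j k).neg

/-- The velocity as a sum of potentials with kernels of degree `-1`. -/
lemma IsInterface.velocity_apply {f : ℝ → ℝ} (hf : IsInterface f) (μ σ : ℝ) {x : Plane}
    (hx : gap f x ≠ 0) (j : Fin 2) :
    velocity f μ σ x j = -σ * ∑ k, (potK f (pd 0 fun y => U μ k y j) (g f k) x +
      potK f (pd 1 fun y => U μ k y j) (fun s => g f k s * deriv f s) x) := by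
  have hi := hf.integrable_velocityIntegrand μ hx
  rw [velocity, PiLp.smul_apply, eval_integral_piLp (integrable_piLp_iff.1 hi)]
  simp only [hf.velocityIntegrand_apply μ hx _ j]
  rw [integral_neg, integral_finsetSum _ fun k _ => hf.integrable_sum_pd_U μ hx j k, smul_eq_mul,
    mul_neg, neg_mul]
  congr 2
  refine Finset.sum_congr rfl fun k _ => potK_add_smul
    ((isHomKernel_pd_U μ j k 0).integrable le_rfl hf (hf.memLp_g k) hx)
    ((isHomKernel_pd_U μ j k 1).integrable le_rfl hf (hf.memLp_g_mul_deriv k) hx)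

lemma IsInterface.integrable_pressureIntegrand {f : ℝ → ℝ} (hf : IsInterface f) {x : Plane}
    (hx : gap f x ≠ 0) : Integrable (pressureIntegrand f x) :=
  integrable_finsetSum _ fun k _ => by
    simpa only [mul_comm] using (isHomKernel_P k).integrable le_rfl hf (hf.memLp_deriv_g k) hx

lemma IsInterface.pressure_eq {f : ℝ → ℝ} (hf : IsInterface f) (σ : ℝ) {x : Plane}
    (hx : gap f x ≠ 0) : pressure f σ x = -σ * ∑ k, potK f (P k) (deriv (g f k)) x := by
  rw [pressure]
  congr 1
  simp only [pressureIntegrand, mul_comm (P _ _)]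
  rw [integral_finsetSum _ fun k _ => (isHomKernel_P k).integrable le_rfl hf (hf.memLp_deriv_g k) hx]
  rfl

lemma pd_congr_on {u v : Plane → ℝ} {s : Set Plane} (hs : IsOpen s) (h : ∀ y ∈ s, u y = v y)
    (l : Fin 2) {x : Plane} (hx : x ∈ s) : pd l u x = pd l v x := by
  have : u =ᶠ[𝓝 x] v := by filter_upwards [hs.mem_nhds hx] with z hz using h z hz
  rw [pd, pd, this.fderiv_eq]

lemma pd_const_mul_sum {u : Fin 2 → Plane → ℝ} {x : Plane} (c : ℝ)
    (hu : ∀ k, DifferentiableAt ℝ (u k) x) (l : Fin 2) :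
    pd l (fun y => c * ∑ k, u k y) x = c * ∑ k, pd l (u k) x := by
  have h := (HasFDerivAt.fun_sum (u := Finset.univ) fun k _ => (hu k).hasFDerivAt).const_mul c
  rw [pd, h.fderiv]
  simp [pd, mul_add]

lemma pd_add {u v : Plane → ℝ} {x : Plane} (hu : DifferentiableAt ℝ u x)
    (hv : DifferentiableAt ℝ v x) (l : Fin 2) :
    pd l (fun y => u y + v y) x = pd l u x + pd l v x := by
  rw [pd, (hu.hasFDerivAt.fun_add hv.hasFDerivAt).fderiv]
  simp [pd]

lemma pd_neg (i : Fin 2) (v : Plane → ℝ) : pd i (fun x => -v x) = fun x => -pd i v x := by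
  funext x
  rw [pd, fderiv_fun_neg]; rfl

lemma potK_congr {f : ℝ → ℝ} {K L : Plane → ℝ} (h : ∀ y, y ≠ 0 → K y = L y) (φ : ℝ → ℝ) {x : Plane}
    (hx : gap f x ≠ 0) : potK f K φ x = potK f L φ x :=
  integral_congr_ae (ae_of_all _ fun s => by simp only [h _ (sub_Xi_ne_zero hx s)])

/-- The derivatives of the velocity are potentials with the density `g'`. -/
lemma IsInterface.pd_velocity_apply {f : ℝ → ℝ} (hf : IsInterface f) (μ σ : ℝ) {x : Plane}
    (hx : gap f x ≠ 0) (j l : Fin 2) :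
    pd l (fun y => velocity f μ σ y j) x =
      -σ * ∑ k, potK f (pd l fun y => U μ k y j) (deriv (g f k)) x := by
  have d0 : ∀ k, DifferentiableAt ℝ (potK f (pd 0 fun y => U μ k y j) (g f k)) x := fun k =>
    ((isHomKernel_pd_U μ j k 0).hasFDerivAt_potK le_rfl hf (hf.memLp_g k) hx).differentiableAt
  have d1 : ∀ k, DifferentiableAt ℝ
      (potK f (pd 1 fun y => U μ k y j) (fun s => g f k s * deriv f s)) x := fun k =>
    ((isHomKernel_pd_U μ j k 1).hasFDerivAt_potK le_rfl hf (hf.memLp_g_mul_deriv k)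
      hx).differentiableAt
  rw [pd_congr_on (isOpen_gap_ne hf.continuous) (fun y hy => hf.velocity_apply μ σ hy j) l hx,
    pd_const_mul_sum (-σ) (fun k => (d0 k).fun_add (d1 k)) l]
  congr 1
  refine Finset.sum_congr rfl fun k _ => ?_
  rw [pd_add (d0 k) (d1 k), (isHomKernel_pd_U μ j k 0).pd_potK le_rfl hf (hf.memLp_g k) hx,
    (isHomKernel_pd_U μ j k 1).pd_potK le_rfl hf (hf.memLp_g_mul_deriv k) hx,
    (isHomKernel_pd_U μ j k l).potK_deriv le_rfl hf (hf.memLp_g k) (hf.memLp_deriv_g k)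
      (hf.memLp_g_mul_deriv k) (fun s => (hf.hasDerivAt_g k s).differentiableAt) hx]
  have hc : ∀ i y, y ≠ 0 → pd l (pd i fun y => U μ k y j) y = pd i (pd l fun y => U μ k y j) y :=
    fun i y hy => pd_comm (((contDiffOn_U μ k j).contDiffAt
      (isOpen_compl_singleton.mem_nhds hy)).of_le ENat.LEInfty.out) l i
  rw [potK_congr (hc 0) _ hx, potK_congr (hc 1) _ hx]

lemma IsInterface.contDiffOn_velocity_apply {f : ℝ → ℝ} (hf : IsInterface f) (μ σ : ℝ) (n : ℕ)
    (j : Fin 2) : ContDiffOn ℝ n (fun x => velocity f μ σ x j) {x | gap f x ≠ 0} := by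
  refine ContDiffOn.congr ?_ fun x hx => hf.velocity_apply μ σ hx j
  refine contDiffOn_const.mul (ContDiffOn.sum fun k _ => ContDiffOn.add ?_ ?_)
  · exact (isHomKernel_pd_U μ j k 0).contDiffOn_potK n le_rfl hf (hf.memLp_g k)
  · exact (isHomKernel_pd_U μ j k 1).contDiffOn_potK n le_rfl hf (hf.memLp_g_mul_deriv k)

lemma IsInterface.contDiffOn_velocity {f : ℝ → ℝ} (hf : IsInterface f) (μ σ : ℝ) (n : ℕ) :
    ContDiffOn ℝ n (velocity f μ σ) {x | gap f x ≠ 0} :=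
  contDiffOn_euclidean.2 fun j => hf.contDiffOn_velocity_apply μ σ n j

lemma IsInterface.contDiffOn_pressure {f : ℝ → ℝ} (hf : IsInterface f) (σ : ℝ) (n : ℕ) :
    ContDiffOn ℝ n (pressure f σ) {x | gap f x ≠ 0} := by
  refine ContDiffOn.congr ?_ fun x hx => hf.pressure_eq σ hx
  exact contDiffOn_const.mul (ContDiffOn.sum fun k _ =>
    (isHomKernel_P k).contDiffOn_potK n le_rfl hf (hf.memLp_deriv_g k))

lemma IsInterface.pd_velocity {f : ℝ → ℝ} (hf : IsInterface f) (μ σ : ℝ) {x : Plane}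
    (hx : gap f x ≠ 0) (l j : Fin 2) :
    pd l (velocity f μ σ) x j =
      -σ * ∑ k, potK f (pd l fun y => U μ k y j) (deriv (g f k)) x := by
  rw [pd_apply, hf.pd_velocity_apply μ σ hx]
  exact ((hf.contDiffOn_velocity μ σ 1).contDiffAt
    ((isOpen_gap_ne hf.continuous).mem_nhds hx)).differentiableAt (by norm_num)

lemma IsInterface.divergence_velocity {f : ℝ → ℝ} (hf : IsInterface f) (μ σ : ℝ) {x : Plane}
    (hx : gap f x ≠ 0) : divergence (velocity f μ σ) x = 0 := by
  simp only [divergence, hf.pd_velocity μ σ hx]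
  rw [← Finset.mul_sum, Finset.sum_comm]
  refine mul_eq_zero_of_right _ (Finset.sum_eq_zero fun k _ => ?_)
  simp only [potK]
  rw [← integral_finsetSum _ fun j _ =>
    (isHomKernel_pd_U μ j k j).integrable le_rfl hf (hf.memLp_deriv_g k) hx]
  refine integral_eq_zero_of_ae (ae_of_all _ fun s => ?_)
  simp only [← Finset.mul_sum, divergence_fundamental μ k (sub_Xi_ne_zero hx s), mul_zero,
    Pi.zero_apply]

lemma IsInterface.momentum_velocity {f : ℝ → ℝ} (hf : IsInterface f) {μ : ℝ} (hμ : 0 < μ) (σ : ℝ)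
    {x : Plane} (hx : gap f x ≠ 0) :
    μ • Laplacian.laplacian (velocity f μ σ) x - gradient (pressure f σ) x = 0 := by
  have ho := isOpen_gap_ne hf.continuous
  have hv := (hf.contDiffOn_velocity μ σ 2).contDiffAt (ho.mem_nhds hx)
  ext j
  rw [PiLp.sub_apply, PiLp.smul_apply, laplacian_apply hv, gradient_apply, PiLp.zero_apply,
    pd_congr_on ho (fun y hy => hf.pressure_eq σ hy) j hx,
    pd_const_mul_sum (-σ) (fun k => ((isHomKernel_P k).hasFDerivAt_potK le_rfl hf
      (hf.memLp_deriv_g k) hx).differentiableAt) j]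
  have e : ∀ i, pd i (pd i fun y => velocity f μ σ y j) x =
      -σ * ∑ k, potK f (pd i (pd i fun y => U μ k y j)) (deriv (g f k)) x := by
    intro i
    rw [pd_congr_on ho (fun y hy => hf.pd_velocity_apply μ σ hy j i) i hx,
      pd_const_mul_sum (-σ) (fun k => ((isHomKernel_pd_U μ j k i).hasFDerivAt_potK le_rfl hf
      (hf.memLp_deriv_g k) hx).differentiableAt) i]
    congr 1
    exact Finset.sum_congr rfl fun k _ =>
      (isHomKernel_pd_U μ j k i).pd_potK le_rfl hf (hf.memLp_deriv_g k) hx i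
  simp only [e]
  rw [← Finset.mul_sum, Finset.sum_comm, smul_eq_mul, mul_left_comm, ← mul_sub, Finset.mul_sum,
    ← Finset.sum_sub_distrib]
  refine mul_eq_zero_of_right _ (Finset.sum_eq_zero fun k _ => ?_)
  rw [(isHomKernel_P k).pd_potK le_rfl hf (hf.memLp_deriv_g k) hx, sub_eq_zero]
  simp only [potK]
  rw [← integral_finsetSum _ fun i _ =>
    ((isHomKernel_pd_U μ j k i).pd i).integrable (by omega) hf (hf.memLp_deriv_g k) hx,
    ← integral_const_mul]
  refine integral_congr_ae (ae_of_all _ fun s => ?_)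
  simp only [← Finset.mul_sum]
  rw [mul_left_comm, momentum_fundamental hμ j k (sub_Xi_ne_zero hx s)]

/-! ### The representation by the matrix `M` -/

lemma differentiableAt_M (μ σ : ℝ) (k : Fin 2) {y : Plane} (hy : y ≠ 0) :
    DifferentiableAt ℝ (M μ σ k) y :=
  ((differentiableAt_U μ k hy).prodMk ((isHomKernel_P k).differentiableAt hy)).const_smul (-σ)

lemma pd_M (μ σ : ℝ) (k l : Fin 2) {y : Plane} (hy : y ≠ 0) :
    pd l (M μ σ k) y = -σ • (pd l (U μ k) y, pd l (P k) y) := by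
  have h := ((differentiableAt_U μ k hy).hasFDerivAt.prodMk
    ((isHomKernel_P k).differentiableAt hy).hasFDerivAt).const_smul (-σ)
  have h2 : fderiv ℝ (M μ σ k) y = _ := h.fderiv
  rw [pd, h2]; rfl

lemma IsInterface.repIntegrand_eq_neg {f : ℝ → ℝ} (hf : IsInterface f) (μ σ : ℝ) {x : Plane}
    (hx : gap f x ≠ 0) (s : ℝ) : repIntegrand f μ σ x s = -repIntegrand' f μ σ x s := by
  rw [repIntegrand, repIntegrand', ← Finset.sum_neg_distrib]
  refine Finset.sum_congr rfl fun k _ => ?_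
  rw [(hf.hasDerivAt_comp_sub_Xi (differentiableAt_M μ σ k (sub_Xi_ne_zero hx s))).deriv, smul_neg]

lemma IsInterface.repIntegrand'_eq {f : ℝ → ℝ} (hf : IsInterface f) (μ σ : ℝ) {x : Plane}
    (hx : gap f x ≠ 0) (s : ℝ) : repIntegrand' f μ σ x s =
      (σ • velocityIntegrand f μ x s, -σ * ∑ k, (g f k s * pd 0 (P k) (x - Xi f s) +
        g f k s * deriv f s * pd 1 (P k) (x - Xi f s))) := by
  have hne := sub_Xi_ne_zero hx s
  have e : ∀ k, deriv (fun t => U μ k (x - Xi f t)) s = _ := fun k =>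
    (hf.hasDerivAt_comp_sub_Xi (differentiableAt_U μ k hne)).deriv
  simp only [repIntegrand', velocityIntegrand, pd_M μ σ _ _ hne, e, Fin.sum_univ_two]
  refine Prod.ext ?_ ?_
  · simp only [Prod.fst_add, Prod.smul_fst]
    module
  · simp only [Prod.snd_add, Prod.smul_snd, smul_eq_mul]
    ring

lemma IsInterface.integrable_sum_pd_P {f : ℝ → ℝ} (hf : IsInterface f) {x : Plane}
    (hx : gap f x ≠ 0) (k : Fin 2) : Integrable fun s => g f k s * pd 0 (P k) (x - Xi f s) +
        g f k s * deriv f s * pd 1 (P k) (x - Xi f s) :=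
  (((isHomKernel_P k).pd 0).integrable (by omega) hf (hf.memLp_g k) hx).add
    (((isHomKernel_P k).pd 1).integrable (by omega) hf (hf.memLp_g_mul_deriv k) hx)

lemma IsInterface.integrable_repIntegrand' {f : ℝ → ℝ} (hf : IsInterface f) (μ σ : ℝ) {x : Plane}
    (hx : gap f x ≠ 0) : Integrable (repIntegrand' f μ σ x) := by
  refine Integrable.congr (Integrable.prodMk ((hf.integrable_velocityIntegrand μ hx).smul σ)
    ((integrable_finsetSum Finset.univ fun k _ => hf.integrable_sum_pd_P hx k).const_mul (-σ)))
    (ae_of_all _ fun s => ?_)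
  rw [hf.repIntegrand'_eq μ σ hx]
  simp

/-- For the pressure this is integration by parts along the graph. -/
lemma IsInterface.integral_repIntegrand' {f : ℝ → ℝ} (hf : IsInterface f) (μ σ : ℝ) {x : Plane}
    (hx : gap f x ≠ 0) :
    (velocity f μ σ x, pressure f σ x) = ∫ s, repIntegrand' f μ σ x s := by
  simp only [hf.repIntegrand'_eq μ σ hx]
  rw [integral_pair (f := fun s => σ • velocityIntegrand f μ x s)
    ((hf.integrable_velocityIntegrand μ hx).smul σ)
    ((integrable_finsetSum Finset.univ fun k _ => hf.integrable_sum_pd_P hx k).const_mul (-σ)),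
    integral_smul, integral_const_mul, integral_finsetSum _ fun k _ => hf.integrable_sum_pd_P hx k,
    hf.pressure_eq σ hx]
  refine Prod.ext rfl ?_
  simp only
  congr 1
  refine Finset.sum_congr rfl fun k _ => ?_
  rw [(isHomKernel_P k).potK_deriv le_rfl hf (hf.memLp_g k) (hf.memLp_deriv_g k)
    (hf.memLp_g_mul_deriv k) (fun s => (hf.hasDerivAt_g k s).differentiableAt) hx]
  exact (potK_add_smul (((isHomKernel_P k).pd 0).integrable (by omega) hf (hf.memLp_g k) hx)
    (((isHomKernel_P k).pd 1).integrable (by omega) hf (hf.memLp_g_mul_deriv k) hx)).symm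

/-! ### One-sided limits at the graph -/

/-- The function `u` has limits at the point `(ξ, f ξ)` from both sides of the graph, and `J` is the
limit from above minus the limit from below. -/
def JumpsBy (f : ℝ → ℝ) (u : Plane → ℝ) (ξ J : ℝ) : Prop :=
  ∃ L : ℝ → ℝ, (∀ ε, ε ^ 2 = 1 → Tendsto u (𝓝[side f ε] (Xi f ξ)) (𝓝 (L ε))) ∧ L 1 - L (-1) = J

lemma JumpsBy.congr {f : ℝ → ℝ} {u v : Plane → ℝ} {ξ J : ℝ} (h : JumpsBy f u ξ J)
    (huv : ∀ x, gap f x ≠ 0 → v x = u x) : JumpsBy f v ξ J := by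
  obtain ⟨L, h1, h2⟩ := h
  refine ⟨L, fun ε hε => (h1 ε hε).congr' ?_, h2⟩
  filter_upwards [self_mem_nhdsWithin] with x hx using (huv x (side_gap_ne hx)).symm

lemma JumpsBy.add {f : ℝ → ℝ} {u v : Plane → ℝ} {ξ J J' : ℝ} (h : JumpsBy f u ξ J)
    (h' : JumpsBy f v ξ J') : JumpsBy f (fun x => u x + v x) ξ (J + J') := by
  obtain ⟨L, h1, h2⟩ := h
  obtain ⟨L', h1', h2'⟩ := h'
  exact ⟨fun ε => L ε + L' ε, fun ε hε => (h1 ε hε).add (h1' ε hε), by linarith⟩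

lemma JumpsBy.const_mul_sum {f : ℝ → ℝ} {u : Fin 2 → Plane → ℝ} {ξ : ℝ} {J : Fin 2 → ℝ} (c : ℝ)
    (h : ∀ k, JumpsBy f (u k) ξ (J k)) :
    JumpsBy f (fun x => c * ∑ k, u k x) ξ (c * ∑ k, J k) := by
  choose L h1 h2 using h
  refine ⟨fun ε => c * ∑ k, L k ε, fun ε hε =>
    (tendsto_finsetSum _ fun k _ => h1 k ε hε).const_mul c, ?_⟩
  simp only [← h2, Finset.sum_sub_distrib, mul_sub]

lemma potK_eq_potAB {f : ℝ → ℝ} {K : Plane → ℝ} {a b : ℂ}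
    (hK : ∀ y, y ≠ 0 → K y = kerAB a b (toC y)) (φ : ℝ → ℝ) {x : Plane} (hx : gap f x ≠ 0) :
    potK f K φ x = potAB f a b φ x := by
  refine integral_congr_ae (ae_of_all _ fun s => ?_)
  simp only [hK _ (sub_Xi_ne_zero hx s), relC_eq_toC]

lemma IsInterface.jumpsBy_potK {f : ℝ → ℝ} (hf : IsInterface f) {K : Plane → ℝ} {a b : ℂ}
    (hK : ∀ y, y ≠ 0 → K y = kerAB a b (toC y)) {φ : ℝ → ℝ} {ψ : ℝ → ℂ}
    (h : SobH1 (fun s => (φ s : ℂ)) ψ) (ξ : ℝ) :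
    JumpsBy f (potK f K φ) ξ (jumpAB f a b ξ * φ ξ) :=
  JumpsBy.congr (hf.potAB_jump a b h ξ) fun _ hx => potK_eq_potAB hK φ hx

lemma IsInterface.tendsto_potK_infty {f : ℝ → ℝ} (hf : IsInterface f) {K : Plane → ℝ} {a b : ℂ}
    (hK : ∀ y, y ≠ 0 → K y = kerAB a b (toC y)) {φ : ℝ → ℝ} {ψ : ℝ → ℂ}
    (h : SobH1 (fun s => (φ s : ℂ)) ψ) {ε : ℝ} (hε : ε ^ 2 = 1) :
    Tendsto (potK f K φ) (Bornology.cobounded Plane ⊓ 𝓟 (side f ε)) (𝓝 0) := by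
  refine (hf.potAB_tendsto_infty a b h hε).congr' ?_
  filter_upwards [mem_inf_of_right (mem_principal_self (side f ε))] with x hx
  exact (potK_eq_potAB hK φ (side_gap_ne hx)).symm

lemma nu_sq (f : ℝ → ℝ) (s : ℝ) : nu f s 0 ^ 2 + nu f s 1 ^ 2 = 1 := by
  rw [nu_zero, nu_one]
  have := (omega_pos f s).ne'
  have h := omega_sq f s
  field_simp
  linarith

/-- The velocity is continuous across the graph, because the tangential derivative of the
fundamental solution has vanishing jump symbol. -/
lemma IsInterface.jumpsBy_velocity {f : ℝ → ℝ} (hf : IsInterface f) {μ : ℝ} (hμ : 0 < μ) (σ : ℝ)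
    (j : Fin 2) (ξ : ℝ) : JumpsBy f (fun x => velocity f μ σ x j) ξ 0 := by
  have h := JumpsBy.const_mul_sum (-σ) fun k =>
    (hf.jumpsBy_potK (fun y hy => pd_U_eq μ j k 0 hy) (hf.sobH1_g k) ξ).add
    (hf.jumpsBy_potK (fun y hy => pd_U_eq μ j k 1 hy) (hf.sobH1_g_mul_deriv k).choose_spec ξ)
  have e : (-σ * ∑ k, (jumpAB f (stokesA μ j k 0) (stokesB μ j k 0) ξ * g f k ξ +
      jumpAB f (stokesA μ j k 1) (stokesB μ j k 1) ξ * (g f k ξ * deriv f ξ))) = 0 := by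
    refine mul_eq_zero_of_right _ (Finset.sum_eq_zero fun k _ => ?_)
    rw [jump_pd_U f hμ, jump_pd_U f hμ, nu_zero f ξ, nu_one f ξ]
    ring
  rw [e] at h
  exact h.congr fun x hx => hf.velocity_apply μ σ hx j

/-- The gradient of the velocity is continuous across the graph, because its density `g'` is normal
and the jump symbol annihilates the normal direction. -/
lemma IsInterface.jumpsBy_pd_velocity {f : ℝ → ℝ} (hf : IsInterface f) {μ : ℝ} (hμ : 0 < μ) (σ : ℝ)
    (l j : Fin 2) (ξ : ℝ) : JumpsBy f (fun x => pd l (velocity f μ σ) x j) ξ 0 := by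
  have h := JumpsBy.const_mul_sum (-σ) fun k =>
    (hf.jumpsBy_potK (fun y hy => pd_U_eq μ j k l hy) (hf.sobH1_deriv_g k).choose_spec ξ)
  have e : (-σ * ∑ k, (jumpAB f (stokesA μ j k l) (stokesB μ j k l) ξ * deriv (g f k) ξ)) = 0 := by
    refine mul_eq_zero_of_right _ ?_
    simp only [jump_pd_U f hμ, hf.deriv_g, Fin.sum_univ_two]
    have h0 := (omega_pos f ξ).ne'
    have hn := nu_sq f ξ
    field_simp
    fin_cases j
    · simp [-mul_eq_zero]
      linear_combination (-kappa f ξ * nu f ξ l * nu f ξ 0) * hn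
    · simp [-mul_eq_zero]
      linear_combination (-kappa f ξ * nu f ξ l * nu f ξ 1) * hn
  rw [e] at h
  exact h.congr fun x hx => hf.pd_velocity μ σ hx l j

lemma IsInterface.jumpsBy_pressure {f : ℝ → ℝ} (hf : IsInterface f) (σ : ℝ) (ξ : ℝ) :
    JumpsBy f (pressure f σ) ξ (σ * kappa f ξ) := by
  have h := JumpsBy.const_mul_sum (-σ) fun k =>
    (hf.jumpsBy_potK (fun y hy => P_eq k hy) (hf.sobH1_deriv_g k).choose_spec ξ)
  have e : (-σ * ∑ k, (jumpAB f (pressA k) 0 ξ * deriv (g f k) ξ)) = σ * kappa f ξ := by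
    simp only [jump_P, hf.deriv_g, Fin.sum_univ_two]
    have h0 := (omega_pos f ξ).ne'
    have hn := nu_sq f ξ
    field_simp
    linear_combination σ * kappa f ξ * hn
  rw [e] at h
  exact h.congr fun x hx => hf.pressure_eq σ hx

lemma tendsto_plane {α : Type*} {l : Filter α} {u : α → Plane} {a : Plane}
    (h : ∀ j, Tendsto (fun x => u x j) l (𝓝 (a j))) : Tendsto u l (𝓝 a) :=
  ((PiLp.continuous_toLp 2 _).tendsto (WithLp.ofLp a)).comp (tendsto_pi_nhds.2 h)

lemma IsInterface.tendsto_velocity {f : ℝ → ℝ} (hf : IsInterface f) (μ σ : ℝ) {ε : ℝ}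
    (hε : ε ^ 2 = 1) :
    Tendsto (velocity f μ σ) (Bornology.cobounded Plane ⊓ 𝓟 (side f ε)) (𝓝 0) := by
  refine tendsto_plane fun j => ?_
  have h := (tendsto_finsetSum Finset.univ fun k _ =>
    (hf.tendsto_potK_infty (fun y hy => pd_U_eq μ j k 0 hy) (hf.sobH1_g k) hε).add
    (hf.tendsto_potK_infty (fun y hy => pd_U_eq μ j k 1 hy)
      (hf.sobH1_g_mul_deriv k).choose_spec hε)).const_mul (-σ)
  simp only [add_zero, Finset.sum_const_zero, mul_zero] at h
  refine h.congr' ?_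
  filter_upwards [mem_inf_of_right (mem_principal_self (side f ε))] with x hx
  exact (hf.velocity_apply μ σ (side_gap_ne hx) j).symm

lemma IsInterface.tendsto_pressure {f : ℝ → ℝ} (hf : IsInterface f) (σ : ℝ) {ε : ℝ}
    (hε : ε ^ 2 = 1) :
    Tendsto (pressure f σ) (Bornology.cobounded Plane ⊓ 𝓟 (side f ε)) (𝓝 0) := by
  have h := (tendsto_finsetSum Finset.univ fun k _ =>
    hf.tendsto_potK_infty (fun y hy => P_eq k hy) (hf.sobH1_deriv_g k).choose_spec hε).const_mul (-σ)
  simp only [Finset.sum_const_zero, mul_zero] at h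
  refine h.congr' ?_
  filter_upwards [mem_inf_of_right (mem_principal_self (side f ε))] with x hx
  exact (hf.pressure_eq σ (side_gap_ne hx)).symm

/-! ### The potential solves the problem -/

lemma omegaPlus_eq (f : ℝ → ℝ) : OmegaPlus f = side f 1 := by
  ext x; simp [OmegaPlus, side, gap]

lemma omegaMinus_eq (f : ℝ → ℝ) : OmegaMinus f = side f (-1) := by
  ext x; simp [OmegaMinus, side, gap]

lemma eq_Xi_of_gap {f : ℝ → ℝ} {x : Plane} (hx : gap f x = 0) : x = Xi f (x 0) := by
  obtain ⟨s, rfl⟩ := mem_gam_iff.2 hx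
  simp [Xi]

lemma closure_side_subset {f : ℝ → ℝ} (hf : Continuous f) {ε : ℝ} (hε : ε ^ 2 = 1) {x : Plane}
    (hx : x ∈ closure (side f ε)) : x ∈ side f ε ∨ x = Xi f (x 0) := by
  have hc : IsClosed {x | 0 ≤ ε * gap f x} :=
    isClosed_le continuous_const (continuous_const.mul (continuous_gap hf))
  have h : x ∈ {x | 0 ≤ ε * gap f x} :=
    closure_minimal (fun y (hy : 0 < ε * gap f y) => hy.le) hc hx
  replace h : 0 ≤ ε * gap f x := h
  rcases h.eq_or_lt with h | h
  · right
    refine eq_Xi_of_gap ?_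
    rcases mul_eq_zero.1 h.symm with h | h
    · rw [h] at hε; norm_num at hε
    · exact h
  · exact Or.inl h

/-- A function which is continuous on one side of the graph and has limits at all points of the graph
extends continuously. -/
lemma extendsCont_side {F : Type*} [TopologicalSpace F] [T3Space F] {f : ℝ → ℝ}
    (hf : Continuous f) {ε : ℝ} (hε : ε ^ 2 = 1) {u : Plane → F} (hu : ContinuousOn u (side f ε))
    (hb : ∀ ξ, ∃ a, Tendsto u (𝓝[side f ε] (Xi f ξ)) (𝓝 a)) : ExtendsCont (side f ε) u := by
  refine ⟨extendFrom (side f ε) u, continuousOn_extendFrom subset_rfl fun x hx => ?_,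
    fun x hx => extendFrom_extends hu x hx⟩
  rcases closure_side_subset hf hε hx with h | h
  · exact ⟨u x, hu x h⟩
  · rw [h]; exact hb _

lemma fderiv_eq_sum_smulRightL {F : Type*} [NormedAddCommGroup F] [NormedSpace ℝ F] (u : Plane → F)
    (x : Plane) : fderiv ℝ u x = ∑ l, ContinuousLinearMap.smulRightL ℝ Plane F
      (EuclideanSpace.proj l : Plane →L[ℝ] ℝ) (pd l u x) := by
  ext v
  rw [fderiv_eq_sum_pd_vec, Fin.sum_univ_two]
  simp

theorem IsInterface.isStokesPhase {f : ℝ → ℝ} (hf : IsInterface f) {μ : ℝ} (hμ : 0 < μ) (σ : ℝ)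
    {ε : ℝ} (hε : ε ^ 2 = 1) :
    IsStokesPhase μ (side f ε) (velocity f μ σ) (pressure f σ) := by
  have hs : side f ε ⊆ {x | gap f x ≠ 0} := fun x hx => side_gap_ne hx
  have hv2 := (hf.contDiffOn_velocity μ σ 2).mono hs
  have hq1 := (hf.contDiffOn_pressure σ 1).mono hs
  have ho := isOpen_side hf.continuous ε
  refine ⟨hv2, extendsCont_side hf.continuous hε hv2.continuousOn fun ξ => ?_,
    extendsCont_side hf.continuous hε (hv2.continuousOn_fderiv_of_isOpen ho (by norm_num))
      fun ξ => ?_, hq1, extendsCont_side hf.continuous hε hq1.continuousOn fun ξ => ?_,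
    fun x hx => hf.momentum_velocity hμ σ (hs hx), fun x hx => hf.divergence_velocity μ σ (hs hx),
    hf.tendsto_velocity μ σ hε, hf.tendsto_pressure σ hε⟩
  · choose L hL _ using fun j => hf.jumpsBy_velocity hμ σ j ξ
    exact ⟨WithLp.toLp 2 fun j => L j ε, tendsto_plane fun j => hL j ε hε⟩
  · choose L hL _ using fun l j => hf.jumpsBy_pd_velocity hμ σ l j ξ
    simp only [funext (fderiv_eq_sum_smulRightL (velocity f μ σ))]
    refine ⟨_, tendsto_finsetSum _ fun l _ => ((ContinuousLinearMap.smulRightL ℝ Plane Plane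
      (EuclideanSpace.proj l : Plane →L[ℝ] ℝ)).continuous.tendsto
      (WithLp.toLp 2 fun j => L l j ε)).comp (tendsto_plane fun j => hL l j ε hε)⟩
  · obtain ⟨L, hL, -⟩ := hf.jumpsBy_pressure σ ξ
    exact ⟨L ε, hL ε hε⟩

/-- The single-layer potential solves the two-phase problem. -/
theorem IsInterface.isSolution {f : ℝ → ℝ} (hf : IsInterface f) {μ : ℝ} (hμ : 0 < μ) (σ : ℝ) :
    IsSolution f μ σ (velocity f μ σ) (velocity f μ σ) (pressure f σ) (pressure f σ) := by
  have e1 : (1 : ℝ) ^ 2 = 1 := by norm_num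
  have e2 : (-1 : ℝ) ^ 2 = 1 := by norm_num
  refine ⟨?_, ?_, fun ξ => ?_, fun ξ => ?_⟩
  · rw [omegaPlus_eq]; exact hf.isStokesPhase hμ σ e1
  · rw [omegaMinus_eq]; exact hf.isStokesPhase hμ σ e2
  · choose L hL hJ using fun j => hf.jumpsBy_velocity hμ σ j ξ
    rw [omegaPlus_eq, omegaMinus_eq]
    refine ⟨WithLp.toLp 2 fun j => L j 1, WithLp.toLp 2 fun j => L j (-1),
      tendsto_plane fun j => hL j 1 e1, tendsto_plane fun j => hL j (-1) e2, ?_⟩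
    ext j
    simpa using (hJ j).symm
  · choose D hD hDJ using fun l j => hf.jumpsBy_pd_velocity hμ σ l j ξ
    obtain ⟨Q, hQ, hQJ⟩ := hf.jumpsBy_pressure σ ξ
    rw [omegaPlus_eq, omegaMinus_eq]
    have ht : ∀ ε : ℝ, ε ^ 2 = 1 → Tendsto (stress μ (velocity f μ σ) (pressure f σ))
        (𝓝[side f ε] (Xi f ξ)) (𝓝 (Matrix.of fun i j =>
          -Q ε * (if i = j then 1 else 0) + μ * (D i j ε + D j i ε))) := by
      intro ε hε
      refine tendsto_pi_nhds.2 fun i => tendsto_pi_nhds.2 fun j => ?_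
      exact ((hQ ε hε).neg.mul_const _).add (((hD i j ε hε).add (hD j i ε hε)).const_mul μ)
    refine ⟨_, ⟨_, _, ht 1 e1, ht (-1) e2, rfl⟩, fun i => ?_⟩
    have h1 : ∀ i j, -Q 1 * (if i = j then (1 : ℝ) else 0) + μ * (D i j 1 + D j i 1) -
        (-Q (-1) * (if i = j then 1 else 0) + μ * (D i j (-1) + D j i (-1))) =
        -(σ * kappa f ξ) * (if i = j then 1 else 0) := fun i j => by
      linear_combination -(if i = j then (1 : ℝ) else 0) * hQJ + μ * hDJ i j + μ * hDJ j i
    simp only [Matrix.sub_apply, Matrix.of_apply, h1, mul_assoc, ite_mul, one_mul, zero_mul,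
      ← Finset.mul_sum, Finset.sum_ite_eq, Finset.mem_univ, if_true]
    ring

/-! ### Harmonic functions vanishing at infinity -/

lemma deriv_deriv_nonpos_of_isLocalMax {h : ℝ → ℝ} {a : ℝ} (hm : IsLocalMax h a)
    (hc : ContinuousAt h a) : deriv (deriv h) a ≤ 0 := by
  by_contra! hpos
  have hmin := isLocalMin_of_deriv_deriv_pos hpos hm.deriv_eq_zero hc
  have hconst : h =ᶠ[𝓝 a] fun _ => h a := by
    filter_upwards [hm, hmin] with t h1 h2 using le_antisymm h1 h2
  have h2 : deriv h =ᶠ[𝓝 a] deriv fun _ => h a := hconst.deriv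
  rw [h2.deriv_eq] at hpos
  simp at hpos

lemma pd_pd_nonpos_of_isLocalMax {h : Plane → ℝ} (hh : ContDiff ℝ 2 h) {z : Plane}
    (hm : IsLocalMax h z) (i : Fin 2) : pd i (pd i h) z ≤ 0 := by
  have hline : ∀ t : ℝ, HasDerivAt (fun t : ℝ => z + t • (EuclideanSpace.single i 1 : Plane))
      (EuclideanSpace.single i 1) t := fun t => by
    simpa using ((hasDerivAt_id t).smul_const (EuclideanSpace.single i (1 : ℝ))).const_add z
  have hd : Differentiable ℝ h := hh.differentiable (by norm_num)
  have hd2 : Differentiable ℝ (pd i h) := fun x =>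
    ((hh.fderiv_right (m := 1) (by norm_num)).differentiable (by norm_num) x).clm_apply
      (differentiableAt_const _)
  have h1 : deriv (fun t : ℝ => h (z + t • EuclideanSpace.single i 1)) =
      fun t => pd i h (z + t • EuclideanSpace.single i 1) := funext fun t =>
    ((hd _).hasFDerivAt.comp_hasDerivAt t (hline t)).deriv
  have h2 : deriv (fun t : ℝ => pd i h (z + t • EuclideanSpace.single i 1)) 0 =
      pd i (pd i h) z := by
    have := ((hd2 _).hasFDerivAt.comp_hasDerivAt (0 : ℝ) (hline 0)).deriv
    rw [zero_smul, add_zero] at this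
    exact this
  have hc : Continuous fun t : ℝ => z + t • (EuclideanSpace.single i 1 : Plane) := by fun_prop
  rw [← h2, ← h1]
  refine deriv_deriv_nonpos_of_isLocalMax ?_ (hd.continuous.comp hc).continuousAt
  have ht : Tendsto (fun t : ℝ => z + t • (EuclideanSpace.single i 1 : Plane)) (𝓝 0) (𝓝 z) := by
    simpa using hc.tendsto 0
  have := ht.eventually hm
  simpa [IsLocalMax, IsMaxFilter] using this

lemma pd_norm_sq (i : Fin 2) (y : Plane) : pd i (fun y : Plane => ‖y‖ ^ 2) y = 2 * y i := by
  rw [pd, fderiv_norm_sq_apply]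
  simp [EuclideanSpace.inner_single_right]

/-- If `u x₀ > 0`, then `u + ε |·|²` with a small `ε > 0` has a local maximum, where its Laplacian,
which is positive, would have to be nonpositive. -/
lemma nonpos_of_harmonic {u : Plane → ℝ} (hu : ContDiff ℝ 2 u)
    (hΔ : ∀ x, ∑ i, pd i (pd i u) x = 0) (h0 : Tendsto u (Bornology.cobounded Plane) (𝓝 0))
    (x₀ : Plane) : u x₀ ≤ 0 := by
  by_contra! hm
  have hev : ∀ᶠ x in Bornology.cobounded Plane, u x < u x₀ / 2 :=
    h0.eventually_lt_const (by linarith)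
  obtain ⟨R₁, hR₁⟩ := (hasBasis_cobounded_norm (E := Plane)).eventually_iff.1 hev
  obtain ⟨-, hR₁⟩ := hR₁
  set R := max R₁ (‖x₀‖ + 1) with hR
  have hRp : 0 < R := lt_of_lt_of_le (by positivity) (le_max_right _ _)
  -- on the sphere of radius `R` the sum `u + ε |·|²` is at most `3 u x₀ / 4 < u x₀`
  set ε := u x₀ / (4 * R ^ 2) with hε
  have hεp : 0 < ε := by positivity
  have hεR : ε * R ^ 2 = u x₀ / 4 := by rw [hε]; field_simp
  set h : Plane → ℝ := fun x => u x + ε * ‖x‖ ^ 2 with hh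
  have hhc : ContDiff ℝ 2 h := hu.add (contDiff_const.mul (contDiff_norm_sq ℝ))
  obtain ⟨z, hz, hzmax⟩ := (isCompact_closedBall (0 : Plane) R).exists_isMaxOn
    ⟨0, by simp [hRp.le]⟩ hhc.continuous.continuousOn
  rw [mem_closedBall_zero_iff] at hz
  have hx₀ : h x₀ ≤ h z := hzmax (by
    rw [mem_closedBall_zero_iff]; linarith [le_max_right R₁ (‖x₀‖ + 1)])
  have hx₀' : u x₀ ≤ h x₀ := by simp only [hh]; nlinarith [sq_nonneg ‖x₀‖]
  have hzR : ‖z‖ < R := by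
    refine lt_of_le_of_ne hz fun he => ?_
    have h1 : u z < u x₀ / 2 := hR₁ (by simp only [Set.mem_ofPred_eq]; rw [he]; exact le_max_left _ _)
    have h2 : h z = u z + u x₀ / 4 := by simp only [hh]; rw [he, hεR]
    linarith
  have hloc : IsLocalMax h z := hzmax.isLocalMax
    (mem_of_superset (Metric.isOpen_ball.mem_nhds (by rwa [mem_ball_zero_iff])) Metric.ball_subset_closedBall)
  have hsum := Finset.sum_nonpos fun i (_ : i ∈ Finset.univ) => pd_pd_nonpos_of_isLocalMax hhc hloc i
  have hd : Differentiable ℝ u := hu.differentiable (by norm_num)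
  have hd2 : ∀ i, Differentiable ℝ (pd i u) := fun i x =>
    ((hu.fderiv_right (m := 1) (by norm_num)).differentiable (by norm_num) x).clm_apply
      (differentiableAt_const _)
  have e1 : ∀ i, pd i h = fun x => pd i u x + ε * (2 * x i) := by
    intro i
    funext x
    have hn : DifferentiableAt ℝ (fun x : Plane => ‖x‖ ^ 2) x :=
      (contDiff_norm_sq ℝ (n := 1)).differentiable (by norm_num) x
    have := ((hd x).hasFDerivAt.fun_add (hn.hasFDerivAt.const_mul ε)).fderiv
    rw [← pd_norm_sq, pd, hh, this]; rfl
  have e2 : ∀ i, pd i (pd i h) z = pd i (pd i u) z + 2 * ε := by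
    intro i
    have hp : HasFDerivAt (fun x : Plane => ε * (2 * x i))
        (ε • (2 : ℝ) • (EuclideanSpace.proj i : Plane →L[ℝ] ℝ)) z :=
      ((EuclideanSpace.proj i : Plane →L[ℝ] ℝ).hasFDerivAt.const_mul 2).const_mul ε
    rw [e1, pd, ((hd2 i z).hasFDerivAt.fun_add hp).fderiv]
    simp [pd]
    ring
  simp only [e2, Finset.sum_add_distrib, hΔ] at hsum
  simp at hsum
  linarith

/-- The maximum principle for entire harmonic functions that vanish at infinity. -/
lemma eq_zero_of_harmonic {u : Plane → ℝ} (hu : ContDiff ℝ 2 u)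
    (hΔ : ∀ x, ∑ i, pd i (pd i u) x = 0) (h0 : Tendsto u (Bornology.cobounded Plane) (𝓝 0))
    (x : Plane) : u x = 0 := by
  refine le_antisymm (nonpos_of_harmonic hu hΔ h0 x) ?_
  have := nonpos_of_harmonic (u := fun x => -u x) hu.neg (fun x => by
    simp only [pd_neg, Finset.sum_neg_distrib, hΔ, neg_zero]) (by simpa using h0.neg) x
  linarith

/-! ### Mollification -/

/-- The convolution `∫ p(y) φ(x - y) dy`. -/
noncomputable def mol (p φ : Plane → ℝ) (x : Plane) : ℝ := ∫ y, p y * φ (x - y)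

lemma contDiff_pd {φ : Plane → ℝ} (hφ : ContDiff ℝ ∞ φ) (i : Fin 2) : ContDiff ℝ ∞ (pd i φ) :=
  (hφ.fderiv_right (m := ∞) (by simp)).clm_apply contDiff_const

lemma hasCompactSupport_pd {φ : Plane → ℝ} (hc : HasCompactSupport φ) (i : Fin 2) :
    HasCompactSupport (pd i φ) := hc.fderiv_apply ℝ _

lemma contDiff_mol {p φ : Plane → ℝ} (hp : LocallyIntegrable p) (hφ : ContDiff ℝ ∞ φ)
    (hc : HasCompactSupport φ) : ContDiff ℝ ∞ (mol p φ) :=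
  hc.contDiff_convolution_right (ContinuousLinearMap.mul ℝ ℝ) hp hφ

lemma pd_mol {p φ : Plane → ℝ} (hp : LocallyIntegrable p) (hφ : ContDiff ℝ ∞ φ)
    (hc : HasCompactSupport φ) (i : Fin 2) : pd i (mol p φ) = mol p (pd i φ) := by
  funext x
  have h1 : ContDiff ℝ 1 φ := hφ.of_le (by simp)
  have h := hc.hasFDerivAt_convolution_right (ContinuousLinearMap.mul ℝ ℝ) hp h1 x
  have h2 : fderiv ℝ (mol p φ) x = _ := h.fderiv
  rw [pd, h2]
  exact convolution_precompR_apply (ContinuousLinearMap.mul ℝ ℝ) hp (hc.fderiv ℝ)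
    (h1.continuous_fderiv (by norm_num)) x _

lemma integrable_mul_test {p φ : Plane → ℝ} (hp : LocallyIntegrable p) (hφ : Continuous φ)
    (hc : HasCompactSupport φ) : Integrable fun y => p y * φ y := by
  simpa [mul_comm] using hp.integrable_smul_left_of_hasCompactSupport hφ hc

lemma hasCompactSupport_comp_sub {φ : Plane → ℝ} (hc : HasCompactSupport φ) (x : Plane) :
    HasCompactSupport fun y => φ (x - y) :=
  hc.comp_homeomorph (Homeomorph.subLeft x)

/-- Mollification preserves decay at infinity. -/
lemma tendsto_mol {p φ : Plane → ℝ}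
    (hd : ∀ δ > 0, ∃ R, ∀ᵐ y : Plane, R ≤ ‖y‖ → |p y| ≤ δ) (hφ : ContDiff ℝ ∞ φ)
    (hc : HasCompactSupport φ) : Tendsto (mol p φ) (Bornology.cobounded Plane) (𝓝 0) := by
  have hφi : Integrable φ := hφ.continuous.integrable_of_hasCompactSupport hc
  obtain ⟨r, hr⟩ := hc.isCompact.isBounded.exists_norm_le
  have hI : 0 ≤ ∫ y, |φ y| := integral_nonneg fun y => abs_nonneg _
  rw [Metric.tendsto_nhds]
  intro η hη
  have hδ : 0 < η / (2 * ((∫ y, |φ y|) + 1)) := by positivity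
  obtain ⟨R, hR⟩ := hd _ hδ
  have hev : ∀ᶠ x : Plane in Bornology.cobounded Plane, R + r ≤ ‖x‖ :=
    tendsto_norm_cobounded_atTop.eventually_ge_atTop _
  filter_upwards [hev] with x hx
  rw [dist_zero_right]
  have hint : Integrable fun y => η / (2 * ((∫ y, |φ y|) + 1)) * |φ (x - y)| :=
    ((hφi.comp_sub_left x).abs).const_mul _
  have h1 : ‖mol p φ x‖ ≤ ∫ y, η / (2 * ((∫ y, |φ y|) + 1)) * |φ (x - y)| := by
    refine norm_integral_le_of_norm_le hint ?_
    filter_upwards [hR] with y hy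
    rw [norm_mul, Real.norm_eq_abs, Real.norm_eq_abs]
    by_cases h0 : φ (x - y) = 0
    · rw [h0]; simp
    · have h2 := hr _ (subset_tsupport _ h0)
      have h3 : R ≤ ‖y‖ := by linarith [norm_sub_norm_le x y]
      gcongr
      exact hy h3
  rw [integral_const_mul, integral_sub_left_eq_self (fun y => |φ y|) volume x] at h1
  refine h1.trans_lt ?_
  rw [div_mul_eq_mul_div, div_lt_iff₀ (by positivity)]
  nlinarith

/-! ### The divergence theorem across the graph -/

/-- The coordinates `(s, t) ↦ (s, f s + t)`, which flatten the graph and preserve the area. -/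
noncomputable def curv (f : ℝ → ℝ) (z : ℝ × ℝ) : Plane := !₂[z.1, f z.1 + z.2]

@[simp] lemma curv_zero (f : ℝ → ℝ) (z : ℝ × ℝ) : curv f z 0 = z.1 := by simp [curv]
@[simp] lemma curv_one (f : ℝ → ℝ) (z : ℝ × ℝ) : curv f z 1 = f z.1 + z.2 := by simp [curv]
@[simp] lemma gap_curv (f : ℝ → ℝ) (z : ℝ × ℝ) : gap f (curv f z) = z.2 := by simp [gap]

lemma curv_mk_zero (f : ℝ → ℝ) (s : ℝ) : curv f (s, 0) = Xi f s := by simp [curv, Xi]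

lemma continuous_curv {f : ℝ → ℝ} (hf : Continuous f) : Continuous (curv f) := by
  unfold curv; fun_prop

/-- `curv` as a homeomorphism. -/
noncomputable def curvHomeo {f : ℝ → ℝ} (hf : Continuous f) : ℝ × ℝ ≃ₜ Plane where
  toFun := curv f
  invFun x := (x 0, x 1 - f (x 0))
  left_inv z := by simp
  right_inv x := by ext i; fin_cases i <;> simp
  continuous_toFun := continuous_curv hf
  continuous_invFun := by fun_prop

lemma measurePreserving_curv {f : ℝ → ℝ} (hf : Continuous f) :
    MeasurePreserving (curv f) (volume : Measure (ℝ × ℝ)) volume := by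
  have h1 : MeasurePreserving (fun z : ℝ × ℝ => (z.1, f z.1 + z.2))
      (volume : Measure (ℝ × ℝ)) volume :=
    (MeasurePreserving.id (volume : Measure ℝ)).skew_product (g := fun s t => f s + t)
      (by fun_prop) (ae_of_all _ fun s => (measurePreserving_add_left volume (f s)).map_eq)
  have h2 := (volume_preserving_finTwoArrow ℝ).symm
  have h3 := PiLp.volume_preserving_toLp (Fin 2)
  exact (h3.comp (h2.comp h1))

lemma integral_comp_curv {f : ℝ → ℝ} (hf : Continuous f) (h : Plane → ℝ) :
    ∫ z, h (curv f z) = ∫ x, h x :=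
  (measurePreserving_curv hf).integral_comp (curvHomeo hf).measurableEmbedding h

lemma integrable_comp_curv {f : ℝ → ℝ} (hf : Continuous f) {h : Plane → ℝ} (hh : Integrable h) :
    Integrable fun z => h (curv f z) :=
  (measurePreserving_curv hf).integrable_comp_of_integrable hh

lemma ae_gap_ne_zero {f : ℝ → ℝ} (hf : Continuous f) : ∀ᵐ x : Plane, gap f x ≠ 0 := by
  have h : ∀ᵐ z : ℝ × ℝ, z.2 ≠ 0 :=
    Measure.quasiMeasurePreserving_snd.ae (Measure.ae_ne volume 0)
  rw [← (measurePreserving_curv hf).map_eq,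
    (curvHomeo hf).measurableEmbedding.ae_map_iff (f := curv f)]
  simpa using h

lemma mem_closure_side {f : ℝ → ℝ} {ε : ℝ} (hε : ε ^ 2 = 1) {x : Plane}
    (hx : 0 ≤ ε * gap f x) : x ∈ closure (side f ε) := by
  have hc : Continuous fun δ : ℝ => shift (ε * δ) x := by unfold shift; fun_prop
  have ht : Tendsto (fun δ : ℝ => shift (ε * δ) x) (𝓝[>] 0) (𝓝 x) := by
    have h0 : shift (ε * 0) x = x := by ext i; fin_cases i <;> simp
    simpa only [h0] using (hc.tendsto 0).mono_left nhdsWithin_le_nhds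
  refine mem_closure_of_tendsto ht ?_
  filter_upwards [self_mem_nhdsWithin] with δ hδ
  have hδ : 0 < δ := hδ
  change 0 < ε * gap f (shift (ε * δ) x)
  rw [gap_shift]
  nlinarith

lemma IsInterface.hasFDerivAt_curv {f : ℝ → ℝ} (hf : IsInterface f) (z : ℝ × ℝ) :
    HasFDerivAt (curv f)
      ((ContinuousLinearMap.fst ℝ ℝ ℝ).smulRight (EuclideanSpace.single 0 1 : Plane) +
        (deriv f z.1 • ContinuousLinearMap.fst ℝ ℝ ℝ + ContinuousLinearMap.snd ℝ ℝ ℝ).smulRight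
          (EuclideanSpace.single 1 1 : Plane)) z := by
  have e : curv f = fun z => z.1 • (EuclideanSpace.single 0 1 : Plane) +
      (f z.1 + z.2) • (EuclideanSpace.single 1 1 : Plane) := by
    funext z; ext i; fin_cases i <;> simp
  have h1 : HasFDerivAt (fun z : ℝ × ℝ => z.1) (ContinuousLinearMap.fst ℝ ℝ ℝ) z := hasFDerivAt_fst
  have h2 : HasFDerivAt (fun z : ℝ × ℝ => z.2) (ContinuousLinearMap.snd ℝ ℝ ℝ) z := hasFDerivAt_snd
  have h3 : HasFDerivAt (fun z : ℝ × ℝ => f z.1) (deriv f z.1 • ContinuousLinearMap.fst ℝ ℝ ℝ) z :=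
    (hf.hasDerivAt z.1).comp_hasFDerivAt z h1
  rw [e]
  exact (h1.smul_const _).fun_add ((h3.fun_add h2).smul_const _)

/-- The divergence theorem on one side of the graph for a field of compact support. -/
lemma IsInterface.gauss_side {f : ℝ → ℝ} (hf : IsInterface f) {ε : ℝ} (hε : ε ^ 2 = 1)
    {Y0 Y1 D : Plane → ℝ} (c0 : ContinuousOn Y0 (closure (side f ε)))
    (c1 : ContinuousOn Y1 (closure (side f ε))) (cD : ContinuousOn D (closure (side f ε)))
    (d0 : ∀ x ∈ side f ε, DifferentiableAt ℝ Y0 x) (d1 : ∀ x ∈ side f ε, DifferentiableAt ℝ Y1 x)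
    (hD : ∀ x ∈ side f ε, pd 0 Y0 x + pd 1 Y1 x = D x) {R : ℝ} (hR : 0 < R)
    (hs : ∀ z : ℝ × ℝ, (R ≤ |z.1| ∨ R ≤ |z.2|) → Y0 (curv f z) = 0 ∧ Y1 (curv f z) = 0) :
    ∫ s in (-R)..R, ∫ t in (0 : ℝ)..(ε * R), D (curv f (s, t)) =
      -∫ s in (-R)..R, (Y1 (Xi f s) - deriv f s * Y0 (Xi f s)) := by
  have habs := abs_eq_one_of_sq hε
  have hcl : ∀ z : ℝ × ℝ, 0 ≤ ε * z.2 → curv f z ∈ closure (side f ε) := fun z hz =>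
    mem_closure_side hε (by simpa using hz)
  have hbox : ∀ z : ℝ × ℝ, z.2 ∈ Set.uIcc 0 (ε * R) → 0 ≤ ε * z.2 := by
    intro z hz
    rcases (abs_eq zero_le_one).1 habs with rfl | rfl
    · rw [one_mul, Set.uIcc_of_le hR.le] at hz; simpa using hz.1
    · rw [neg_one_mul, Set.uIcc_of_ge (by linarith)] at hz; linarith [hz.2]
  have hin : ∀ t : ℝ, t ∈ Set.Ioo (min 0 (ε * R)) (max 0 (ε * R)) → 0 < ε * t := by
    intro t ht
    rcases (abs_eq zero_le_one).1 habs with rfl | rfl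
    · rw [one_mul, min_eq_left hR.le] at ht; simpa using ht.1
    · rw [neg_one_mul, max_eq_left (by linarith)] at ht; linarith [ht.2]
  set B : Set (ℝ × ℝ) := Set.uIcc (-R) R ×ˢ Set.uIcc 0 (ε * R) with hB
  have hmap : Set.MapsTo (curv f) B (closure (side f ε)) := fun z hz => hcl z (hbox z hz.2)
  have cc := (continuous_curv hf.continuous).continuousOn (s := B)
  set L : ℝ × ℝ → (ℝ × ℝ →L[ℝ] Plane) := fun z =>
    (ContinuousLinearMap.fst ℝ ℝ ℝ).smulRight (EuclideanSpace.single 0 1 : Plane) +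
        (deriv f z.1 • ContinuousLinearMap.fst ℝ ℝ ℝ + ContinuousLinearMap.snd ℝ ℝ ℝ).smulRight
          (EuclideanSpace.single 1 1 : Plane) with hL
  set G' : ℝ × ℝ → (ℝ × ℝ →L[ℝ] ℝ) := fun z => (fderiv ℝ Y1 (curv f z)).comp (L z) -
    (deriv f z.1 • (fderiv ℝ Y0 (curv f z)).comp (L z) +
      Y0 (curv f z) • (deriv (deriv f) z.1 • ContinuousLinearMap.fst ℝ ℝ ℝ)) with hG'
  have hsum : ∀ z : ℝ × ℝ, 0 < ε * z.2 →
      ((fderiv ℝ Y0 (curv f z)).comp (L z)) (1, 0) + G' z (0, 1) = D (curv f z) := by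
    intro z hz
    rw [← hD _ (show curv f z ∈ side f ε by simpa [side] using hz)]
    simp [hG', hL, pd]
  have hne : ∀ᵐ z : ℝ × ℝ, z.2 ≠ 0 :=
    Measure.quasiMeasurePreserving_snd.ae (Measure.ae_ne volume 0)
  have hpos : ∀ t : ℝ, t ≠ 0 → 0 ≤ ε * t → 0 < ε * t := fun t h0 h =>
    lt_of_le_of_ne h (Ne.symm (mul_ne_zero (fun h => by simp [h] at hε) h0))
  -- in the flattened coordinates the divergence is `∂ₛ Y₀ + ∂ₜ (Y₁ - f' Y₀)`; on the edge `t = 0` the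
  -- second component is the normal one, and the other three edges do not meet the support
  have key := integral2_divergence_prod_of_hasFDerivAt (fun z => Y0 (curv f z))
    (fun z => Y1 (curv f z) - deriv f z.1 * Y0 (curv f z))
    (fun z => (fderiv ℝ Y0 (curv f z)).comp (L z)) G' (-R) 0 R (ε * R) (c0.comp cc hmap)
    ((c1.comp cc hmap).sub (((hf.continuous_deriv.comp continuous_fst).continuousOn).mul
      (c0.comp cc hmap))) ?_ ?_ ?_
  · have e1 : (∫ s in (-R)..R, ∫ t in (0 : ℝ)..(ε * R),
        ((fderiv ℝ Y0 (curv f (s, t))).comp (L (s, t))) (1, 0) + G' (s, t) (0, 1)) =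
        ∫ s in (-R)..R, ∫ t in (0 : ℝ)..(ε * R), D (curv f (s, t)) := by
      refine intervalIntegral.integral_congr fun s _ => ?_
      refine intervalIntegral.integral_congr_ae ?_
      filter_upwards [Measure.ae_ne volume (0 : ℝ)] with t ht hmem
      exact hsum (s, t) (hpos t ht (hbox (s, t) (Set.uIoc_subset_uIcc hmem)))
    rw [← e1, key]
    have z1 : ∀ s, Y1 (curv f (s, ε * R)) - deriv f s * Y0 (curv f (s, ε * R)) = 0 := by
      intro s
      obtain ⟨h0, h1⟩ := hs (s, ε * R) (Or.inr (by
        rw [abs_mul, habs, one_mul]; exact le_abs_self R))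
      rw [h0, h1]; ring
    have z2 : ∀ t, Y0 (curv f (R, t)) = 0 := fun t => (hs (R, t) (Or.inl (le_abs_self R))).1
    have z3 : ∀ t, Y0 (curv f (-R, t)) = 0 := fun t =>
      (hs (-R, t) (Or.inl (by rw [abs_neg]; exact le_abs_self R))).1
    simp only [z1, z2, z3, intervalIntegral.integral_zero, curv_mk_zero]
    ring
  · intro z hz
    have hm : curv f z ∈ side f ε := by simpa [side] using hin z.2 hz.2
    exact (d0 _ hm).hasFDerivAt.comp z (hf.hasFDerivAt_curv z)
  · intro z hz
    have hm : curv f z ∈ side f ε := by simpa [side] using hin z.2 hz.2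
    have h3 : HasFDerivAt (fun z : ℝ × ℝ => deriv f z.1)
        (deriv (deriv f) z.1 • ContinuousLinearMap.fst ℝ ℝ ℝ) z :=
      (hf.hasDerivAt_deriv z.1).comp_hasFDerivAt z hasFDerivAt_fst
    exact ((d1 _ hm).hasFDerivAt.comp z (hf.hasFDerivAt_curv z)).fun_sub
      (h3.fun_mul ((d0 _ hm).hasFDerivAt.comp z (hf.hasFDerivAt_curv z)))
  · have hDi : IntegrableOn (fun z => D (curv f z)) B :=
      (cD.comp cc hmap).integrableOn_compact (isCompact_uIcc.prod isCompact_uIcc)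
    refine hDi.congr_fun_ae ?_
    filter_upwards [ae_restrict_mem (measurableSet_uIcc.prod measurableSet_uIcc),
      ae_restrict_of_ae hne] with z hz h0
    exact (hsum z (hpos z.2 h0 (hbox z hz.2))).symm

/-- The divergence theorem for fields that are piecewise smooth with respect to the graph: the
divergence of a compactly supported field whose normal component does not jump has integral zero. -/
lemma IsInterface.integral_divergence_eq_zero {f : ℝ → ℝ} (hf : IsInterface f)
    {Y0 Y1 D : ℝ → Plane → ℝ}
    (c0 : ∀ ε, ε ^ 2 = 1 → ContinuousOn (Y0 ε) (closure (side f ε)))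
    (c1 : ∀ ε, ε ^ 2 = 1 → ContinuousOn (Y1 ε) (closure (side f ε)))
    (cD : ∀ ε, ε ^ 2 = 1 → ContinuousOn (D ε) (closure (side f ε)))
    (d0 : ∀ ε, ε ^ 2 = 1 → ∀ x ∈ side f ε, DifferentiableAt ℝ (Y0 ε) x)
    (d1 : ∀ ε, ε ^ 2 = 1 → ∀ x ∈ side f ε, DifferentiableAt ℝ (Y1 ε) x)
    (hD : ∀ ε, ε ^ 2 = 1 → ∀ x ∈ side f ε, pd 0 (Y0 ε) x + pd 1 (Y1 ε) x = D ε x)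
    (hJ : ∀ s, Y1 1 (Xi f s) - deriv f s * Y0 1 (Xi f s) =
      Y1 (-1) (Xi f s) - deriv f s * Y0 (-1) (Xi f s))
    {E : Plane → ℝ} (hE : Integrable E) (hED : ∀ ε, ε ^ 2 = 1 → ∀ x ∈ side f ε, E x = D ε x)
    {r : ℝ} (hs : ∀ x : Plane, r ≤ ‖x‖ → E x = 0 ∧ ∀ ε, Y0 ε x = 0 ∧ Y1 ε x = 0) :
    ∫ x, E x = 0 := by
  have e1 : (1 : ℝ) ^ 2 = 1 := by norm_num
  have e2 : (-1 : ℝ) ^ 2 = 1 := by norm_num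
  -- a box in the flattened coordinates that contains the support
  obtain ⟨R, hR, hbox⟩ : ∃ R : ℝ, 0 < R ∧ ∀ z : ℝ × ℝ, (R ≤ |z.1| ∨ R ≤ |z.2|) → r ≤ ‖curv f z‖ := by
    obtain ⟨Λ, hΛ, -, -, hLip⟩ := hf.exists_bound
    refine ⟨|r| + (|r| + |f 0| + Λ * |r|) + 1, by positivity, fun z hz => ?_⟩
    by_contra! hlt
    have a0 : |z.1| ≤ ‖curv f z‖ := by
      simpa using PiLp.norm_apply_le (curv f z) 0
    have a1 : |f z.1 + z.2| ≤ ‖curv f z‖ := by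
      simpa using PiLp.norm_apply_le (curv f z) 1
    have hr := le_abs_self r
    have b1 : |z.2| ≤ |f z.1 + z.2| + |f z.1| := by
      have : z.2 = (f z.1 + z.2) - f z.1 := by ring
      rw [this]; simpa using abs_sub (f z.1 + z.2) (f z.1)
    have b2 : |f z.1| ≤ |f 0| + Λ * |z.1| := by
      have h := hLip z.1 0
      rw [sub_zero] at h
      have : f z.1 = f 0 + (f z.1 - f 0) := by ring
      calc |f z.1| ≤ |f 0| + |f z.1 - f 0| := by conv_lhs => rw [this]
                                                 exact abs_add_le _ _
        _ ≤ _ := by linarith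
    have b3 : Λ * |z.1| ≤ Λ * |r| := mul_le_mul_of_nonneg_left (by linarith) hΛ
    have b4 := abs_nonneg (f 0)
    have b5 : 0 ≤ Λ * |r| := by positivity
    rcases hz with hz | hz <;> linarith [abs_nonneg r]
  have hEi := integrable_comp_curv hf.continuous hE
  have hne : ∀ᵐ z : ℝ × ℝ, z.2 ≠ 0 :=
    Measure.quasiMeasurePreserving_snd.ae (Measure.ae_ne volume 0)
  -- the contributions of the two sides
  let F : ℝ → ℝ × ℝ → ℝ := fun ε => {z : ℝ × ℝ | 0 < ε * z.2}.indicator fun z => E (curv f z)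
  have hmeas : ∀ ε : ℝ, MeasurableSet {z : ℝ × ℝ | 0 < ε * z.2} := fun ε =>
    (isOpen_lt continuous_const (by fun_prop)).measurableSet
  have hFi : ∀ ε, Integrable (F ε) := fun ε => hEi.indicator (hmeas ε)
  have hF0 : ∀ ε (z : ℝ × ℝ), (R ≤ |z.1| ∨ R ≤ |z.2|) → F ε z = 0 := fun ε z hz => by
    have := (hs _ (hbox z hz)).1
    simp only [F, Set.indicator_apply, this, ite_self]
  have hsplit : ∫ x, E x = (∫ z, F 1 z) + ∫ z, F (-1) z := by
    rw [← integral_comp_curv hf.continuous, ← integral_add (hFi 1) (hFi (-1))]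
    refine integral_congr_ae ?_
    filter_upwards [hne] with z hz
    rcases lt_or_gt_of_ne hz with h | h
    · simp [F, h, not_lt.2 h.le]
    · simp [F, h, not_lt.2 h.le]
  have houter : ∀ ε, ∫ z, F ε z = ∫ s in (-R)..R, ∫ t, F ε (s, t) := by
    intro ε
    rw [Measure.volume_eq_prod, integral_prod _ (hFi ε)]
    refine (intervalIntegral.integral_eq_integral_of_support_subset fun s hs' => ?_).symm
    have : |s| < R := by
      by_contra! h
      exact hs' (integral_eq_zero_of_ae (ae_of_all _ fun t => hF0 ε (s, t) (Or.inl h)))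
    exact ⟨(abs_lt.1 this).1, (abs_lt.1 this).2.le⟩
  have hpos : ∀ s, ∫ t, F 1 (s, t) = ∫ t in (0 : ℝ)..(1 * R), D 1 (curv f (s, t)) := by
    intro s
    rw [← intervalIntegral.integral_eq_integral_of_support_subset (a := 0) (b := 1 * R)]
    · refine intervalIntegral.integral_congr_ae (ae_of_all _ fun t ht => ?_)
      rw [one_mul, Set.uIoc_of_le hR.le] at ht
      have h1 : 0 < 1 * t := by linarith [ht.1]
      simp only [F]
      rw [Set.indicator_of_mem (show (s, t) ∈ {z : ℝ × ℝ | 0 < 1 * z.2} from h1)]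
      exact hED 1 e1 _ (by simpa [side] using h1)
    · intro t ht
      have h1 : (s, t) ∈ {z : ℝ × ℝ | 0 < 1 * z.2} := by
        by_contra h
        exact ht (Set.indicator_of_notMem h _)
      have h2 : |t| < R := by
        by_contra! h
        exact ht (hF0 1 (s, t) (Or.inr h))
      have h1 : 0 < 1 * t := h1
      rw [one_mul] at h1 ⊢
      exact ⟨h1, (abs_lt.1 h2).2.le⟩
  have hneg : ∀ s, ∫ t, F (-1) (s, t) = -∫ t in (0 : ℝ)..(-1 * R), D (-1) (curv f (s, t)) := by
    intro s
    rw [← intervalIntegral.integral_symm,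
      ← intervalIntegral.integral_eq_integral_of_support_subset (a := -1 * R) (b := 0)]
    · refine intervalIntegral.integral_congr_ae ?_
      filter_upwards [Measure.ae_ne volume (0 : ℝ)] with t h0 ht
      rw [neg_one_mul, Set.uIoc_of_le (by linarith)] at ht
      have h1 : 0 < -1 * t := by linarith [lt_of_le_of_ne ht.2 h0]
      simp only [F]
      rw [Set.indicator_of_mem (show (s, t) ∈ {z : ℝ × ℝ | 0 < -1 * z.2} from h1)]
      exact hED (-1) e2 _ (by simpa [side] using h1)
    · intro t ht
      have h1 : (s, t) ∈ {z : ℝ × ℝ | 0 < -1 * z.2} := by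
        by_contra h
        exact ht (Set.indicator_of_notMem h _)
      have h2 : |t| < R := by
        by_contra! h
        exact ht (hF0 (-1) (s, t) (Or.inr h))
      have h1 : 0 < -1 * t := h1
      rw [neg_one_mul] at h1 ⊢
      exact ⟨(abs_lt.1 h2).1, by linarith⟩
  have hg : ∀ ε, ε ^ 2 = 1 → ∫ s in (-R)..R, ∫ t in (0 : ℝ)..(ε * R), D ε (curv f (s, t)) =
      -∫ s in (-R)..R, (Y1 ε (Xi f s) - deriv f s * Y0 ε (Xi f s)) := fun ε hε =>
    hf.gauss_side hε (c0 ε hε) (c1 ε hε) (cD ε hε) (d0 ε hε) (d1 ε hε) (hD ε hε) hR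
      fun z hz => (hs _ (hbox z hz)).2 ε
  rw [hsplit, houter, houter]
  simp only [hpos, hneg, intervalIntegral.integral_neg]
  rw [hg 1 e1, hg (-1) e2]
  simp only [hJ]
  ring

/-! ### Flows without surface forces -/

/-- The components of two Stokes flows on the sides `ε = ±1` of the graph, of their gradients
`G ε i j = ∂ᵢ Wⱼ` and of their pressures, extended continuously to the graph, such that neither the
velocity nor the normal stress jumps there. -/
structure BrokenFlow (f : ℝ → ℝ) (μ : ℝ) (W : ℝ → Fin 2 → Plane → ℝ)
    (G : ℝ → Fin 2 → Fin 2 → Plane → ℝ) (Q : ℝ → Plane → ℝ) : Prop where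
  continuousOn_W : ∀ ε, ε ^ 2 = 1 → ∀ j, ContinuousOn (W ε j) (closure (side f ε))
  continuousOn_G : ∀ ε, ε ^ 2 = 1 → ∀ i j, ContinuousOn (G ε i j) (closure (side f ε))
  continuousOn_Q : ∀ ε, ε ^ 2 = 1 → ContinuousOn (Q ε) (closure (side f ε))
  differentiableAt_W : ∀ ε, ε ^ 2 = 1 → ∀ j, ∀ x ∈ side f ε, DifferentiableAt ℝ (W ε j) x
  differentiableAt_G : ∀ ε, ε ^ 2 = 1 → ∀ i j, ∀ x ∈ side f ε, DifferentiableAt ℝ (G ε i j) x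
  differentiableAt_Q : ∀ ε, ε ^ 2 = 1 → ∀ x ∈ side f ε, DifferentiableAt ℝ (Q ε) x
  pd_W : ∀ ε, ε ^ 2 = 1 → ∀ i j, ∀ x ∈ side f ε, pd i (W ε j) x = G ε i j x
  pd_G_comm : ∀ ε, ε ^ 2 = 1 → ∀ i j k, ∀ x ∈ side f ε, pd i (G ε j k) x = pd j (G ε i k) x
  momentum : ∀ ε, ε ^ 2 = 1 → ∀ j, ∀ x ∈ side f ε, μ * ∑ i, pd i (G ε i j) x = pd j (Q ε) x
  incompressible : ∀ ε, ε ^ 2 = 1 → ∀ x ∈ side f ε, ∑ i, G ε i i x = 0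
  velocity_jump : ∀ j s, W 1 j (Xi f s) = W (-1) j (Xi f s)
  /-- The vector `(-f', 1)` is normal to the graph. -/
  stress_jump : ∀ j s, ∑ i, ![-deriv f s, 1] i * (-Q 1 (Xi f s) * (if i = j then 1 else 0) +
      μ * (G 1 i j (Xi f s) + G 1 j i (Xi f s))) =
    ∑ i, ![-deriv f s, 1] i * (-Q (-1) (Xi f s) * (if i = j then 1 else 0) +
      μ * (G (-1) i j (Xi f s) + G (-1) j i (Xi f s)))
  decay_W : ∀ ε, ε ^ 2 = 1 → ∀ j, Tendsto (W ε j) (Bornology.cobounded Plane ⊓ 𝓟 (side f ε)) (𝓝 0)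
  decay_Q : ∀ ε, ε ^ 2 = 1 → Tendsto (Q ε) (Bornology.cobounded Plane ⊓ 𝓟 (side f ε)) (𝓝 0)

open Classical in
/-- The function on the plane with the given restrictions to the two sides of the graph. -/
noncomputable def glue (f : ℝ → ℝ) (u : ℝ → Plane → ℝ) (x : Plane) : ℝ :=
  if 0 < gap f x then u 1 x else u (-1) x

lemma glue_eq {f : ℝ → ℝ} (u : ℝ → Plane → ℝ) {ε : ℝ} (hε : ε ^ 2 = 1) {x : Plane}
    (hx : x ∈ side f ε) : glue f u x = u ε x := by
  have hx : 0 < ε * gap f x := hx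
  rcases (abs_eq zero_le_one).1 (abs_eq_one_of_sq hε) with rfl | rfl
  · rw [glue, if_pos (by linarith)]
  · rw [glue, if_neg (by linarith)]

lemma locallyIntegrable_glue {f : ℝ → ℝ} (hf : Continuous f) {u : ℝ → Plane → ℝ}
    (hu : ∀ ε, ε ^ 2 = 1 → ContinuousOn (u ε) (closure (side f ε))) :
    LocallyIntegrable (glue f u) := by
  rw [locallyIntegrable_iff]
  intro K hK
  have hm : MeasurableSet {x | 0 < gap f x} :=
    (isOpen_lt continuous_const (continuous_gap hf)).measurableSet
  have key : ∀ ε, ε ^ 2 = 1 → IntegrableOn (u ε) (K ∩ {x | 0 ≤ ε * gap f x}) := fun ε hε =>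
    ((hu ε hε).mono fun x hx => mem_closure_side hε hx.2).integrableOn_compact
      (hK.inter_right (isClosed_le continuous_const (continuous_const.mul (continuous_gap hf))))
  have h1 : IntegrableOn (glue f u) (K ∩ {x | 0 < gap f x}) :=
    ((key 1 (by norm_num)).mono_set fun x hx => ⟨hx.1, by
      have : 0 < gap f x := hx.2
      simp [this.le]⟩).congr_fun (fun x hx => by
        exact (if_pos hx.2).symm) (hK.measurableSet.inter hm)
  have h2 : IntegrableOn (glue f u) (K \ {x | 0 < gap f x}) :=
    ((key (-1) (by norm_num)).mono_set fun x hx => ⟨hx.1, by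
      have : gap f x ≤ 0 := not_lt.1 hx.2
      simpa using this⟩).congr_fun (fun x hx => by
        exact (if_neg hx.2).symm) (hK.measurableSet.diff hm)
  rw [← Set.inter_union_sdiff K {x | 0 < gap f x}]
  exact h1.union h2

lemma glue_decay {f : ℝ → ℝ} (hf : Continuous f) {u : ℝ → Plane → ℝ}
    (hu : ∀ ε, ε ^ 2 = 1 → Tendsto (u ε) (Bornology.cobounded Plane ⊓ 𝓟 (side f ε)) (𝓝 0))
    (δ : ℝ) (hδ : 0 < δ) : ∃ R, ∀ᵐ y : Plane, R ≤ ‖y‖ → |glue f u y| ≤ δ := by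
  have key : ∀ ε, ε ^ 2 = 1 → ∃ R, ∀ y ∈ side f ε, R ≤ ‖y‖ → |u ε y| ≤ δ := by
    intro ε hε
    have h := (hu ε hε).abs.eventually_le_const (v := |(0 : ℝ)|) (u := δ) (by simpa using hδ)
    rw [eventually_inf_principal] at h
    obtain ⟨R, -, hR⟩ := (hasBasis_cobounded_norm (E := Plane)).eventually_iff.1 h
    exact ⟨R, fun y hy hn => hR hn hy⟩
  obtain ⟨R1, h1⟩ := key 1 (by norm_num)
  obtain ⟨R2, h2⟩ := key (-1) (by norm_num)
  refine ⟨max R1 R2, ?_⟩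
  filter_upwards [ae_gap_ne_zero hf] with y hy hn
  rcases lt_or_gt_of_ne hy with h | h
  · have hm : y ∈ side f (-1) := by simpa [side] using h
    rw [glue_eq u (by norm_num) hm]
    exact h2 y hm ((le_max_right _ _).trans hn)
  · have hm : y ∈ side f 1 := by simpa [side] using h
    rw [glue_eq u (by norm_num) hm]
    exact h1 y hm ((le_max_left _ _).trans hn)

lemma notMem_tsupport_pd {φ : Plane → ℝ} {x : Plane} (hx : x ∉ tsupport φ) (i : Fin 2) :
    x ∉ tsupport (pd i φ) := fun h => hx (tsupport_fderiv_apply_subset ℝ _ h)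

lemma exists_radius {ψ : Plane → ℝ} (hc : HasCompactSupport ψ) :
    ∃ r, ∀ x : Plane, r ≤ ‖x‖ → ψ x = 0 ∧ (∀ i, pd i ψ x = 0) ∧ ∀ i j, pd i (pd j ψ) x = 0 := by
  obtain ⟨r, hr⟩ := hc.isCompact.isBounded.exists_norm_le
  refine ⟨r + 1, fun x hx => ?_⟩
  have h0 : x ∉ tsupport ψ := fun h => by linarith [hr x h]
  have h1 := fun i => notMem_tsupport_pd h0 i
  exact ⟨image_eq_zero_of_notMem_tsupport h0, fun i => image_eq_zero_of_notMem_tsupport (h1 i),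
    fun i j => image_eq_zero_of_notMem_tsupport (notMem_tsupport_pd (h1 j) i)⟩

lemma differentiable_test {ψ : Plane → ℝ} (hψ : ContDiff ℝ ∞ ψ) : Differentiable ℝ ψ :=
  hψ.differentiable (by simp)

/-- The glued velocity is weakly solenoidal. -/
lemma BrokenFlow.weak_divergence {f : ℝ → ℝ} (hf : IsInterface f) {μ : ℝ}
    {W : ℝ → Fin 2 → Plane → ℝ} {G : ℝ → Fin 2 → Fin 2 → Plane → ℝ} {Q : ℝ → Plane → ℝ}
    (h : BrokenFlow f μ W G Q) {ψ : Plane → ℝ} (hψ : ContDiff ℝ ∞ ψ) (hc : HasCompactSupport ψ) :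
    ∫ x, ∑ i, glue f (fun ε => W ε i) x * pd i ψ x = 0 := by
  obtain ⟨r, hr⟩ := exists_radius hc
  have hψd := differentiable_test hψ
  have cψ : ∀ ε, ContinuousOn ψ (closure (side f ε)) := fun ε => hψ.continuous.continuousOn
  have cψ' : ∀ i ε, ContinuousOn (pd i ψ) (closure (side f ε)) := fun i ε =>
    (contDiff_pd hψ i).continuous.continuousOn
  refine hf.integral_divergence_eq_zero (Y0 := fun ε x => W ε 0 x * ψ x)
    (Y1 := fun ε x => W ε 1 x * ψ x) (D := fun ε x => ∑ i, W ε i x * pd i ψ x)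
    (fun ε hε => (h.continuousOn_W ε hε 0).mul (cψ ε))
    (fun ε hε => (h.continuousOn_W ε hε 1).mul (cψ ε))
    (fun ε hε => continuousOn_finsetSum _ fun i _ => (h.continuousOn_W ε hε i).mul (cψ' i ε))
    (fun ε hε x hx => (h.differentiableAt_W ε hε 0 x hx).mul (hψd x))
    (fun ε hε x hx => (h.differentiableAt_W ε hε 1 x hx).mul (hψd x)) ?_ ?_ ?_ ?_ (r := r) ?_
  · intro ε hε x hx
    have e : ∀ i, pd i (fun x => W ε i x * ψ x) x = W ε i x * pd i ψ x + ψ x * G ε i i x := by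
      intro i
      rw [pd, ((h.differentiableAt_W ε hε i x hx).hasFDerivAt.fun_mul (hψd x).hasFDerivAt).fderiv,
        ← h.pd_W ε hε i i x hx]
      simp [pd]
    have hd := h.incompressible ε hε x hx
    rw [Fin.sum_univ_two] at hd ⊢
    rw [e, e]
    linear_combination ψ x * hd
  · intro s
    simp only [h.velocity_jump]
  · exact integrable_finsetSum _ fun i _ => integrable_mul_test
      (locallyIntegrable_glue hf.continuous fun ε hε => h.continuousOn_W ε hε i)
      (contDiff_pd hψ i).continuous (hasCompactSupport_pd hc i)
  · intro ε hε x hx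
    simp only [glue_eq (fun ε => W ε _) hε hx]
  · intro x hx
    obtain ⟨h0, h1, -⟩ := hr x hx
    simp [h0, h1]

/-- The glued flow satisfies the momentum equation weakly. -/
lemma BrokenFlow.weak_momentum {f : ℝ → ℝ} (hf : IsInterface f) {μ : ℝ}
    {W : ℝ → Fin 2 → Plane → ℝ} {G : ℝ → Fin 2 → Fin 2 → Plane → ℝ} {Q : ℝ → Plane → ℝ}
    (h : BrokenFlow f μ W G Q) {ψ : Plane → ℝ} (hψ : ContDiff ℝ ∞ ψ) (hc : HasCompactSupport ψ)
    (j : Fin 2) :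
    ∫ x, (glue f Q x * pd j ψ x + μ * ∑ i, glue f (fun ε => W ε j) x * pd i (pd i ψ) x) = 0 := by
  obtain ⟨r, hr⟩ := exists_radius hc
  have hψd := differentiable_test hψ
  have hψd' : ∀ i, Differentiable ℝ (pd i ψ) := fun i => differentiable_test (contDiff_pd hψ i)
  have cψ : ∀ ε, ContinuousOn ψ (closure (side f ε)) := fun ε => hψ.continuous.continuousOn
  have cψ' : ∀ i ε, ContinuousOn (pd i ψ) (closure (side f ε)) := fun i ε =>
    (contDiff_pd hψ i).continuous.continuousOn
  have cψ'' : ∀ i ε, ContinuousOn (pd i (pd i ψ)) (closure (side f ε)) := fun i ε =>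
    (contDiff_pd (contDiff_pd hψ i) i).continuous.continuousOn
  -- the stress applied to the test field, corrected by terms with continuous normal component so
  -- that no derivative of the velocity remains in the divergence
  let Y : Fin 2 → ℝ → Plane → ℝ := fun i ε x =>
    -((-Q ε x * (if i = j then 1 else 0) + μ * (G ε i j x + G ε j i x)) * ψ x
      - μ * (W ε j x * pd i ψ x)
      - μ * (if i = j then 1 else 0) * (W ε 0 x * pd 0 ψ x + W ε 1 x * pd 1 ψ x)
      + μ * (W ε i x * pd j ψ x))
  have cY : ∀ i ε, ε ^ 2 = 1 → ContinuousOn (Y i ε) (closure (side f ε)) := by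
    intro i ε hε
    have a1 := h.continuousOn_W ε hε
    have a2 := h.continuousOn_G ε hε
    have a3 := h.continuousOn_Q ε hε
    have b1 := cψ ε
    have b2 := fun i => cψ' i ε
    exact (((((a3.neg.mul continuousOn_const).add (continuousOn_const.mul
      ((a2 i j).add (a2 j i)))).mul b1).sub (continuousOn_const.mul ((a1 j).mul (b2 i)))).sub
      (continuousOn_const.mul (((a1 0).mul (b2 0)).add ((a1 1).mul (b2 1))))).add
      (continuousOn_const.mul ((a1 i).mul (b2 j))) |>.neg
  have a1 := fun (ε : ℝ) (hε : ε ^ 2 = 1) j (x : Plane) (hx : x ∈ side f ε) =>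
    (h.differentiableAt_W ε hε j x hx).hasFDerivAt
  have a2 := fun (ε : ℝ) (hε : ε ^ 2 = 1) i j (x : Plane) (hx : x ∈ side f ε) =>
    (h.differentiableAt_G ε hε i j x hx).hasFDerivAt
  have a3 := fun (ε : ℝ) (hε : ε ^ 2 = 1) (x : Plane) (hx : x ∈ side f ε) =>
    (h.differentiableAt_Q ε hε x hx).hasFDerivAt
  have b1 := fun x => (hψd x).hasFDerivAt
  have b2 := fun i x => (hψd' i x).hasFDerivAt
  have dY := fun (i : Fin 2) (ε : ℝ) (hε : ε ^ 2 = 1) (x : Plane) (hx : x ∈ side f ε) =>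
    ((((((a3 ε hε x hx).fun_neg.mul_const (if i = j then (1 : ℝ) else 0)).fun_add
      (((a2 ε hε i j x hx).fun_add (a2 ε hε j i x hx)).const_mul μ)).fun_mul (b1 x)).fun_sub
      (((a1 ε hε j x hx).fun_mul (b2 i x)).const_mul μ)).fun_sub
      ((((a1 ε hε 0 x hx).fun_mul (b2 0 x)).fun_add ((a1 ε hε 1 x hx).fun_mul (b2 1 x))).const_mul
        (μ * (if i = j then (1 : ℝ) else 0)))).fun_add
      (((a1 ε hε i x hx).fun_mul (b2 j x)).const_mul μ) |>.fun_neg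
  refine hf.integral_divergence_eq_zero (Y0 := Y 0) (Y1 := Y 1)
    (D := fun ε x => Q ε x * pd j ψ x + μ * ∑ i, W ε j x * pd i (pd i ψ) x)
    (cY 0) (cY 1) (fun ε hε => ((h.continuousOn_Q ε hε).mul (cψ' j ε)).add
      (continuousOn_const.mul (continuousOn_finsetSum _ fun i _ =>
        (h.continuousOn_W ε hε j).mul (cψ'' i ε))))
    (fun ε hε x hx => (dY 0 ε hε x hx).differentiableAt)
    (fun ε hε x hx => (dY 1 ε hε x hx).differentiableAt) ?_ ?_ ?_ ?_ (r := r) ?_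
  · intro ε hε x hx
    have p0 : pd 0 (Y 0 ε) x = _ := congrArg (fun L => L (EuclideanSpace.single 0 1))
      (dY 0 ε hε x hx).fderiv
    have p1 : pd 1 (Y 1 ε) x = _ := congrArg (fun L => L (EuclideanSpace.single 1 1))
      (dY 1 ε hε x hx).fderiv
    have hW : ∀ i j, fderiv ℝ (W ε j) x (EuclideanSpace.single i 1) = G ε i j x := fun i j =>
      h.pd_W ε hε i j x hx
    have hd := h.incompressible ε hε x hx
    have hm := h.momentum ε hε j x hx
    have hs0 := h.pd_G_comm ε hε 0 j 0 x hx
    have hs1 := h.pd_G_comm ε hε 1 j 1 x hx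
    have hd' : pd j (G ε 0 0) x + pd j (G ε 1 1) x = 0 := by
      have e := pd_congr_on (u := fun x => G ε 0 0 x + G ε 1 1 x) (v := fun _ => 0)
        (isOpen_side hf.continuous ε) (fun y hy => by
          simpa [Fin.sum_univ_two] using h.incompressible ε hε y hy) j hx
      rw [pd_add (h.differentiableAt_G ε hε 0 0 x hx) (h.differentiableAt_G ε hε 1 1 x hx)] at e
      rw [e, pd]; simp
    have hψc := pd_comm ((hψ.of_le ENat.LEInfty.out : ContDiff ℝ 2 ψ).contDiffAt (x := x)) 0 1
    simp only [Fin.sum_univ_two] at hd hm ⊢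
    rw [p0, p1]
    simp only [add_apply, sub_apply, neg_apply, smul_apply, smul_eq_mul, hW]
    simp only [pd] at hm hs0 hs1 hd' hψc ⊢
    obtain rfl | rfl : j = 0 ∨ j = 1 := by omega
    · simp only [if_true, one_ne_zero, if_false]
      linear_combination -(ψ x) * hm - μ * ψ x * (hs0 + hs1 + hd') -
        μ * fderiv ℝ ψ x (EuclideanSpace.single 0 1) * hd + μ * W ε 1 x * hψc
    · simp only [if_true, zero_ne_one, if_false]
      linear_combination -(ψ x) * hm - μ * ψ x * (hs0 + hs1 + hd') -
        μ * fderiv ℝ ψ x (EuclideanSpace.single 1 1) * hd - μ * W ε 0 x * hψc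
  · intro s
    have hT := h.stress_jump j s
    simp only [Fin.sum_univ_two, Matrix.cons_val_zero, Matrix.cons_val_one] at hT
    simp only [Y, h.velocity_jump]
    linear_combination -ψ (Xi f s) * hT
  · refine (integrable_mul_test (locallyIntegrable_glue hf.continuous h.continuousOn_Q)
      (contDiff_pd hψ j).continuous (hasCompactSupport_pd hc j)).add
      ((integrable_finsetSum _ fun i _ => integrable_mul_test
      (locallyIntegrable_glue hf.continuous fun ε hε => h.continuousOn_W ε hε j)
      (contDiff_pd (contDiff_pd hψ i) i).continuous
      (hasCompactSupport_pd (hasCompactSupport_pd hc i) i)).const_mul μ)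
  · intro ε hε x hx
    simp only [glue_eq (fun ε => W ε _) hε hx, glue_eq Q hε hx]
  · intro x hx
    obtain ⟨h0, h1, h2⟩ := hr x hx
    simp [Y, h0, h1, h2]

lemma pd_comp_sub {φ : Plane → ℝ} (hφ : Differentiable ℝ φ) (x : Plane) (i : Fin 2) :
    pd i (fun y => φ (x - y)) = fun y => -pd i φ (x - y) := by
  funext y
  have h := (hφ (x - y)).hasFDerivAt.comp y ((hasFDerivAt_id y).const_sub x)
  have h2 : fderiv ℝ (fun y => φ (x - y)) y = _ := h.fderiv
  rw [pd, h2]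
  simp [pd]

lemma integrable_mol {p φ : Plane → ℝ} (hp : LocallyIntegrable p) (hφ : ContDiff ℝ ∞ φ)
    (hc : HasCompactSupport φ) (x : Plane) : Integrable fun y => p y * φ (x - y) :=
  integrable_mul_test hp (hφ.continuous.comp (continuous_const.sub continuous_id))
    (hasCompactSupport_comp_sub hc x)

/-- The mollified velocity is solenoidal: test the weak equation with `φ (x - ·)`. -/
lemma BrokenFlow.mol_divergence {f : ℝ → ℝ} (hf : IsInterface f) {μ : ℝ}
    {W : ℝ → Fin 2 → Plane → ℝ} {G : ℝ → Fin 2 → Fin 2 → Plane → ℝ} {Q : ℝ → Plane → ℝ}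
    (h : BrokenFlow f μ W G Q) {φ : Plane → ℝ} (hφ : ContDiff ℝ ∞ φ) (hc : HasCompactSupport φ)
    (x : Plane) : ∑ i, mol (glue f fun ε => W ε i) (pd i φ) x = 0 := by
  have hw := fun i => locallyIntegrable_glue hf.continuous fun ε hε => h.continuousOn_W ε hε i
  have key := h.weak_divergence hf (ψ := fun y => φ (x - y))
    (hφ.comp (contDiff_const.sub contDiff_id)) (hasCompactSupport_comp_sub hc x)
  simp only [pd_comp_sub (differentiable_test hφ), mul_neg, Finset.sum_neg_distrib] at key
  rw [integral_neg, neg_eq_zero, integral_finsetSum _ fun i _ =>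
    integrable_mol (hw i) (contDiff_pd hφ i) (hasCompactSupport_pd hc i) x] at key
  exact key

/-- The mollified flow satisfies the momentum equation, with the derivatives moved to the mollifier. -/
lemma BrokenFlow.mol_momentum {f : ℝ → ℝ} (hf : IsInterface f) {μ : ℝ}
    {W : ℝ → Fin 2 → Plane → ℝ} {G : ℝ → Fin 2 → Fin 2 → Plane → ℝ} {Q : ℝ → Plane → ℝ}
    (h : BrokenFlow f μ W G Q) {φ : Plane → ℝ} (hφ : ContDiff ℝ ∞ φ) (hc : HasCompactSupport φ)
    (j : Fin 2) (x : Plane) :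
    mol (glue f Q) (pd j φ) x = μ * ∑ i, mol (glue f fun ε => W ε j) (pd i (pd i φ)) x := by
  have hw := locallyIntegrable_glue hf.continuous fun ε hε => h.continuousOn_W ε hε j
  have hq := locallyIntegrable_glue hf.continuous h.continuousOn_Q
  have key := h.weak_momentum hf (ψ := fun y => φ (x - y))
    (hφ.comp (contDiff_const.sub contDiff_id)) (hasCompactSupport_comp_sub hc x) j
  simp only [pd_comp_sub (differentiable_test hφ), pd_neg,
    pd_comp_sub (differentiable_test (contDiff_pd hφ _)), mul_neg, neg_neg] at key
  have i1 := fun i => integrable_mol hw (contDiff_pd (contDiff_pd hφ i) i)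
    (hasCompactSupport_pd (hasCompactSupport_pd hc i) i) x
  rw [integral_add (integrable_mol hq (contDiff_pd hφ j) (hasCompactSupport_pd hc j) x).fun_neg
    ((integrable_finsetSum _ fun i _ => i1 i).const_mul μ), integral_neg, integral_const_mul,
    integral_finsetSum _ fun i _ => i1 i] at key
  unfold mol
  linarith

lemma ae_eq_zero_of_mol {p : Plane → ℝ} (hp : LocallyIntegrable p)
    (h : ∀ φ : Plane → ℝ, ContDiff ℝ ∞ φ → HasCompactSupport φ → ∀ x, mol p φ x = 0) :
    ∀ᵐ x, p x = 0 := by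
  refine ae_eq_zero_of_integral_contDiff_smul_eq_zero hp fun φ hφ hc => ?_
  have := h (fun y => φ (-y)) (hφ.comp contDiff_neg) (hc.comp_homeomorph (Homeomorph.neg _)) 0
  simpa [mol, mul_comm] using this

lemma eq_zero_on_side {f : ℝ → ℝ} (hf : Continuous f) {u : ℝ → Plane → ℝ}
    (hu : ∀ ε, ε ^ 2 = 1 → ContinuousOn (u ε) (closure (side f ε)))
    (h0 : ∀ᵐ x, glue f u x = 0) {ε : ℝ} (hε : ε ^ 2 = 1) : ∀ x ∈ side f ε, u ε x = 0 := by
  have ho := isOpen_side hf ε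
  refine Measure.eqOn_open_of_ae_eq (μ := volume) (g := fun _ => 0) ?_ ho
    ((hu ε hε).mono subset_closure) continuousOn_const
  filter_upwards [ae_restrict_mem ho.measurableSet, ae_restrict_of_ae h0] with x hx h
  rw [← glue_eq u hε hx, h]

/-- A flow without surface forces that vanishes at infinity is trivial: after mollification it is an
entire solution of the Stokes system, whose pressure, and then velocity, is harmonic. -/
theorem BrokenFlow.eq_zero {f : ℝ → ℝ} (hf : IsInterface f) {μ : ℝ} (hμ : 0 < μ)
    {W : ℝ → Fin 2 → Plane → ℝ} {G : ℝ → Fin 2 → Fin 2 → Plane → ℝ} {Q : ℝ → Plane → ℝ}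
    (h : BrokenFlow f μ W G Q) {ε : ℝ} (hε : ε ^ 2 = 1) :
    ∀ x ∈ side f ε, (∀ j, W ε j x = 0) ∧ Q ε x = 0 := by
  have hw := fun j => locallyIntegrable_glue hf.continuous fun ε hε => h.continuousOn_W ε hε j
  have hq := locallyIntegrable_glue hf.continuous h.continuousOn_Q
  -- the divergence of the mollified momentum equation: the mollified pressure is harmonic
  have hQ0 : ∀ᵐ x, glue f Q x = 0 := by
    refine ae_eq_zero_of_mol hq fun φ hφ hc => eq_zero_of_harmonic
      ((contDiff_mol hq hφ hc).of_le ENat.LEInfty.out) (fun x => ?_)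
      (tendsto_mol (glue_decay hf.continuous h.decay_Q) hφ hc)
    have e : ∀ j, pd j (pd j (mol (glue f Q) φ)) x =
        μ * ∑ i, mol (glue f fun ε => W ε j) (pd j (pd i (pd i φ))) x := by
      intro j
      rw [pd_mol hq hφ hc, pd_mol hq (contDiff_pd hφ j) (hasCompactSupport_pd hc j),
        h.mol_momentum hf (contDiff_pd hφ j) (hasCompactSupport_pd hc j)]
      have hcomm : ∀ i, pd i (pd i (pd j φ)) = pd j (pd i (pd i φ)) := by
        intro i
        have c1 : pd i (pd j φ) = pd j (pd i φ) := funext fun y =>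
          pd_comm ((hφ.of_le ENat.LEInfty.out : ContDiff ℝ 2 φ).contDiffAt) i j
        rw [c1]
        exact funext fun y => pd_comm
          (((contDiff_pd hφ i).of_le ENat.LEInfty.out : ContDiff ℝ 2 _).contDiffAt) i j
      simp only [hcomm]
    simp only [e]
    rw [← Finset.mul_sum, Finset.sum_comm]
    refine mul_eq_zero_of_right _ (Finset.sum_eq_zero fun i _ => ?_)
    exact h.mol_divergence hf (contDiff_pd (contDiff_pd hφ i) i)
      (hasCompactSupport_pd (hasCompactSupport_pd hc i) i) x
  have hQ1 : ∀ φ : Plane → ℝ, ∀ x, mol (glue f Q) φ x = 0 := fun φ x =>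
    integral_eq_zero_of_ae (by filter_upwards [hQ0] with y hy; simp [hy])
  have hW0 : ∀ j, ∀ᵐ x, glue f (fun ε => W ε j) x = 0 := by
    intro j
    refine ae_eq_zero_of_mol (hw j) fun φ hφ hc => eq_zero_of_harmonic
      ((contDiff_mol (hw j) hφ hc).of_le ENat.LEInfty.out) (fun x => ?_)
      (tendsto_mol (glue_decay hf.continuous fun ε hε => h.decay_W ε hε j) hφ hc)
    have hm := h.mol_momentum hf hφ hc j x
    rw [hQ1] at hm
    have := (mul_eq_zero.1 hm.symm).resolve_left hμ.ne'
    rw [← this]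
    refine Finset.sum_congr rfl fun i _ => ?_
    rw [pd_mol (hw j) hφ hc, pd_mol (hw j) (contDiff_pd hφ i) (hasCompactSupport_pd hc i)]
  exact fun x hx => ⟨fun j => eq_zero_on_side hf.continuous
    (fun ε hε => h.continuousOn_W ε hε j) (hW0 j) hε x hx,
    eq_zero_on_side hf.continuous h.continuousOn_Q hQ0 hε x hx⟩

/-! ### Differences of solutions -/

lemma ExtendsCont.sub {F : Type*} [NormedAddCommGroup F] {Ω : Set Plane} {u u' w : Plane → F}
    (h : ExtendsCont Ω u) (h' : ExtendsCont Ω u') (hw : ∀ x ∈ Ω, w x = u x - u' x) :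
    ExtendsCont Ω w := by
  obtain ⟨V, hV, e⟩ := h
  obtain ⟨V', hV', e'⟩ := h'
  exact ⟨fun x => V x - V' x, hV.sub hV', fun x hx => by simp only [e hx, e' hx, hw x hx]⟩

lemma pd_sub {F : Type*} [NormedAddCommGroup F] [NormedSpace ℝ F] {u v : Plane → F} {x : Plane}
    (hu : DifferentiableAt ℝ u x) (hv : DifferentiableAt ℝ v x) (l : Fin 2) :
    pd l (fun y => u y - v y) x = pd l u x - pd l v x := by
  rw [pd, (hu.hasFDerivAt.fun_sub hv.hasFDerivAt).fderiv]
  simp [pd]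

lemma IsStokesPhase.differentiableAt_v {μ : ℝ} {Ω : Set Plane} {v : Plane → Plane}
    {q : Plane → ℝ} (h : IsStokesPhase μ Ω v q) (hΩ : IsOpen Ω) {x : Plane} (hx : x ∈ Ω) :
    DifferentiableAt ℝ v x :=
  (h.contDiffOn_v.contDiffAt (hΩ.mem_nhds hx)).differentiableAt (by norm_num)

lemma IsStokesPhase.differentiableAt_q {μ : ℝ} {Ω : Set Plane} {v : Plane → Plane}
    {q : Plane → ℝ} (h : IsStokesPhase μ Ω v q) (hΩ : IsOpen Ω) {x : Plane} (hx : x ∈ Ω) :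
    DifferentiableAt ℝ q x :=
  (h.contDiffOn_q.contDiffAt (hΩ.mem_nhds hx)).differentiableAt (by norm_num)

lemma IsStokesPhase.sub {μ : ℝ} {Ω : Set Plane} (hΩ : IsOpen Ω) {v v' : Plane → Plane}
    {q q' : Plane → ℝ} (h : IsStokesPhase μ Ω v q) (h' : IsStokesPhase μ Ω v' q') :
    IsStokesPhase μ Ω (fun x => v x - v' x) (fun x => q x - q' x) where
  contDiffOn_v := h.contDiffOn_v.sub h'.contDiffOn_v
  extends_v := h.extends_v.sub h'.extends_v fun _ _ => rfl
  extends_Dv := h.extends_Dv.sub h'.extends_Dv fun _ hx =>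
    ((h.differentiableAt_v hΩ hx).hasFDerivAt.fun_sub (h'.differentiableAt_v hΩ hx).hasFDerivAt).fderiv
  contDiffOn_q := h.contDiffOn_q.sub h'.contDiffOn_q
  extends_q := h.extends_q.sub h'.extends_q fun _ _ => rfl
  momentum x hx := by
    have e1 : Laplacian.laplacian (fun x => v x - v' x) x =
        Laplacian.laplacian v x - Laplacian.laplacian v' x :=
      (h.contDiffOn_v.contDiffAt (hΩ.mem_nhds hx)).laplacian_sub
        (h'.contDiffOn_v.contDiffAt (hΩ.mem_nhds hx))
    have e2 : gradient (fun x => q x - q' x) x = gradient q x - gradient q' x := by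
      ext j
      rw [PiLp.sub_apply, gradient_apply, gradient_apply, gradient_apply,
        pd_sub (h.differentiableAt_q hΩ hx) (h'.differentiableAt_q hΩ hx)]
    have m := h.momentum x hx
    have m' := h'.momentum x hx
    rw [e1, e2, smul_sub, sub_sub_sub_comm, m, m', sub_zero]
  incompressible x hx := by
    have d := h.incompressible x hx
    have d' := h'.incompressible x hx
    simp only [divergence, pd_sub (h.differentiableAt_v hΩ hx) (h'.differentiableAt_v hΩ hx),
      PiLp.sub_apply, Finset.sum_sub_distrib] at d d' ⊢
    rw [d, d', sub_zero]
  decay_v := by simpa using h.decay_v.sub h'.decay_v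
  decay_q := by simpa using h.decay_q.sub h'.decay_q

lemma isOpen_omegaPlus {f : ℝ → ℝ} (hf : Continuous f) : IsOpen (OmegaPlus f) := by
  rw [omegaPlus_eq]; exact isOpen_side hf 1

lemma isOpen_omegaMinus {f : ℝ → ℝ} (hf : Continuous f) : IsOpen (OmegaMinus f) := by
  rw [omegaMinus_eq]; exact isOpen_side hf (-1)

lemma IsStokesPhase.stress_sub {μ : ℝ} {Ω : Set Plane} (hΩ : IsOpen Ω) {v v' : Plane → Plane}
    {q q' : Plane → ℝ} (h : IsStokesPhase μ Ω v q) (h' : IsStokesPhase μ Ω v' q') {x : Plane}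
    (hx : x ∈ Ω) : stress μ (fun x => v x - v' x) (fun x => q x - q' x) x =
      stress μ v q x - stress μ v' q' x := by
  ext i j
  simp only [stress, Matrix.of_apply, Matrix.sub_apply,
    pd_sub (h.differentiableAt_v hΩ hx) (h'.differentiableAt_v hΩ hx), PiLp.sub_apply]
  ring

/-- The problem is affine in the surface tension. -/
lemma IsSolution.sub {f : ℝ → ℝ} (hf : Continuous f) {μ σ σ' : ℝ} {vp vm vp' vm' : Plane → Plane}
    {qp qm qp' qm' : Plane → ℝ} (h : IsSolution f μ σ vp vm qp qm)
    (h' : IsSolution f μ σ' vp' vm' qp' qm') :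
    IsSolution f μ (σ - σ') (fun x => vp x - vp' x) (fun x => vm x - vm' x)
      (fun x => qp x - qp' x) (fun x => qm x - qm' x) where
  upper := h.upper.sub (isOpen_omegaPlus hf) h'.upper
  lower := h.lower.sub (isOpen_omegaMinus hf) h'.lower
  velocity_jump ξ := by
    obtain ⟨a, b, ta, tb, e⟩ := h.velocity_jump ξ
    obtain ⟨a', b', ta', tb', e'⟩ := h'.velocity_jump ξ
    exact ⟨a - a', b - b', ta.sub ta', tb.sub tb', by
      rw [sub_sub_sub_comm, ← e, ← e', sub_zero]⟩
  stress_jump ξ := by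
    obtain ⟨J, ⟨a, b, ta, tb, e⟩, hJ⟩ := h.stress_jump ξ
    obtain ⟨J', ⟨a', b', ta', tb', e'⟩, hJ'⟩ := h'.stress_jump ξ
    refine ⟨J - J', ⟨a - a', b - b', (ta.sub ta').congr' ?_, (tb.sub tb').congr' ?_, ?_⟩, fun i => ?_⟩
    · filter_upwards [self_mem_nhdsWithin] with x hx
      exact (h.upper.stress_sub (isOpen_omegaPlus hf) h'.upper hx).symm
    · filter_upwards [self_mem_nhdsWithin] with x hx
      exact (h.lower.stress_sub (isOpen_omegaMinus hf) h'.lower hx).symm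
    · rw [sub_sub_sub_comm, e, e']
    · simp only [Matrix.sub_apply, sub_mul, Finset.sum_sub_distrib, hJ, hJ']
      ring

lemma nhdsWithin_side_neBot {f : ℝ → ℝ} {ε : ℝ} (hε : ε ^ 2 = 1) (ξ : ℝ) :
    (𝓝[side f ε] (Xi f ξ)).NeBot :=
  mem_closure_iff_nhdsWithin_neBot.1 (mem_closure_side hε (by simp [gap, Xi]))

/-- A solution without surface tension, extended to the closures of the two domains. -/
lemma IsSolution.exists_brokenFlow {f : ℝ → ℝ} (hf : Continuous f) {μ : ℝ} {vp vm : Plane → Plane}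
    {qp qm : Plane → ℝ} (h : IsSolution f μ 0 vp vm qp qm) :
    ∃ W G Q, BrokenFlow f μ W G Q ∧
      (∀ x ∈ side f 1, (∀ j, W 1 j x = vp x j) ∧ Q 1 x = qp x) ∧
      (∀ x ∈ side f (-1), (∀ j, W (-1) j x = vm x j) ∧ Q (-1) x = qm x) := by
  classical
  obtain ⟨v, hv1, hv2⟩ : ∃ v : ℝ → Plane → Plane, v 1 = vp ∧ v (-1) = vm :=
    ⟨fun ε => if ε = 1 then vp else vm, if_pos rfl, if_neg (by norm_num)⟩
  obtain ⟨q, hq1, hq2⟩ : ∃ q : ℝ → Plane → ℝ, q 1 = qp ∧ q (-1) = qm :=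
    ⟨fun ε => if ε = 1 then qp else qm, if_pos rfl, if_neg (by norm_num)⟩
  have e1 : (1 : ℝ) ^ 2 = 1 := by norm_num
  have e2 : (-1 : ℝ) ^ 2 = 1 := by norm_num
  have hp : ∀ ε, ε ^ 2 = 1 → IsStokesPhase μ (side f ε) (v ε) (q ε) := by
    intro ε hε
    rcases (abs_eq zero_le_one).1 (abs_eq_one_of_sq hε) with rfl | rfl
    · rw [← omegaPlus_eq, hv1, hq1]; exact h.upper
    · rw [← omegaMinus_eq, hv2, hq2]; exact h.lower
  choose! V hVc hVe using fun ε hε => (hp ε hε).extends_v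
  choose! H hHc hHe using fun ε hε => (hp ε hε).extends_Dv
  choose! Q hQc hQe using fun ε hε => (hp ε hε).extends_q
  have ho := fun ε => isOpen_side hf ε
  have hvd : ∀ ε, ε ^ 2 = 1 → ∀ x ∈ side f ε, DifferentiableAt ℝ (v ε) x := fun ε hε x hx =>
    (hp ε hε).differentiableAt_v (ho ε) hx
  have hvC : ∀ ε, ε ^ 2 = 1 → ∀ j, ∀ x ∈ side f ε, ContDiffAt ℝ 2 (fun y => v ε y j) x :=
    fun ε hε j x hx =>
      contDiffAt_euclidean.1 ((hp ε hε).contDiffOn_v.contDiffAt ((ho ε).mem_nhds hx)) j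
  have hW : ∀ ε, ε ^ 2 = 1 → ∀ j, ∀ x ∈ side f ε, V ε x j = v ε x j := fun ε hε j x hx => by
    rw [hVe ε hε hx]
  have hG : ∀ ε, ε ^ 2 = 1 → ∀ i j, ∀ x ∈ side f ε, H ε x (EuclideanSpace.single i 1) j =
      pd i (fun y => v ε y j) x := fun ε hε i j x hx => by
    rw [hHe ε hε hx, ← pd_apply (hvd ε hε x hx)]; rfl
  have hGd : ∀ ε, ε ^ 2 = 1 → ∀ i j, ∀ x ∈ side f ε,
      DifferentiableAt ℝ (pd i fun y => v ε y j) x := fun ε hε i j x hx =>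
    (((hvC ε hε j x hx).fderiv_right (m := 1) (by norm_num)).differentiableAt
      (by norm_num)).clm_apply (differentiableAt_const _)
  have hev : ∀ ε {u w : Plane → ℝ}, (∀ x ∈ side f ε, u x = w x) → ∀ x ∈ side f ε, u =ᶠ[𝓝 x] w :=
    fun ε u w huw x hx => by filter_upwards [(ho ε).mem_nhds hx] with y hy using huw y hy
  have hself : ∀ ε : ℝ, ∀ᶠ x in Bornology.cobounded Plane ⊓ 𝓟 (side f ε), x ∈ side f ε :=
    fun ε => mem_inf_of_right (mem_principal_self _)
  have hcl : ∀ ε, ε ^ 2 = 1 → ∀ s, Xi f s ∈ closure (side f ε) := fun ε hε s =>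
    mem_closure_side hε (by simp [gap, Xi])
  have hlimV : ∀ ε, ε ^ 2 = 1 → ∀ s, Tendsto (v ε) (𝓝[side f ε] (Xi f s)) (𝓝 (V ε (Xi f s))) := by
    intro ε hε s
    refine (((hVc ε hε) _ (hcl ε hε s)).mono_left
      (nhdsWithin_mono _ subset_closure)).congr' ?_
    filter_upwards [self_mem_nhdsWithin] with x hx using hVe ε hε hx
  have hlimT : ∀ ε, ε ^ 2 = 1 → ∀ s, Tendsto (stress μ (v ε) (q ε)) (𝓝[side f ε] (Xi f s))
      (𝓝 (Matrix.of fun i j => -Q ε (Xi f s) * (if i = j then 1 else 0) +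
        μ * (H ε (Xi f s) (EuclideanSpace.single i 1) j +
          H ε (Xi f s) (EuclideanSpace.single j 1) i))) := by
    intro ε hε s
    refine tendsto_pi_nhds.2 fun i => tendsto_pi_nhds.2 fun j => ?_
    have tH : ∀ i j, Tendsto (fun x => pd i (v ε) x j) (𝓝[side f ε] (Xi f s))
        (𝓝 (H ε (Xi f s) (EuclideanSpace.single i 1) j)) := by
      intro i j
      have t0 : Tendsto (H ε) (𝓝[side f ε] (Xi f s)) (𝓝 (H ε (Xi f s))) :=
        ((hHc ε hε) _ (hcl ε hε s)).mono_left (nhdsWithin_mono _ subset_closure)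
      have hc : Continuous fun L : Plane →L[ℝ] Plane => L (EuclideanSpace.single i 1) j :=
        (EuclideanSpace.proj j : Plane →L[ℝ] ℝ).continuous.comp
          (continuous_id.clm_apply continuous_const)
      have t2 := (hc.tendsto _).comp t0
      refine t2.congr' ?_
      filter_upwards [self_mem_nhdsWithin] with x hx
      simp only [Function.comp, hHe ε hε hx]; rfl
    have tQ : Tendsto (q ε) (𝓝[side f ε] (Xi f s)) (𝓝 (Q ε (Xi f s))) := by
      refine (((hQc ε hε) _ (hcl ε hε s)).mono_left
        (nhdsWithin_mono _ subset_closure)).congr' ?_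
      filter_upwards [self_mem_nhdsWithin] with x hx using hQe ε hε hx
    exact (tQ.neg.mul_const _).add (((tH i j).add (tH j i)).const_mul μ)
  refine ⟨fun ε j x => V ε x j, fun ε i j x => H ε x (EuclideanSpace.single i 1) j, Q,
    ?_, fun x hx => ⟨fun j => ?_, ?_⟩, fun x hx => ⟨fun j => ?_, ?_⟩⟩
  · constructor
    · exact fun ε hε j => (EuclideanSpace.proj j : Plane →L[ℝ] ℝ).continuous.comp_continuousOn
        (hVc ε hε)
    · exact fun ε hε i j => (EuclideanSpace.proj j : Plane →L[ℝ] ℝ).continuous.comp_continuousOn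
        ((hHc ε hε).clm_apply continuousOn_const)
    · exact hQc
    · exact fun ε hε j x hx => ((hvC ε hε j x hx).differentiableAt
        (by norm_num)).congr_of_eventuallyEq (hev ε (hW ε hε j) x hx)
    · exact fun ε hε i j x hx => (hGd ε hε i j x hx).congr_of_eventuallyEq
        (hev ε (hG ε hε i j) x hx)
    · exact fun ε hε x hx => ((hp ε hε).differentiableAt_q (ho ε) hx).congr_of_eventuallyEq
        (hev ε (hQe ε hε) x hx)
    · intro ε hε i j x hx
      rw [pd_congr_on (ho ε) (hW ε hε j) i hx, hG ε hε i j x hx]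
    · intro ε hε i j k x hx
      rw [pd_congr_on (ho ε) (hG ε hε j k) i hx, pd_congr_on (ho ε) (hG ε hε i k) j hx,
        pd_comm (hvC ε hε k x hx)]
    · intro ε hε j x hx
      have m := congrArg (fun z : Plane => z j) ((hp ε hε).momentum x hx)
      simp only [PiLp.sub_apply, PiLp.smul_apply, PiLp.zero_apply, gradient_apply, smul_eq_mul,
        laplacian_apply ((hp ε hε).contDiffOn_v.contDiffAt ((ho ε).mem_nhds hx))] at m
      rw [pd_congr_on (ho ε) (hQe ε hε) j hx]
      simp only [fun i => pd_congr_on (ho ε) (hG ε hε i j) i hx]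
      linarith
    · intro ε hε x hx
      have d := (hp ε hε).incompressible x hx
      simp only [divergence, pd_apply (hvd ε hε x hx)] at d
      simpa only [hG ε hε _ _ x hx] using d
    · intro j s
      obtain ⟨a, b, ta, tb, e⟩ := h.velocity_jump s
      rw [omegaPlus_eq, ← hv1] at ta
      rw [omegaMinus_eq, ← hv2] at tb
      have := nhdsWithin_side_neBot (f := f) e1 s
      have := nhdsWithin_side_neBot (f := f) e2 s
      have t1 := hlimV 1 e1 s
      have t2 := hlimV (-1) e2 s
      change V 1 (Xi f s) j = V (-1) (Xi f s) j
      rw [tendsto_nhds_unique t1 ta, tendsto_nhds_unique t2 tb, sub_eq_zero.1 e.symm]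
    · intro j s
      obtain ⟨J, ⟨a, b, ta, tb, e⟩, hJ⟩ := h.stress_jump s
      rw [omegaPlus_eq, ← hv1, ← hq1] at ta
      rw [omegaMinus_eq, ← hv2, ← hq2] at tb
      have := nhdsWithin_side_neBot (f := f) e1 s
      have := nhdsWithin_side_neBot (f := f) e2 s
      have ea := tendsto_nhds_unique ta (hlimT 1 e1 s)
      have eb := tendsto_nhds_unique tb (hlimT (-1) e2 s)
      have o := (omega_pos f s).ne'
      -- the stress is symmetric, and the jump condition may be multiplied by `ω`
      have hj := congrArg (fun z => omega f s * z) (hJ j)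
      simp only [e, ea, eb, Matrix.sub_apply, Matrix.of_apply, Fin.sum_univ_two, nu_zero, nu_one,
        neg_zero, zero_mul, mul_zero] at hj
      field_simp at hj
      fin_cases j <;> simp [Fin.sum_univ_two] at hj ⊢ <;> linear_combination hj
    · intro ε hε j
      have t := ((EuclideanSpace.proj j : Plane →L[ℝ] ℝ).continuous.tendsto _).comp (hp ε hε).decay_v
      rw [map_zero] at t
      refine t.congr' ?_
      filter_upwards [hself ε] with x hx using (hW ε hε j x hx).symm
    · intro ε hε
      refine (hp ε hε).decay_q.congr' ?_
      filter_upwards [hself ε] with x hx using (hQe ε hε hx).symm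
  · exact (hW 1 e1 j x hx).trans (by rw [hv1])
  · rw [hQe 1 e1 hx, hq1]
  · exact (hW (-1) e2 j x hx).trans (by rw [hv2])
  · rw [hQe (-1) e2 hx, hq2]

end StokesGraph

/-- `hfc` selects the continuous representative of the class `f ∈ H³(ℝ)`. -/
theorem theorem2p1 (f : ℝ → ℝ) (hfc : Continuous f) (hf : StokesGraph.MemH 3 f)
    (μ σ : ℝ) (hμ : 0 < μ) (hσ : 0 < σ) :
    -- the integrals exist away from the interface, and the two representations agree
    (∀ x ∈ (StokesGraph.Gam f)ᶜ,
      Integrable (StokesGraph.velocityIntegrand f μ x) ∧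
      Integrable (StokesGraph.pressureIntegrand f x) ∧
      Integrable (StokesGraph.repIntegrand f μ σ x) ∧
      Integrable (StokesGraph.repIntegrand' f μ σ x) ∧
      (StokesGraph.velocity f μ σ x, StokesGraph.pressure f σ x) =
        -∫ s, StokesGraph.repIntegrand f μ σ x s ∧
      (StokesGraph.velocity f μ σ x, StokesGraph.pressure f σ x) =
        ∫ s, StokesGraph.repIntegrand' f μ σ x s) ∧
    -- the potential is a solution
    StokesGraph.IsSolution f μ σ
      (StokesGraph.velocity f μ σ) (StokesGraph.velocity f μ σ)
      (StokesGraph.pressure f σ) (StokesGraph.pressure f σ) ∧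
    -- it is the only one
    ∀ (vp vm : StokesGraph.Plane → StokesGraph.Plane) (qp qm : StokesGraph.Plane → ℝ),
      StokesGraph.IsSolution f μ σ vp vm qp qm →
        Set.EqOn vp (StokesGraph.velocity f μ σ) (StokesGraph.OmegaPlus f) ∧
        Set.EqOn vm (StokesGraph.velocity f μ σ) (StokesGraph.OmegaMinus f) ∧
        Set.EqOn qp (StokesGraph.pressure f σ) (StokesGraph.OmegaPlus f) ∧
        Set.EqOn qm (StokesGraph.pressure f σ) (StokesGraph.OmegaMinus f) := by
  obtain ⟨c, s1, s2⟩ := StokesGraph.MemH.regularity hfc hf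
  have hI : StokesGraph.IsInterface f := ⟨c, s1, s2⟩
  refine ⟨fun x hx => ?_, hI.isSolution hμ σ, fun vp vm qp qm h => ?_⟩
  · have hx : StokesGraph.gap f x ≠ 0 := fun h => hx (StokesGraph.mem_gam_iff.2 h)
    have e : StokesGraph.repIntegrand f μ σ x = fun s => -StokesGraph.repIntegrand' f μ σ x s :=
      funext fun s => hI.repIntegrand_eq_neg μ σ hx s
    refine ⟨hI.integrable_velocityIntegrand μ hx, hI.integrable_pressureIntegrand hx, ?_,
      hI.integrable_repIntegrand' μ σ hx, ?_, hI.integral_repIntegrand' μ σ hx⟩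
    · rw [e]; exact (hI.integrable_repIntegrand' μ σ hx).neg
    · rw [e, integral_neg, neg_neg]; exact hI.integral_repIntegrand' μ σ hx
  · have d := h.sub hI.continuous (hI.isSolution hμ σ)
    rw [sub_self] at d
    obtain ⟨W, G, Q, hB, hp, hm⟩ := d.exists_brokenFlow hI.continuous
    rw [StokesGraph.omegaPlus_eq, StokesGraph.omegaMinus_eq]
    have zp := hB.eq_zero hI hμ (ε := 1) (by norm_num)
    have zm := hB.eq_zero hI hμ (ε := -1) (by norm_num)
    refine ⟨fun x hx => ?_, fun x hx => ?_, fun x hx => ?_, fun x hx => ?_⟩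
    · exact sub_eq_zero.1 (PiLp.ext fun j => ((hp x hx).1 j).symm.trans ((zp x hx).1 j))
    · exact sub_eq_zero.1 (PiLp.ext fun j => ((hm x hx).1 j).symm.trans ((zm x hx).1 j))
    · exact sub_eq_zero.1 ((hp x hx).2.symm.trans (zp x hx).2)
    · exact sub_eq_zero.1 ((hm x hx).2.symm.trans (zm x hx).2)
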